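/- Let $\mathrm{Un}=\{\neg,\mathbf X,\mathbf F,\mathbf G\}$ be the unary LTL operators and let $\mathrm{Bin}=\{\lor,\wedge,\Rightarrow,\Leftarrow,\Leftrightarrow\}\cup\{\text{their negations}\}$ be the ten logical binary operators. For an LTL formula $\varphi$, its size $|\varphi|$ is its number of distinct sub-formulas, and $|\varphi|_{\mathrm{Bin}}$ is the number of its distinct sub-formulas whose outermost operator is binary. For all sets $\mathsf U\subseteq\mathrm{Un}$ and $\mathsf B\subseteq\mathrm{Bin}$ and every fixed $n\in\mathbb N$, the following decision problem is in $\mathsf L$ (deterministic logarithmic space). Input: a finite set $\mathsf{Prop}$ of propositions, two finite collections $\mathcal P,\mathcal N$ of ultimately periodic words $u\cdot v^\omega$ with $u\in(2^{\mathsf{Prop}})^*$ and $v\in(2^{\mathsf{Prop}})^+$ (each given by the pair $(u,v)$, letters written as bit vectors), and a bound $B\in\mathbb N$ written in unary. Question: is there an LTL formula $\varphi$ over $\mathsf{Prop}$, built from propositions with operators in $\mathsf U\cup\mathsf B$ only, such that $|\varphi|\le B$, $|\varphi|_{\mathrm{Bin}}\le n$, $w\models\varphi$ for all $w\in\mathcal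 P$, and $w\not\models\varphi$ for all $w\in\mathcal N$? -/

import Mathlib

/-! ### LTL: syntax and semantics -/

/-- Unary operators: negation, next, future, globally. -/
inductive UnOp
  | not | X | F | G
  deriving DecidableEq

/-- Binary temporal operators: until, release, weak until, mighty release. -/
inductive BinTempOp
  | U | R | W | M
  deriving DecidableEq

/-- Binary logical operators: the classical ones and their negations. -/
inductive BinLogOp
  | or | and | imp | revImp | iff
  | nor | nand | nimp | nrevImp | niff
  deriving DecidableEq

/-- The truth function of a binary logical operator. -/
def BinLogOp.eval : BinLogOp → Prop → Prop → Prop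
  | .or, a, b => a ∨ b
  | .and, a, b => a ∧ b
  | .imp, a, b => a → b
  | .revImp, a, b => b → a
  | .iff, a, b => a ↔ b
  | .nor, a, b => ¬ (a ∨ b)
  | .nand, a, b => ¬ (a ∧ b)
  | .nimp, a, b => ¬ (a → b)
  | .nrevImp, a, b => ¬ (b → a)
  | .niff, a, b => ¬ (a ↔ b)

/-- LTL formulas over a type `α` of propositions. -/
inductive LTL (α : Type)
  | atom (p : α)
  | un (o : UnOp) (φ : LTL α)
  | binTemp (o : BinTempOp) (φ ψ : LTL α)
  | binLog (o : BinLogOp) (φ ψ : LTL α)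
  deriving DecidableEq

namespace LTL

variable {α : Type}

/-- The formula uses only operators from the given sets. -/
def UsesOnly (Ut : Set UnOp) (Bt : Set BinTempOp) (Bl : Set BinLogOp) : LTL α → Prop
  | atom _ => True
  | un o φ => o ∈ Ut ∧ UsesOnly Ut Bt Bl φ
  | binTemp o φ ψ => o ∈ Bt ∧ UsesOnly Ut Bt Bl φ ∧ UsesOnly Ut Bt Bl ψ
  | binLog o φ ψ => o ∈ Bl ∧ UsesOnly Ut Bt Bl φ ∧ UsesOnly Ut Bt Bl ψ

/-- The set of sub-formulas. -/
def subF [DecidableEq α] : LTL α → Finset (LTL α)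
  | atom p => {atom p}
  | un o φ => insert (un o φ) (subF φ)
  | binTemp o φ ψ => insert (binTemp o φ ψ) (subF φ ∪ subF ψ)
  | binLog o φ ψ => insert (binLog o φ ψ) (subF φ ∪ subF ψ)

/-- Whether the outermost operator is binary. -/
def isBin : LTL α → Bool
  | atom _ => false
  | un _ _ => false
  | binTemp _ _ _ => true
  | binLog _ _ _ => true

/-- The size of a formula: its number of distinct sub-formulas. -/
def size [DecidableEq α] (φ : LTL α) : ℕ := φ.subF.card

/-- The number of distinct sub-formulas whose outermost operator is binary. -/
def numBin [DecidableEq α] (φ : LTL α) : ℕ := (φ.subF.filter fun ψ => ψ.isBin = true).card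

/-- The suffix of an infinite word from position `i` on (positions start at `0`). -/
def suffix (w : ℕ → Set α) (i : ℕ) : ℕ → Set α := fun j => w (i + j)

/-- `Sat w φ`: the infinite word `w` over the alphabet of sets of propositions satisfies `φ`. -/
def Sat (w : ℕ → Set α) : LTL α → Prop
  | atom p => p ∈ w 0
  | un .not φ => ¬ Sat w φ
  | un .X φ => Sat (suffix w 1) φ
  | un .F φ => ∃ i, Sat (suffix w i) φ
  | un .G φ => ∀ i, Sat (suffix w i) φ
  | binTemp .U φ ψ => ∃ i, Sat (suffix w i) ψ ∧ ∀ j < i, Sat (suffix w j) φ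
  | binTemp .R φ ψ => ¬ ∃ i, ¬ Sat (suffix w i) ψ ∧ ∀ j < i, ¬ Sat (suffix w j) φ
  | binTemp .W φ ψ =>
      (∃ i, Sat (suffix w i) ψ ∧ ∀ j < i, Sat (suffix w j) φ) ∨ ∀ i, Sat (suffix w i) φ
  | binTemp .M φ ψ =>
      (¬ ∃ i, ¬ Sat (suffix w i) ψ ∧ ∀ j < i, ¬ Sat (suffix w j) φ) ∧ ∃ i, Sat (suffix w i) φ
  | binLog o φ ψ => o.eval (Sat w φ) (Sat w ψ)

end LTL

/-! ### Ultimately periodic words and the learning problem -/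

/-- A presentation of the ultimately periodic word `pre · per^ω` with `per` non-empty; letters are
sets of propositions. -/
structure UPWord (α : Type) where
  pre : List (Finset α)
  per : List (Finset α)
  per_ne : per ≠ []

/-- The infinite word `pre · per^ω`. -/
def UPWord.toWord {α : Type} (w : UPWord α) (i : ℕ) : Set α :=
  if h : i < w.pre.length then (w.pre[i] : Set α)
  else (w.per[(i - w.pre.length) % w.per.length]'
    (Nat.mod_lt _ (List.length_pos_of_ne_nil w.per_ne)) : Set α)

/-- An input of the LTL learning problem: a number of propositions, the finite collections of
positive and negative ultimately periodic words (as explicit lists), and the size bound. -/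
structure LearnInput where
  numProp : ℕ
  pos : List (UPWord (Fin numProp))
  neg : List (UPWord (Fin numProp))
  bound : ℕ

/-- The input is a positive instance of the learning problem for the given sets of operators and
the given bound `n` on the number of occurrences of binary operators. -/
def LearnInput.IsPositive (Ut : Set UnOp) (Bt : Set BinTempOp) (Bl : Set BinLogOp) (n : ℕ∞)
    (I : LearnInput) : Prop :=
  ∃ φ : LTL (Fin I.numProp), φ.UsesOnly Ut Bt Bl ∧ φ.size ≤ I.bound ∧ (φ.numBin : ℕ∞) ≤ n ∧
    (∀ w ∈ I.pos, LTL.Sat w.toWord φ) ∧ (∀ w ∈ I.neg, ¬ LTL.Sat w.toWord φ)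

/-- The finite alphabet in which inputs are written. -/
inductive LearnSym
  | prop | tick | pos | neg | loop | letter | zero | one
  deriving DecidableEq

instance : Fintype LearnSym where
  elems := {.prop, .tick, .pos, .neg, .loop, .letter, .zero, .one}
  complete := by intro x; cases x <;> decide

/-- A letter is written as the symbol `letter` followed by its characteristic bit vector. -/
def encodeLetter {m : ℕ} (a : Finset (Fin m)) : List LearnSym :=
  LearnSym.letter :: List.ofFn fun i => if i ∈ a then LearnSym.one else LearnSym.zero

/-- A word is written as its polarity mark, the letters of the prefix, the symbol `loop`, and the
letters of the period. -/
def encodeWord {m : ℕ} (mark : LearnSym) (w : UPWord (Fin m)) : List LearnSym :=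
  mark :: (w.pre.flatMap encodeLetter ++ LearnSym.loop :: w.per.flatMap encodeLetter)

/-- The encoding of an input; the number of propositions and the size bound are in unary. -/
def LearnInput.encode (I : LearnInput) : List LearnSym :=
  List.replicate I.numProp LearnSym.prop ++ List.replicate I.bound LearnSym.tick ++
    I.pos.flatMap (encodeWord LearnSym.pos) ++ I.neg.flatMap (encodeWord LearnSym.neg)

/-- The LTL learning problem, as the language of the encodings of its positive instances. -/
def LTLLearn (Ut : Set UnOp) (Bt : Set BinTempOp) (Bl : Set BinLogOp) (n : ℕ∞) : Language LearnSym :=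
  {x | ∃ I : LearnInput, I.encode = x ∧ I.IsPositive Ut Bt Bl n}

/-! ### Deterministic logarithmic space -/

/-- Head movements. -/
inductive HeadMove
  | left | stay | right
  deriving DecidableEq

/-- What the input head can read: an input symbol or one of the two end markers. -/
inductive InSym (A : Type)
  | leftEnd
  | sym (a : A)
  | rightEnd

/-- A deterministic Turing machine with a two-way read-only input tape and finitely many one-way
infinite read-write work tapes. The transition function reads the state, the scanned input symbol
and the scanned work symbols; it either halts (`none`) or gives the new state, the move of the
input head, and the symbol to write and the move on each work tape. -/
structure OfflineTM (A : Type) where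
  State : Type
  Work : Type
  tapes : ℕ
  finState : Finite State
  finWork : Finite Work
  start : State
  accept : Set State
  blank : Work
  trans : State → InSym A → (Fin tapes → Work) →
    Option (State × HeadMove × (Fin tapes → Work × HeadMove))

namespace OfflineTM

variable {A : Type}

/-- A configuration: the state, the position of the input head, and the head position and the
contents of every work tape. -/
structure Cfg (M : OfflineTM A) where
  state : M.State
  inPos : ℕ
  head : Fin M.tapes → ℕ
  tape : Fin M.tapes → ℕ → M.Work

/-- The symbol at position `p` of the input tape holding `x`: the left end marker is at position
`0`, the input at positions `1, …, |x|`, the right end marker at position `|x| + 1`. -/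
def readInput (x : List A) : ℕ → InSym A
  | 0 => .leftEnd
  | p + 1 => match x[p]? with
    | some a => .sym a
    | none => .rightEnd

/-- Moving a head on a one-way infinite tape; at position `0` a left move has no effect. -/
def moveHead : HeadMove → ℕ → ℕ
  | .left, p => p - 1
  | .stay, p => p
  | .right, p => p + 1

/-- One step on input `x`; `none` if the machine halts. The input head cannot leave the part of
the tape between the two end markers. -/
def step (M : OfflineTM A) (x : List A) (c : M.Cfg) : Option M.Cfg :=
  (M.trans c.state (readInput x c.inPos) fun i => c.tape i (c.head i)).map fun r =>
    { state := r.1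
      inPos := min (moveHead r.2.1 c.inPos) (x.length + 1)
      head := fun i => moveHead (r.2.2 i).2 (c.head i)
      tape := fun i => Function.update (c.tape i) (c.head i) (r.2.2 i).1 }

/-- The initial configuration. -/
def init (M : OfflineTM A) : M.Cfg where
  state := M.start
  inPos := 0
  head := fun _ => 0
  tape := fun _ _ => M.blank

/-- On every input `x`, the machine halts, it accepts if and only if `x ∈ L`, and during the whole
run every work head stays within the first `s |x|` cells of its tape. -/
def DecidesInSpace (M : OfflineTM A) (L : Language A) (s : ℕ → ℕ) : Prop :=
  ∀ x : List A,
    (∃ c : M.Cfg, StateTransition.Reaches (M.step x) M.init c ∧ M.step x c = none ∧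
      (c.state ∈ M.accept ↔ x ∈ L)) ∧
    ∀ c : M.Cfg, StateTransition.Reaches (M.step x) M.init c → ∀ i, c.head i < s x.length

end OfflineTM

/-- The class of languages decidable in deterministic logarithmic space. -/
def InLogspace {A : Type} [Finite A] (L : Language A) : Prop :=
  ∃ (M : OfflineTM A) (c : ℕ), M.DecidesInSpace L fun n => c * (Nat.log 2 n + 1)

/-! Combinatorial part. A formula with at most `n` binary operators consists of few chains of unary
operators. `X` commutes with the other unary operators, and those generate only ten signed
modalities (id, F, G, FG, GF, each with an optional negation of the argument). So every chain is
equivalent to a power of `X` followed by a chain of length at most 10 that uses no new operators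
(`Modality.ofChain_shrink`, `LTL.exists_short_chain`). In the graph of sub-formulas, call special
those at which chains begin, end or branch. Counting edges shows that there are at most `2 * (2 * n
+ 1)` of them (`LTL.card_special_le`), and that the chains between them do not overlap
(`LTL.sum_segment_le`), so shortening the chains does not increase the size. Hence each formula may
be replaced by an instance of one of finitely many shapes, whose parameters are propositions and
exponents of `X` (`exists_finite_shapes`). The size of an instance is never computed: a linear
expression in the exponents bounds it from above for all parameters, and for the parameters read off
a formula this expression is at most the size of that formula.

Logical part. On `u · v^ω` the operators F and G need to look only `|u| + |v|` positions ahead, so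
truth of a fixed shape is a statement with bounded quantifiers about the symbols of the input. The
parameters are at most the length of the input, because the number of propositions and the size
bound are written in unary. Being a well-formed encoding is expressible in the same way. Thus the
language is defined by one fixed formula of bounded arithmetic with access to the input
(`mem_LTLLearn_iff`, `defPred_solves`).

Machine part. Such a formula is evaluated in logarithmic space (`Fm.inLogspace`): all values are
polynomial in the input length, so a fixed number of binary registers with logarithmically many
digits suffices, and a quantifier is a search loop. The machine is obtained from a structured
program whose residual programs are the states; correctness and the space bound are proved together
by total-correctness triples. -/

/-! ### Structured programs for offline Turing machines -/

/-- Work tape symbols: a mark for the leftmost cell, binary digits, and the blank. -/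
inductive Cell
  | mark | zero | one | blank
  deriving DecidableEq

instance : Finite Cell :=
  Finite.of_injective (fun c : Cell => match c with
    | .mark => (0 : Fin 4) | .zero => 1 | .one => 2 | .blank => 3) (by
      intro a b h; cases a <;> cases b <;> simp_all)

/-- The effect of one step: the move of the input head, the symbol written and the move on every
work tape, and the new value of the flag. -/
abbrev Effect (k : ℕ) := HeadMove × (Fin k → Cell × HeadMove) × Bool

/-- Structured programs over `k` work tapes and one Boolean flag. -/
inductive Prog (A : Type) (k : ℕ)
  | skip
  | act (f : InSym A → (Fin k → Cell) → Bool → Effect k)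
  | seq (p q : Prog A k)
  | ite (t : InSym A → (Fin k → Cell) → Bool → Bool) (p q : Prog A k)
  | loop (t : InSym A → (Fin k → Cell) → Bool → Bool) (p : Prog A k)

/-- The data part of a configuration. -/
@[ext]
structure Store (k : ℕ) where
  inPos : ℕ
  flag : Bool
  head : Fin k → ℕ
  tape : Fin k → ℕ → Cell

namespace Prog

variable {A : Type} {k : ℕ}

/-- The effect that changes nothing. -/
def idle (w : Fin k → Cell) (b : Bool) : Effect k := (.stay, fun i => (w i, .stay), b)

/-- One step of the control. -/
def next : Prog A k → InSym A → (Fin k → Cell) → Bool → Option (Prog A k × Effect k)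
  | skip, _, _, _ => none
  | act f, a, w, b => some (skip, f a w b)
  | seq p q, a, w, b =>
    match next p a w b with
    | none => some (q, idle w b)
    | some r => some (seq r.1 q, r.2)
  | ite t p q, a, w, b => some (if t a w b then p else q, idle w b)
  | loop t p, a, w, b => some (if t a w b then seq p (loop t p) else skip, idle w b)

/-- The residual programs. -/
def residuals : Prog A k → Set (Prog A k)
  | skip => {skip}
  | act f => {act f, skip}
  | seq p q => (fun r => seq r q) '' residuals p ∪ residuals q
  | ite t p q => insert (ite t p q) (residuals p ∪ residuals q)
  | loop t p => {loop t p, skip} ∪ (fun r => seq r (loop t p)) '' residuals p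

/-- The body of a loop is always followed by that same loop, so unfolding creates no new programs.
This allows residuals to serve as machine states. -/
theorem residuals_finite (p : Prog A k) : p.residuals.Finite := by
  induction p with
  | skip => exact Set.finite_singleton _
  | act f => exact (Set.finite_singleton _).insert _
  | seq p q hp hq => exact (hp.image _).union hq
  | ite t p q hp hq => exact (hp.union hq).insert _
  | loop t p hp => exact ((Set.finite_singleton _).insert _).union (hp.image _)

theorem self_mem_residuals (p : Prog A k) : p ∈ p.residuals := by
  induction p with
  | seq p q hp hq => exact Or.inl ⟨p, hp, rfl⟩
  | _ => simp [residuals]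

theorem next_mem_residuals {p₀ p : Prog A k} (hp : p ∈ p₀.residuals) {a w b r}
    (h : p.next a w b = some r) : r.1 ∈ p₀.residuals := by
  induction p₀ generalizing p r with
  | skip => cases hp; simp [next] at h
  | act f =>
    rcases hp with rfl | hp
    · simp only [next, Option.some.injEq] at h; subst h; simp [residuals]
    · cases hp; simp [next] at h
  | seq p' q ihp ihq =>
    rcases hp with ⟨s, hs, rfl⟩ | hp
    · simp only [next] at h
      split at h
      · cases h; exact Or.inr (self_mem_residuals q)
      · next r' hr' => cases h; exact Or.inl ⟨_, ihp hs hr', rfl⟩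
    · exact Or.inr (ihq hp h)
  | ite t p' q ihp ihq =>
    rcases hp with rfl | hp | hp
    · simp only [next, Option.some.injEq] at h; subst h
      dsimp only
      split
      · exact Or.inr (Or.inl (self_mem_residuals _))
      · exact Or.inr (Or.inr (self_mem_residuals _))
    · exact Or.inr (Or.inl (ihp hp h))
    · exact Or.inr (Or.inr (ihq hp h))
  | loop t p' ihp =>
    rcases hp with (rfl | hp) | ⟨s, hs, rfl⟩
    · simp only [next, Option.some.injEq] at h; subst h
      dsimp only
      split
      · exact Or.inr ⟨_, self_mem_residuals _, rfl⟩
      · exact Or.inl (Or.inr rfl)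
    · cases hp; simp [next] at h
    · simp only [next] at h
      split at h
      · cases h; exact Or.inl (Or.inl rfl)
      · next r' hr' => cases h; exact Or.inr ⟨_, ihp hs hr', rfl⟩

/-- The Turing machine that runs a program. -/
def toTM (p₀ : Prog A k) : OfflineTM A where
  State := p₀.residuals × Bool
  Work := Cell
  tapes := k
  finState := by
    have := p₀.residuals_finite.to_subtype
    infer_instance
  finWork := inferInstance
  start := (⟨p₀, p₀.self_mem_residuals⟩, false)
  accept := {s | s.2 = true}
  blank := .blank
  trans := fun s a w =>
    match h : s.1.1.next a w s.2 with
    | none => none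
    | some r => some ((⟨r.1, next_mem_residuals s.1.2 h⟩, r.2.2.2), r.2.1, r.2.2.1)

end Prog

namespace Store

variable {A : Type} {k : ℕ}

/-- The symbols scanned on the work tapes. -/
def scan (s : Store k) : Fin k → Cell := fun i => s.tape i (s.head i)

/-- The store after one step. -/
def apply (x : List A) (s : Store k) (e : Effect k) : Store k where
  inPos := min (OfflineTM.moveHead e.1 s.inPos) (x.length + 1)
  flag := e.2.2
  head := fun i => OfflineTM.moveHead (e.2.1 i).2 (s.head i)
  tape := fun i => Function.update (s.tape i) (s.head i) (e.2.1 i).1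

/-- All work heads are within the first `H` cells. -/
def Within (H : ℕ) (s : Store k) : Prop := ∀ i, s.head i < H

end Store

/-! ### Runs of programs and their simulation by the machine. -/

namespace Prog

variable {A : Type} {k : ℕ} (x : List A) (H : ℕ)

/-- One step of a program that stays within `H` cells. -/
def Step (c d : Prog A k × Store k) : Prop :=
  ∃ e, c.1.next (OfflineTM.readInput x c.2.inPos) c.2.scan c.2.flag = some (d.1, e) ∧
    d.2 = c.2.apply x e ∧ d.2.Within H

/-- The program `p` started in store `s` terminates in store `s'`, staying within `H` cells. -/
def Runs (p : Prog A k) (s s' : Store k) : Prop :=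
  Relation.ReflTransGen (Step x H) (p, s) (skip, s')

variable {x H}

/-- The bound on the input position is needed because `apply` clamps the input head to the right end
marker. -/
theorem apply_idle {s : Store k} (hs : s.inPos ≤ x.length + 1) :
    s.apply x (idle s.scan s.flag) = s := by
  ext1
  · simp [Store.apply, idle, OfflineTM.moveHead, hs]
  · rfl
  · rfl
  · funext i
    simp [Store.apply, idle, Store.scan]

theorem Runs.skip (s : Store k) : Runs x H (skip : Prog A k) s s := Relation.ReflTransGen.refl

theorem Runs.act {f : InSym A → (Fin k → Cell) → Bool → Effect k} {s s' : Store k}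
    (h : s' = s.apply x (f (OfflineTM.readInput x s.inPos) s.scan s.flag)) (hs : s'.Within H) :
    Runs x H (act f) s s' :=
  Relation.ReflTransGen.single ⟨_, rfl, h, hs⟩

theorem steps_seq {p p' q : Prog A k} {s s' : Store k}
    (h : Relation.ReflTransGen (Step x H) (p, s) (p', s')) :
    Relation.ReflTransGen (Step x H) (seq p q, s) (seq p' q, s') := by
  refine Relation.ReflTransGen.lift (p := Step x H)
    (fun c : Prog A k × Store k => (seq c.1 q, c.2)) ?_ _ _ h
  rintro ⟨a, s⟩ ⟨b, s'⟩ ⟨e, h1, h2, h3⟩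
  refine ⟨e, ?_, h2, h3⟩
  simp only at h1 ⊢
  simp [next, h1]

/-- Passing from `p` to `q` is a genuine idle step of the machine, hence the two hypotheses on the
intermediate store. -/
theorem Runs.seq {p q : Prog A k} {s s' s'' : Store k} (h₁ : Runs x H p s s')
    (h₂ : Runs x H q s' s'') (hs : s'.inPos ≤ x.length + 1) (hw : s'.Within H) :
    Runs x H (seq p q) s s'' := by
  refine (steps_seq h₁).trans (.head ⟨idle s'.scan s'.flag, ?_, ?_, hw⟩ h₂)
  · simp [next]
  · exact (apply_idle hs).symm

theorem Runs.ite {t : InSym A → (Fin k → Cell) → Bool → Bool} {p q : Prog A k} {s s' : Store k}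
    (hs : s.inPos ≤ x.length + 1) (hw : s.Within H)
    (h : Runs x H (if t (OfflineTM.readInput x s.inPos) s.scan s.flag then p else q) s s') :
    Runs x H (ite t p q) s s' :=
  .head ⟨idle s.scan s.flag, rfl, (apply_idle hs).symm, hw⟩ h

theorem Runs.loop_of_false {t : InSym A → (Fin k → Cell) → Bool → Bool} {p : Prog A k}
    {s : Store k} (hs : s.inPos ≤ x.length + 1) (hw : s.Within H)
    (ht : t (OfflineTM.readInput x s.inPos) s.scan s.flag = false) : Runs x H (loop t p) s s :=
  .single ⟨idle s.scan s.flag, by simp [next, ht], (apply_idle hs).symm, hw⟩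

theorem Runs.loop_of_true {t : InSym A → (Fin k → Cell) → Bool → Bool} {p : Prog A k}
    {s s' s'' : Store k} (hs : s.inPos ≤ x.length + 1) (hw : s.Within H)
    (hs' : s'.inPos ≤ x.length + 1) (hw' : s'.Within H)
    (ht : t (OfflineTM.readInput x s.inPos) s.scan s.flag = true) (h₁ : Runs x H p s s')
    (h₂ : Runs x H (loop t p) s' s'') : Runs x H (loop t p) s s'' :=
  .head ⟨idle s.scan s.flag, by simp [next, ht], (apply_idle hs).symm, hw⟩
    (h₁.seq h₂ hs' hw')

/-- The store of the initial configuration. -/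
def initStore (k : ℕ) : Store k where
  inPos := 0
  flag := false
  head := fun _ => 0
  tape := fun _ _ => .blank

/-- The configuration of the machine of `p₀` with residual program `p` and store `s`. -/
def cfg (p₀ p : Prog A k) (hp : p ∈ p₀.residuals) (s : Store k) : p₀.toTM.Cfg where
  state := (⟨p, hp⟩, s.flag)
  inPos := s.inPos
  head := s.head
  tape := s.tape

theorem step_cfg_skip {p₀ : Prog A k} (hp : skip ∈ p₀.residuals) (s : Store k) :
    p₀.toTM.step x (cfg p₀ skip hp s) = none := by
  simp only [OfflineTM.step, cfg, toTM]
  rfl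

theorem step_cfg {p₀ p p' : Prog A k} (hp : p ∈ p₀.residuals) {s : Store k} {e : Effect k}
    (h : p.next (OfflineTM.readInput x s.inPos) s.scan s.flag = some (p', e)) :
    p₀.toTM.step x (cfg p₀ p hp s) =
      some (cfg p₀ p' (next_mem_residuals hp h) (s.apply x e)) := by
  have key : p₀.toTM.trans (⟨p, hp⟩, s.flag) (OfflineTM.readInput x s.inPos) s.scan =
      some ((⟨p', next_mem_residuals hp h⟩, e.2.2), e.1, e.2.1) := by
    simp only [toTM]
    split
    · next h' => exact absurd (h.symm.trans h') (by simp)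
    · next r h' =>
      have := h.symm.trans h'
      cases this; rfl
  have : p₀.toTM.step x (cfg p₀ p hp s) = (p₀.toTM.trans (⟨p, hp⟩, s.flag)
      (OfflineTM.readInput x s.inPos) s.scan).map _ := rfl
  rw [this, key]
  rfl

/-- The machine is deterministic and halts at `skip`, so every reachable configuration lies on the
given run, and the steps of a run respect the bound by definition. -/
theorem within_of_reaches {p₀ p : Prog A k} (hp : p ∈ p₀.residuals) {s s' : Store k}
    (h : Runs x H p s s') (hs : s.Within H) {c : p₀.toTM.Cfg}
    (hc : StateTransition.Reaches (p₀.toTM.step x) (cfg p₀ p hp s) c) (i : Fin k) :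
    c.head i < H := by
  unfold Runs at h
  generalize hd : (p, s) = d at h
  induction h using Relation.ReflTransGen.head_induction_on generalizing p s with
  | refl =>
    cases hd
    rcases Relation.ReflTransGen.cases_head hc with h | ⟨c', h, -⟩
    · subst h; exact hs i
    · rw [step_cfg_skip] at h; simp at h
  | head h₁ h₂ ih =>
    subst hd
    rcases Relation.ReflTransGen.cases_head hc with h | ⟨c', h, hc'⟩
    · subst h; exact hs i
    · obtain ⟨e, he, hde, hw⟩ := h₁
      rw [step_cfg hp he] at h
      obtain rfl := Option.some.inj h
      exact ih (next_mem_residuals hp he) (hde ▸ hw) hc' (by rw [← hde])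

theorem reaches_of_runs {p₀ p : Prog A k} (hp : p ∈ p₀.residuals) {s s' : Store k}
    (h : Runs x H p s s') : ∃ hp' : skip ∈ p₀.residuals,
      StateTransition.Reaches (p₀.toTM.step x) (cfg p₀ p hp s) (cfg p₀ skip hp' s') := by
  unfold Runs at h
  generalize hd : (p, s) = d at h
  induction h using Relation.ReflTransGen.head_induction_on generalizing p s with
  | refl => cases hd; exact ⟨hp, .refl⟩
  | head h₁ h₂ ih =>
    subst hd
    obtain ⟨e, he, hde, hw⟩ := h₁
    obtain ⟨hp', h'⟩ := ih (next_mem_residuals hp he) rfl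
    refine ⟨hp', .head ?_ h'⟩
    rw [step_cfg hp he, hde]; rfl

/-- A program that always terminates within the space bound, with the flag telling membership,
gives a machine that decides the language. -/
theorem decidesInSpace (p : Prog A k) (L : Language A) (f : ℕ → ℕ) (hf : ∀ n, 0 < f n)
    (h : ∀ x : List A, ∃ s, Runs x (f x.length) p (initStore k) s ∧ (s.flag = true ↔ x ∈ L)) :
    p.toTM.DecidesInSpace L f := by
  intro x
  obtain ⟨s, hs, hL⟩ := h x
  refine ⟨?_, ?_⟩
  · obtain ⟨hp', h'⟩ := reaches_of_runs p.self_mem_residuals hs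
    exact ⟨_, h', step_cfg_skip hp' s, hL⟩
  · intro c hc i
    exact within_of_reaches p.self_mem_residuals hs (fun _ => hf _) hc i

end Prog

/-! ### Registers in binary -/

/-- The tape that holds the bits of `v`, least significant first, after the mark. -/
def digits (v : ℕ) : ℕ → Cell
  | 0 => .mark
  | j + 1 => match (Nat.bits v)[j]? with
    | none => .blank
    | some true => .one
    | some false => .zero

theorem digits_ne_mark {v j : ℕ} (hj : j ≠ 0) : digits v j ≠ .mark := by
  obtain ⟨j, rfl⟩ := Nat.exists_eq_succ_of_ne_zero hj
  simp only [digits]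
  split <;> simp

theorem digits_succ_eq_blank {v j : ℕ} : digits v (j + 1) = .blank ↔ (Nat.bits v).length ≤ j := by
  rw [← List.getElem?_eq_none_iff]
  simp only [digits]
  split <;> simp_all

/-- Blanks differ from zero digits, so the tape determines the list of bits; folding `Nat.bit` over
that list returns the number. -/
theorem digits_injective {v v' : ℕ} (h : digits v = digits v') : v = v' := by
  have : Nat.bits v = Nat.bits v' := by
    apply List.ext_getElem?
    intro j
    have := congrFun h (j + 1)
    simp only [digits] at this
    split at this <;> split at this <;> simp_all
  have hv : ∀ n : ℕ, (Nat.bits n).foldr Nat.bit 0 = n := by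
    intro n
    induction n using Nat.binaryRec' with
    | zero => simp
    | bit b n h ih => rw [Nat.bits_append_bit n b h]; simp [ih]
  rw [← hv v, this, hv]

/-- The carry, in the form in which `inc` performs it on the tape: the `m` lowest digits are ones
and become zeros, and the next cell, a zero or the blank behind the number, becomes a one. -/
theorem bits_succ (v : ℕ) : ∃ m l l', Nat.bits v = List.replicate m true ++ l ∧
    Nat.bits (v + 1) = List.replicate m false ++ true :: l' ∧
      ((l = [] ∧ l' = []) ∨ l = false :: l') := by
  induction v using Nat.binaryRec' with
  | zero => exact ⟨0, [], [], by simp⟩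
  | bit b n h ih =>
    rw [Nat.bits_append_bit n b h]
    cases b with
    | false =>
      refine ⟨0, false :: n.bits, n.bits, by simp, ?_, Or.inr rfl⟩
      have : Nat.bit false n + 1 = Nat.bit true n := by simp [Nat.bit]
      rw [this, Nat.bits_append_bit n true (by simp)]; simp
    | true =>
      obtain ⟨m, l, l', h1, h2, h3⟩ := ih
      refine ⟨m + 1, l, l', by simp [h1, List.replicate_succ], ?_, h3⟩
      have : Nat.bit true n + 1 = Nat.bit false (n + 1) := by simp [Nat.bit]; ring
      rw [this, Nat.bits_append_bit _ _ (by simp), h2]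
      simp [List.replicate_succ]

/-- The abstract state of a register program. -/
structure RegState where
  reg : ℕ → ℕ
  flag : Bool
  inPos : ℕ

namespace RegState

variable {k : ℕ}

/-- The state `σ` in which the heads of the tapes in `R` are at `j`, and these tapes hold `T`. -/
def store (k : ℕ) (σ : RegState) (R : Finset ℕ) (j : ℕ) (T : ℕ → ℕ → Cell) : Store k where
  inPos := σ.inPos
  flag := σ.flag
  head := fun i => if (i : ℕ) ∈ R then j else 0
  tape := fun i => if (i : ℕ) ∈ R then T i else digits (σ.reg i)

/-- The store that represents `σ`. -/
def rest (k : ℕ) (σ : RegState) : Store k where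
  inPos := σ.inPos
  flag := σ.flag
  head := fun _ => 0
  tape := fun i => digits (σ.reg i)

/-- Assign a register. -/
def set (σ : RegState) (r v : ℕ) : RegState := { σ with reg := Function.update σ.reg r v }

/-- Assign the flag. -/
def setFlag (σ : RegState) (b : Bool) : RegState := { σ with flag := b }

/-- Assign the position of the input head. -/
def setPos (σ : RegState) (p : ℕ) : RegState := { σ with inPos := p }

theorem store_eq_rest {σ σ' : RegState} {R : Finset ℕ} {T : ℕ → ℕ → Cell}
    (hp : σ.inPos = σ'.inPos) (hf : σ.flag = σ'.flag)
    (hR : ∀ i ∈ R, T i = digits (σ'.reg i)) (hR' : ∀ i ∉ R, σ.reg i = σ'.reg i) :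
    σ.store k R 0 T = σ'.rest k := by
  ext1
  · exact hp
  · exact hf
  · funext i; simp [store, rest]
  · funext i
    by_cases h : (i : ℕ) ∈ R
    · simp [store, rest, h, hR]
    · simp [store, rest, h, hR']

end RegState

namespace Prog

open RegState OfflineTM

variable {A : Type} {k : ℕ} {x : List A} {H K : ℕ}

/-- The symbol scanned on tape `r`. -/
def rd (w : Fin k → Cell) (r : ℕ) : Cell := if h : r < k then w ⟨r, h⟩ else .blank

theorem rd_store {σ : RegState} {R : Finset ℕ} {j : ℕ} {T : ℕ → ℕ → Cell} {r : ℕ} (hr : r ∈ R)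
    (hk : r < k) : rd (σ.store k R j T).scan r = T r j := by
  simp [rd, Store.scan, store, hr, hk]

/-- Rewrite and move on the tapes in `R`. -/
def moveOn (R : Finset ℕ) (g : Cell → Cell) (m : HeadMove) : Prog A k :=
  act fun _ w b => (.stay, fun i => if (i : ℕ) ∈ R then (g (w i), m) else (w i, .stay), b)

theorem within_store {σ : RegState} {R : Finset ℕ} {j : ℕ} {T : ℕ → ℕ → Cell} (hj : j < H) :
    (σ.store k R j T).Within H := by
  intro i
  simp only [store]
  split <;> omega

theorem within_rest {σ : RegState} (hH : 0 < H) : (σ.rest k).Within H := fun _ => hH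

theorem runs_moveOn {σ : RegState} {R : Finset ℕ} {g : Cell → Cell} {m : HeadMove} {j j' : ℕ}
    {T T' : ℕ → ℕ → Cell} (hσ : σ.inPos ≤ x.length + 1) (hj : j' = moveHead m j)
    (hT : ∀ i ∈ R, T' i = Function.update (T i) j (g (T i j))) (hH : j' < H) :
    Runs x H (moveOn R g m : Prog A k) (σ.store k R j T) (σ.store k R j' T') := by
  refine Runs.act ?_ (within_store hH)
  ext1
  · simp [Store.apply, store, moveHead, hσ]
  · rfl
  · funext i
    by_cases h : (i : ℕ) ∈ R <;> simp [Store.apply, store, h, moveHead, hj]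
  · funext i
    by_cases h : (i : ℕ) ∈ R <;> simp [Store.apply, store, h, hT, Store.scan]

/-- The sequences `j` and `T` give head position and tape contents before each round, so a loop is
verified by writing down its trajectory in closed form. -/
theorem runs_loop_moveOn {σ : RegState} {R : Finset ℕ} {g : Cell → Cell} {m : HeadMove} {n : ℕ}
    {t : (Fin k → Cell) → Bool} (j : ℕ → ℕ) (T : ℕ → ℕ → ℕ → Cell)
    (hσ : σ.inPos ≤ x.length + 1) (hj : ∀ i < n, j (i + 1) = moveHead m (j i))
    (hT : ∀ i < n, ∀ r ∈ R, T (i + 1) r = Function.update (T i r) (j i) (g (T i r (j i))))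
    (hH : ∀ i ≤ n, j i < H)
    (ht : ∀ i < n, t (σ.store k R (j i) (T i)).scan = true)
    (ht' : t (σ.store k R (j n) (T n)).scan = false) :
    Runs x H (loop (fun _ w _ => t w) (moveOn R g m) : Prog A k) (σ.store k R (j 0) (T 0))
      (σ.store k R (j n) (T n)) := by
  have key : ∀ d i, i + d = n →
      Runs x H (loop (fun _ w _ => t w) (moveOn R g m) : Prog A k) (σ.store k R (j i) (T i))
        (σ.store k R (j n) (T n)) := by
    intro d
    induction d with
    | zero => rintro i rfl; exact Runs.loop_of_false hσ (within_store (hH _ le_rfl)) ht'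
    | succ d ih =>
      intro i hi
      refine Runs.loop_of_true hσ (within_store (hH i (by omega))) hσ
        (within_store (hH (i + 1) (by omega))) (ht i (by omega)) ?_ (ih (i + 1) (by omega))
      exact runs_moveOn hσ (hj i (by omega)) (hT i (by omega)) (hH _ (by omega))
  exact key n 0 (by omega)

/-- Move the heads of the tapes in `R` to the left end, where tape `r` has its mark. -/
def rewindOn (R : Finset ℕ) (r : ℕ) : Prog A k :=
  loop (fun _ w _ => decide (rd w r ≠ .mark)) (moveOn R id .left)

theorem runs_rewindOn {σ : RegState} {R : Finset ℕ} {r j : ℕ} {T : ℕ → ℕ → Cell}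
    (hσ : σ.inPos ≤ x.length + 1) (hr : r ∈ R) (hk : r < k) (hj : j < H) (h0 : T r 0 = .mark)
    (hT : ∀ i, i ≠ 0 → T r i ≠ .mark) :
    Runs x H (rewindOn R r : Prog A k) (σ.store k R j T) (σ.store k R 0 T) := by
  have := runs_loop_moveOn (x := x) (H := H) (σ := σ) (R := R) (g := id) (m := .left) (n := j)
    (t := fun w : Fin k → Cell => decide (rd w r ≠ .mark)) (fun i => j - i) (fun _ => T) hσ
    (by intro i hi; simp only [moveHead]; omega)
    (by intro i hi r hr; simp) (by intro i hi; omega)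
    (by intro i hi; simpa [rd_store hr hk] using hT _ (by omega))
    (by simpa [rd_store hr hk] using h0)
  simp only [Nat.sub_zero, Nat.sub_self] at this
  exact this

/-- Increment register `r`. -/
def inc (r : ℕ) : Prog A k :=
  seq (moveOn {r} id .right) <|
  seq (loop (fun _ w _ => decide (rd w r = .one)) (moveOn {r} (fun _ => .zero) .right)) <|
  seq (moveOn {r} (fun _ => .one) .stay) (rewindOn {r} r)

theorem length_bits_le {v K : ℕ} (h : v ≤ K) : (Nat.bits v).length ≤ Nat.size K := by
  rw [Nat.size_eq_bits_len]; exact Nat.size_le_size h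

theorem runs_inc {σ : RegState} {r : ℕ} (hσ : σ.inPos ≤ x.length + 1) (hk : r < k)
    (hK : σ.reg r + 1 ≤ K) (hH : Nat.size K + 3 ≤ H) :
    Runs x H (inc r : Prog A k) (σ.rest k) ((σ.set r (σ.reg r + 1)).rest k) := by
  obtain ⟨m, l, l', h1, h2, h3⟩ := bits_succ (σ.reg r)
  have hlen := length_bits_le hK
  rw [h2] at hlen
  simp only [List.length_append, List.length_replicate, List.length_cons] at hlen
  have hr : r ∈ ({r} : Finset ℕ) := by simp
  set D := digits (σ.reg r) with hD
  have e0 : σ.rest k = σ.store k {r} 0 (fun _ => D) := by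
    refine (store_eq_rest rfl rfl ?_ ?_).symm <;> simp [hD]
  rw [e0]
  -- After `i` rounds of the carry the `i` lowest digits have become zeros.
  set T : ℕ → ℕ → ℕ → Cell := fun i _ p => if 1 ≤ p ∧ p ≤ i then .zero else D p with hT
  have hT0 : (fun _ => D) = T 0 := by
    funext r p; simp only [hT]; rw [if_neg (by omega)]
  refine Runs.seq (runs_moveOn (j' := 1) (T' := T 0) hσ rfl ?_ (by omega)) ?_ hσ
    (within_store (by omega))
  · rw [← hT0]; simp
  refine Runs.seq (runs_loop_moveOn (n := m) (t := fun w => decide (rd w r = .one))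
    (fun i => i + 1) T hσ (fun _ _ => rfl) ?_ (by intros; omega) ?_ ?_) ?_ hσ
    (within_store (by omega))
  · intro i hi r' hr'
    funext p
    simp only [hT, Function.update_apply]
    grind
  · intro i hi
    simp only [rd_store hr hk, hT]
    rw [if_neg (by omega)]
    simp [hD, digits, h1, List.getElem?_append, hi]
  · simp only [rd_store hr hk, hT]
    rw [if_neg (by omega)]
    rcases h3 with ⟨rfl, -⟩ | rfl <;> simp [hD, digits, h1]
  set D' := digits (σ.reg r + 1) with hD'
  refine Runs.seq (runs_moveOn (j' := m + 1) (T' := fun _ => D') hσ rfl ?_ (by omega)) ?_ hσ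
    (within_store (by omega))
  · intro i _
    funext p
    simp only [hT, Function.update_apply]
    rcases p with _ | p
    · simp [hD, hD', digits]
    · have hp : 1 ≤ p + 1 := by omega
      simp only [hD, hD', digits, h1, h2, hp, true_and, Nat.add_left_inj]
      rcases lt_trichotomy p m with h | h | h
      · have h5 : p ≠ m := by omega
        simp [h5, List.getElem?_append, h]
      · simp [h]
      · have h5 : p ≠ m := by omega
        have h6 : ¬ p + 1 ≤ m := by omega
        have h7 : ¬ p < m := by omega
        obtain ⟨d, rfl⟩ := Nat.exists_eq_add_of_lt h
        have h8 : m + d + 1 - m = d + 1 := by omega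
        rcases h3 with ⟨rfl, rfl⟩ | rfl <;>
          simp [List.getElem?_append, h5, h6, h7, h8]
  have := runs_rewindOn (x := x) (H := H) (k := k) (σ := σ) (j := m + 1) (T := fun _ => D') hσ hr hk
    (by omega) rfl (fun i hi => digits_ne_mark hi)
  convert this using 1
  symm
  refine store_eq_rest ?_ ?_ ?_ ?_
  · rfl
  · rfl
  · simp [RegState.set, hD']
  · intro i hi
    simp only [Finset.mem_singleton] at hi
    simp [RegState.set, hi]

/-- Set register `r` to zero. -/
def clr (r : ℕ) : Prog A k :=
  seq (loop (fun _ w _ => decide (rd w r ≠ .blank)) (moveOn {r} id .right)) <|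
  loop (fun _ w _ => decide (rd w r ≠ .mark)) (moveOn {r} (fun _ => .blank) .left)

theorem runs_clr {σ : RegState} {r : ℕ} (hσ : σ.inPos ≤ x.length + 1) (hk : r < k)
    (hK : σ.reg r ≤ K) (hH : Nat.size K + 3 ≤ H) :
    Runs x H (clr r : Prog A k) (σ.rest k) ((σ.set r 0).rest k) := by
  have hlen := length_bits_le hK
  have hr : r ∈ ({r} : Finset ℕ) := by simp
  set D := digits (σ.reg r) with hD
  set n := (Nat.bits (σ.reg r)).length with hn
  have e0 : σ.rest k = σ.store k {r} 0 (fun _ => D) := by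
    refine (store_eq_rest rfl rfl ?_ ?_).symm <;> simp [hD]
  rw [e0]
  refine Runs.seq (runs_loop_moveOn (n := n + 1) (t := fun w => decide (rd w r ≠ .blank))
    (fun i => i) (fun _ _ => D) hσ (fun _ _ => rfl) (by simp) (by intros; omega) ?_ ?_) ?_ hσ
    (within_store (by omega))
  · intro i hi
    simp only [rd_store hr hk]
    rcases i with _ | i
    · simp [hD, digits]
    · have : ¬ (D (i + 1) = .blank) := by rw [hD, digits_succ_eq_blank]; omega
      simp [this]
  · have : D (n + 1) = .blank := by rw [hD, digits_succ_eq_blank]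
    simp [rd_store hr hk, this]
  -- On the way back to the mark, the cells to the right of the head are already blank.
  set T : ℕ → ℕ → ℕ → Cell := fun i _ p => if p ≤ n + 1 - i then D p else .blank with hT
  have := runs_loop_moveOn (x := x) (H := H) (k := k) (σ := σ) (R := {r}) (g := fun _ => .blank)
    (m := .left) (n := n + 1)
    (t := fun w : Fin k → Cell => decide (rd w r ≠ .mark)) (fun i => n + 1 - i) T hσ
    (by intro i hi; simp only [moveHead]; omega)
    (by
      intro i hi r hr; funext p
      simp only [hT, Function.update_apply]
      grind)
    (by intro i hi; omega)
    (by
      intro i hi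
      simp only [rd_store hr hk, hT, le_refl, if_true]
      simpa using digits_ne_mark (by omega))
    (by simp [rd_store hr hk, hT, hD, digits])
  convert this using 1
  · congr 1
    funext _ p
    simp only [hT]
    split
    · rfl
    · obtain ⟨q, rfl⟩ : ∃ q, p = q + 1 := ⟨p - 1, by omega⟩
      rw [hD, digits_succ_eq_blank]; omega
  · simp only [Nat.sub_self]
    symm
    refine store_eq_rest ?_ ?_ ?_ ?_
    · rfl
    · rfl
    · intro i hi
      simp only [Finset.mem_singleton] at hi
      subst hi
      funext p
      rcases p with _ | p <;> simp [hT, RegState.set, hD, digits]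
    · intro i hi
      simp only [Finset.mem_singleton] at hi
      simp [RegState.set, hi]

/-- Set the flag by a test of the scanned symbols. -/
def setFlag (t : InSym A → (Fin k → Cell) → Bool → Bool) : Prog A k :=
  act fun a w b => (.stay, fun i => (w i, .stay), t a w b)

theorem runs_setFlag {t : InSym A → (Fin k → Cell) → Bool → Bool} {s s' : Store k}
    (hs : s.inPos ≤ x.length + 1) (hw : s.Within H)
    (h : s' = { s with flag := t (readInput x s.inPos) s.scan s.flag }) :
    Runs x H (setFlag t) s s' := by
  subst h
  refine Runs.act ?_ hw
  ext1
  · simp [Store.apply, moveHead, hs]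
  · rfl
  · rfl
  · funext i; simp [Store.apply, Store.scan]

/-- Set the flag to whether the registers `r` and `s` are equal. -/
def eqt (r s : ℕ) : Prog A k :=
  seq (loop (fun _ w _ => decide (rd w r = rd w s ∧ rd w r ≠ .blank)) (moveOn {r, s} id .right)) <|
  seq (setFlag fun _ w _ => decide (rd w r = rd w s)) (rewindOn {r, s} r)

theorem runs_eqt {σ : RegState} {r s : ℕ} (hσ : σ.inPos ≤ x.length + 1) (hr : r < k) (hs : s < k)
    (hK : σ.reg r ≤ K) (hH : Nat.size K + 3 ≤ H) :
    Runs x H (eqt r s : Prog A k) (σ.rest k)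
      ((σ.setFlag (decide (σ.reg r = σ.reg s))).rest k) := by
  have hlen := length_bits_le hK
  have hrR : r ∈ ({r, s} : Finset ℕ) := by simp
  have hsR : s ∈ ({r, s} : Finset ℕ) := by simp
  set T : ℕ → ℕ → Cell := fun i => digits (σ.reg i) with hT
  have e0 : σ.rest k = σ.store k {r, s} 0 T := by
    refine (store_eq_rest rfl rfl ?_ ?_).symm <;> simp [hT]
  rw [e0]
  have hex : ∃ m, ¬ (T r m = T s m ∧ T r m ≠ .blank) := by
    refine ⟨(Nat.bits (σ.reg r)).length + 1, ?_⟩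
    have : T r ((Nat.bits (σ.reg r)).length + 1) = .blank := by
      simp only [hT]; rw [digits_succ_eq_blank]
    simp [this]
  -- The scan stops at the first cell where the tapes differ or are both blank. Nothing but blanks
  -- follows a blank, so agreement at `m` decides equality of the registers.
  obtain ⟨m, hm, hmin⟩ : ∃ m, ¬ (T r m = T s m ∧ T r m ≠ .blank) ∧
      ∀ i < m, T r i = T s i ∧ T r i ≠ .blank := by
    classical
    exact ⟨Nat.find hex, Nat.find_spec hex, fun i hi => not_not.1 (Nat.find_min hex hi)⟩
  have hmH : m < H := by
    by_contra hcon
    have := (hmin ((Nat.bits (σ.reg r)).length + 1) (by omega)).2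
    simp only [hT, ne_eq, digits_succ_eq_blank] at this
    omega
  refine Runs.seq (runs_loop_moveOn (n := m)
    (t := fun w => decide (rd w r = rd w s ∧ rd w r ≠ .blank))
    (fun i => i) (fun _ => T) hσ (fun _ _ => rfl) (by simp) (by intros; omega) ?_ ?_) ?_ hσ
    (within_store hmH)
  · intro i hi
    simpa [rd_store hrR hr, rd_store hsR hs] using hmin i hi
  · simpa [rd_store hrR hr, rd_store hsR hs] using hm
  have hflag : (T r m = T s m) ↔ σ.reg r = σ.reg s := by
    constructor
    · intro h
      have hb : T r m = .blank := by by_contra hb; exact hm ⟨h, hb⟩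
      rw [h] at hb
      have hb' : T r m = .blank := h ▸ hb
      apply digits_injective
      funext p
      by_cases hp : p < m
      · exact (hmin p hp).1
      · rcases m with _ | m
        · simp [hT, digits] at hb
        · obtain ⟨q, rfl⟩ : ∃ q, p = q + 1 := ⟨p - 1, by omega⟩
          simp only [hT, digits_succ_eq_blank] at hb hb'
          rw [digits_succ_eq_blank.2 (by omega), digits_succ_eq_blank.2 (by omega)]
    · intro h; simp [hT, h]
  refine Runs.seq (s' := (σ.setFlag (decide (σ.reg r = σ.reg s))).store k {r, s} m T)
    (runs_setFlag hσ (within_store hmH) ?_) ?_ hσ (within_store hmH)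
  · simp only [rd_store hrR hr, rd_store hsR hs, hflag]
    rfl
  have := runs_rewindOn (x := x) (H := H) (k := k)
    (σ := σ.setFlag (decide (σ.reg r = σ.reg s))) (j := m) (T := T) hσ hrR hr hmH rfl
    (fun i hi => digits_ne_mark hi)
  convert this using 1
  exact (store_eq_rest rfl rfl (by simp [hT, RegState.setFlag]) (by simp)).symm

/-- Set the flag by a test of the scanned input symbol and the flag. -/
def test (t : InSym A → Bool → Bool) : Prog A k := setFlag fun a _ b => t a b

theorem runs_test {t : InSym A → Bool → Bool} {σ : RegState} (hσ : σ.inPos ≤ x.length + 1)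
    (hH : 0 < H) : Runs x H (test t : Prog A k) (σ.rest k)
      ((σ.setFlag (t (readInput x σ.inPos) σ.flag)).rest k) :=
  runs_setFlag hσ (within_rest hH) rfl

/-- Move the input head. -/
def moveIn (m : HeadMove) : Prog A k := act fun _ w b => (m, fun i => (w i, .stay), b)

theorem runs_moveIn {m : HeadMove} {σ : RegState} (hH : 0 < H) :
    Runs x H (moveIn m : Prog A k) (σ.rest k)
      ((σ.setPos (min (moveHead m σ.inPos) (x.length + 1))).rest k) := by
  refine Runs.act ?_ (within_rest hH)
  ext1
  · rfl
  · rfl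
  · rfl
  · funext i; simp [Store.apply, Store.scan, rest, setPos]

/-- Mark the leftmost cells. -/
def setup : Prog A k := act fun _ _ b => (.stay, fun _ => (.mark, .stay), b)

theorem runs_setup (hH : 0 < H) :
    Runs x H (setup : Prog A k) (initStore k)
      ((⟨fun _ => 0, false, 0⟩ : RegState).rest k) := by
  refine Runs.act ?_ (within_rest hH)
  ext1
  · simp [Store.apply, rest, initStore, moveHead]
  · rfl
  · rfl
  · funext i p
    rcases p with _ | p <;> simp [Store.apply, rest, initStore, digits]

end Prog

/-! ### Register programs -/

namespace RegState

/-- The registers are at most `K`, and the input head is on the input tape. -/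
def Good {A : Type} (x : List A) (K : ℕ) (σ : RegState) : Prop :=
  (∀ i, σ.reg i ≤ K) ∧ σ.inPos ≤ x.length + 1

/-- The first `d` registers hold the values `ρ`. -/
def Agree (d : ℕ) (ρ : ℕ → ℕ) (σ : RegState) : Prop := ∀ i < d, σ.reg i = ρ i

theorem Agree.setFlag {d : ℕ} {ρ : ℕ → ℕ} {σ : RegState} (h : Agree d ρ σ) (b : Bool) :
    Agree d ρ (σ.setFlag b) := h

theorem Agree.mono {d d' : ℕ} {ρ ρ' : ℕ → ℕ} {σ : RegState} (h : Agree d ρ σ) (hd : d' ≤ d)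
    (hρ : ∀ i < d', ρ i = ρ' i) : Agree d' ρ' σ := fun i hi =>
  (h i (hi.trans_le hd)).trans (hρ i hi)

theorem Agree.set {d d' r v : ℕ} {ρ ρ' : ℕ → ℕ} {σ : RegState} (h : Agree d ρ σ)
    (hd : ∀ i < d', i ≠ r → i < d ∧ ρ i = ρ' i) (hr : r < d' → v = ρ' r) :
    Agree d' ρ' (σ.set r v) := by
  intro i hi
  by_cases hir : i = r
  · subst hir; simp [RegState.set, hr hi]
  · simp only [RegState.set, Function.update_of_ne hir]
    rw [h i (hd i hi hir).1, (hd i hi hir).2]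

end RegState

namespace Prog

open RegState OfflineTM

variable {A : Type} {k : ℕ} {x : List A} {H K : ℕ}

/-- Total correctness of a register program within the space bound. -/
def Triple (x : List A) (H K : ℕ) (P : RegState → Prop) (p : Prog A k) (Q : RegState → Prop) :
    Prop :=
  ∀ σ, σ.Good x K → P σ → ∃ σ', Runs x H p (σ.rest k) (σ'.rest k) ∧ σ'.Good x K ∧ Q σ'

variable {P P' Q Q' R : RegState → Prop} {p q : Prog A k}

theorem Triple.mono (h : Triple x H K P p Q) (hP : ∀ σ, P' σ → P σ) (hQ : ∀ σ, Q σ → Q' σ) :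
    Triple x H K P' p Q' := by
  intro σ hσ hp
  obtain ⟨σ', h1, h2, h3⟩ := h σ hσ (hP σ hp)
  exact ⟨σ', h1, h2, hQ _ h3⟩

theorem Triple.skip (h : ∀ σ, P σ → Q σ) : Triple x H K P (skip : Prog A k) Q :=
  fun σ hσ hp => ⟨σ, Runs.skip _, hσ, h σ hp⟩

theorem Triple.seq (hH : Nat.size K + 3 ≤ H) (h₁ : Triple x H K P p Q)
    (h₂ : Triple x H K Q q R) : Triple x H K P (seq p q) R := by
  intro σ hσ hp
  obtain ⟨σ', h1, h2, h3⟩ := h₁ σ hσ hp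
  obtain ⟨σ'', h4, h5, h6⟩ := h₂ σ' h2 h3
  exact ⟨σ'', h1.seq h4 h2.2 (within_rest (by omega)), h5, h6⟩

theorem Triple.inc {r : ℕ} (hH : Nat.size K + 3 ≤ H) (hr : r < k)
    (h : ∀ σ, P σ → σ.reg r + 1 ≤ K ∧ Q (σ.set r (σ.reg r + 1))) :
    Triple x H K P (inc r : Prog A k) Q := by
  intro σ hσ hp
  refine ⟨_, runs_inc hσ.2 hr (h σ hp).1 hH, ⟨fun i => ?_, hσ.2⟩, (h σ hp).2⟩
  by_cases hi : i = r
  · subst hi; simpa [RegState.set] using (h σ hp).1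
  · simpa [RegState.set, hi] using hσ.1 i

theorem Triple.clr {r : ℕ} (hH : Nat.size K + 3 ≤ H) (hr : r < k)
    (h : ∀ σ, P σ → Q (σ.set r 0)) : Triple x H K P (clr r : Prog A k) Q := by
  intro σ hσ hp
  refine ⟨_, runs_clr hσ.2 hr (hσ.1 r) hH, ⟨fun i => ?_, hσ.2⟩, h σ hp⟩
  by_cases hi : i = r
  · subst hi; simp [RegState.set]
  · simpa [RegState.set, hi] using hσ.1 i

theorem Triple.eqt {r s : ℕ} (hH : Nat.size K + 3 ≤ H) (hr : r < k) (hs : s < k)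
    (h : ∀ σ, P σ → Q (σ.setFlag (decide (σ.reg r = σ.reg s)))) :
    Triple x H K P (eqt r s : Prog A k) Q := fun σ hσ hp =>
  ⟨_, runs_eqt hσ.2 hr hs (hσ.1 r) hH, hσ, h σ hp⟩

theorem Triple.test {t : InSym A → Bool → Bool} (hH : Nat.size K + 3 ≤ H)
    (h : ∀ σ, P σ → Q (σ.setFlag (t (readInput x σ.inPos) σ.flag))) :
    Triple x H K P (test t : Prog A k) Q := fun σ hσ hp =>
  ⟨_, runs_test hσ.2 (by omega), hσ, h σ hp⟩

theorem Triple.moveIn {m : HeadMove} (hH : Nat.size K + 3 ≤ H)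
    (h : ∀ σ, P σ → Q (σ.setPos (min (moveHead m σ.inPos) (x.length + 1)))) :
    Triple x H K P (moveIn m : Prog A k) Q := fun σ hσ hp =>
  ⟨_, runs_moveIn (by omega), ⟨hσ.1, min_le_right _ _⟩, h σ hp⟩

theorem Triple.ite (hH : Nat.size K + 3 ≤ H)
    (h₁ : Triple x H K (fun σ => P σ ∧ σ.flag = true) p Q)
    (h₂ : Triple x H K (fun σ => P σ ∧ σ.flag = false) q Q) :
    Triple x H K P (ite (fun _ _ b => b) p q) Q := by
  intro σ hσ hp
  cases hf : σ.flag with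
  | true =>
    obtain ⟨σ', h1, h2⟩ := h₁ σ hσ ⟨hp, hf⟩
    refine ⟨σ', Runs.ite hσ.2 (within_rest (by omega)) ?_, h2⟩
    simpa [rest, hf] using h1
  | false =>
    obtain ⟨σ', h1, h2⟩ := h₂ σ hσ ⟨hp, hf⟩
    refine ⟨σ', Runs.ite hσ.2 (within_rest (by omega)) ?_, h2⟩
    simpa [rest, hf] using h1

/-- The invariant is indexed by the round and the number `m` of rounds is fixed in advance; this
yields termination together with correctness. -/
theorem Triple.loop (hH : Nat.size K + 3 ≤ H) {t : InSym A → Bool → Bool}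
    (I : ℕ → RegState → Prop) (m : ℕ)
    (hI : ∀ j ≤ m, ∀ σ, I j σ → (t (readInput x σ.inPos) σ.flag = true ↔ j < m))
    (h : ∀ j < m, Triple x H K (I j) p (I (j + 1))) :
    Triple x H K (I 0) (loop (fun a _ b => t a b) p) (I m) := by
  have key : ∀ d j, j + d = m → Triple x H K (I j) (Prog.loop (fun a _ b => t a b) p) (I m) := by
    intro d
    induction d with
    | zero =>
      rintro j rfl σ hσ hj
      refine ⟨σ, Runs.loop_of_false hσ.2 (within_rest (by omega)) ?_, hσ, hj⟩
      have := hI _ le_rfl σ hj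
      simpa [rest] using this
    | succ d ih =>
      intro j hj σ hσ hIj
      obtain ⟨σ', h1, h2, h3⟩ := h j (by omega) σ hσ hIj
      obtain ⟨σ'', h4, h5⟩ := ih (j + 1) (by omega) σ' h2 h3
      exact ⟨σ'', Runs.loop_of_true hσ.2 (within_rest (by omega)) h2.2 (within_rest (by omega))
        ((hI j (by omega) σ hIj).2 (by omega)) h1 h4, h5⟩
  exact key m 0 (by omega)

/-- Repeat `p` until the registers `r` and `s` are equal. -/
def whileNe (r s : ℕ) (p : Prog A k) : Prog A k :=
  Prog.seq (Prog.seq (Prog.eqt r s) (Prog.test fun _ b => !b)) <|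
    Prog.loop (fun _ _ b => b) (Prog.seq p (Prog.seq (Prog.eqt r s) (Prog.test fun _ b => !b)))

theorem Triple.whileNe {r s : ℕ} (hH : Nat.size K + 3 ≤ H) (hr : r < k) (hs : s < k)
    (I : ℕ → RegState → Prop) (m : ℕ)
    (hf : ∀ j ≤ m, ∀ σ b, I j σ → I j (σ.setFlag b))
    (hI : ∀ j ≤ m, ∀ σ, I j σ → (σ.reg r = σ.reg s ↔ j = m))
    (h : ∀ j < m, Triple x H K (I j) p (I (j + 1))) :
    Triple x H K (I 0) (whileNe r s p) (I m) := by
  have hne : ∀ j ≤ m, Triple x H K (I j)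
      (Prog.seq (Prog.eqt r s) (Prog.test fun _ b => !b) : Prog A k)
      (fun σ => I j σ ∧ (σ.flag = true ↔ j < m)) := by
    intro j hj
    refine Triple.seq hH (Triple.eqt hH hr hs
      (Q := fun σ => I j σ ∧ (σ.flag = true ↔ j = m)) fun σ hσ => ?_)
      (Triple.test hH fun σ hσ => ?_)
    · exact ⟨hf j hj σ _ hσ, by simpa [RegState.setFlag] using hI j hj σ hσ⟩
    · refine ⟨hf j hj σ _ hσ.1, ?_⟩
      have := hσ.2
      simp only [RegState.setFlag, Bool.not_eq_true', ← Bool.not_eq_true, this]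
      omega
  have hloop := Triple.loop (x := x) (K := K) (k := k) hH (t := fun _ b => b)
    (p := Prog.seq p (Prog.seq (Prog.eqt r s) (Prog.test fun _ b => !b)))
    (fun j σ => I j σ ∧ (σ.flag = true ↔ j < m)) m (fun j _ σ hσ => hσ.2)
    (fun j hj => Triple.seq hH ((h j hj).mono (fun σ hσ => hσ.1) (fun _ h => h))
      (hne (j + 1) (by omega)))
  exact Triple.seq hH (hne 0 (by omega)) (hloop.mono (fun _ h => h) fun σ hσ => hσ.1)

/-- Add register `b` to register `a`, with `c` as a counter. -/
def addTo (a b c : ℕ) : Prog A k :=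
  Prog.seq (Prog.clr c) (Prog.whileNe c b (Prog.seq (Prog.inc c) (Prog.inc a)))

/-- `Agree d` says nothing about registers from `d` on, so the counter in register `d` is scratch
space that need not be restored. -/
theorem Triple.addTo {a b d : ℕ} {ρ : ℕ → ℕ} (hH : Nat.size K + 3 ≤ H) (hd : d < k) (ha : a < d)
    (hb : b < d) (hab : a ≠ b) (hK : ρ a + ρ b ≤ K) :
    Triple x H K (Agree d ρ) (addTo a b d : Prog A k)
      (Agree d (Function.update ρ a (ρ a + ρ b))) := by
  set I : ℕ → RegState → Prop := fun j =>
    Agree (d + 1) (Function.update (Function.update ρ a (ρ a + j)) d j) with hI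
  have hloop := Triple.whileNe (x := x) (K := K) (k := k) (r := d) (s := b)
    (p := Prog.seq (Prog.inc d) (Prog.inc a)) hH hd (by omega) I (ρ b)
    (fun j _ σ c h => h.setFlag c)
    (by
      intro j hj σ hσ
      rw [hσ d (by omega), hσ b (by omega)]
      simp [show b ≠ d by omega, Ne.symm hab])
    (by
      intro j hj
      refine Triple.seq hH (Q := Agree (d + 1)
        (Function.update (Function.update ρ a (ρ a + j)) d (j + 1))) (Triple.inc hH hd ?_)
        (Triple.inc hH (by omega) ?_)
      · intro σ hσ
        have h1 := hσ d (by omega)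
        simp only [Function.update_self] at h1
        refine ⟨by omega, hσ.set ?_ ?_⟩
        · intro i hi hid; exact ⟨hi, by simp [hid]⟩
        · simp [h1]
      · intro σ hσ
        have h1 := hσ a (by omega)
        rw [Function.update_of_ne (by omega), Function.update_self] at h1
        refine ⟨by omega, hσ.set ?_ ?_⟩
        · intro i hi hid
          refine ⟨hi, ?_⟩
          simp only [Function.update_apply, hid, if_false]
        · intro _
          rw [Function.update_of_ne (by omega), Function.update_self]; omega)
  refine Triple.seq hH (Triple.clr hH hd (Q := I 0) ?_) (hloop.mono (fun _ h => h) ?_)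
  · intro σ hσ
    refine hσ.set ?_ ?_
    · intro i hi hid
      refine ⟨by omega, ?_⟩
      simp only [Function.update_apply, hid, if_false, Nat.add_zero]
      split <;> simp_all
    · simp
  · intro σ hσ
    refine hσ.mono (by omega) ?_
    intro i hi
    rw [Function.update_of_ne (by omega)]

/-- Increment register `r` by the constant `c`. -/
def incBy (r : ℕ) : ℕ → Prog A k
  | 0 => Prog.skip
  | c + 1 => Prog.seq (incBy r c) (Prog.inc r)

theorem Triple.incBy {d r c : ℕ} {ρ : ℕ → ℕ} (hH : Nat.size K + 3 ≤ H) (hr : r < k) (hd : r < d)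
    (hK : ρ r + c ≤ K) : Triple x H K (Agree d ρ) (incBy r c : Prog A k)
      (Agree d (Function.update ρ r (ρ r + c))) := by
  induction c with
  | zero => exact Triple.skip fun σ hσ => by simpa using hσ
  | succ c ih =>
    refine Triple.seq hH (ih (by omega)) (Triple.inc hH hr fun σ hσ => ?_)
    have h1 := hσ r hd
    rw [Function.update_self] at h1
    refine ⟨by omega, hσ.set ?_ ?_⟩
    · intro i hi hid; exact ⟨hi, by simp [hid]⟩
    · simp only [Function.update_self]; omega

/-- Move the input head to the left end marker. -/
def rewindIn : Prog A k :=
  Prog.loop (fun a _ _ => match a with | .leftEnd => false | _ => true) (Prog.moveIn .left)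

theorem readInput_leftEnd {p : ℕ} : (match readInput x p with
    | .leftEnd => false | _ => true) = true ↔ p ≠ 0 := by
  rcases p with _ | p
  · simp [readInput]
  · simp only [readInput]
    cases x[p]? <;> simp

theorem Triple.rewindIn (hH : Nat.size K + 3 ≤ H)
    (h : ∀ σ, P σ → Q (σ.setPos 0)) : Triple x H K P (rewindIn : Prog A k) Q := by
  intro σ hσ hp
  refine Triple.loop (x := x) (K := K) (k := k) hH
    (t := fun a _ => match a with | .leftEnd => false | _ => true)
    (p := Prog.moveIn .left) (fun j σ' => σ' = σ.setPos (σ.inPos - j)) σ.inPos ?_ ?_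
    |>.mono (P' := fun σ' => σ' = σ) (Q' := Q) ?_ ?_ σ hσ rfl
  · rintro j hj _ rfl
    rw [readInput_leftEnd]
    simp only [setPos]; omega
  · intro j hj
    refine Triple.moveIn hH ?_
    rintro _ rfl
    have := hσ.2
    simp only [setPos, moveHead, RegState.mk.injEq, true_and]
    omega
  · rintro _ rfl; rfl
  · rintro _ rfl
    simpa using h σ hp

end Prog

/-! ### Bounded arithmetic over input positions -/

/-- Polynomial terms. -/
inductive Tm
  | var (i : ℕ)
  | const (c : ℕ)
  | add (t u : Tm)
  | mul (t u : Tm)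

namespace Tm

/-- The value of a term. -/
def eval (ρ : ℕ → ℕ) : Tm → ℕ
  | var i => ρ i
  | const c => c
  | add t u => t.eval ρ + u.eval ρ
  | mul t u => t.eval ρ * u.eval ρ

/-- The variables are below `d`. -/
def Scoped (d : ℕ) : Tm → Prop
  | var i => i < d
  | const _ => True
  | add t u => t.Scoped d ∧ u.Scoped d
  | mul t u => t.Scoped d ∧ u.Scoped d

/-- A bound for the values of all sub-terms when the variables are at most `M`. -/
def bd (M : ℕ) : Tm → ℕ
  | var _ => M
  | const c => c
  | add t u => t.bd M + u.bd M
  | mul t u => (t.bd M + 1) * (u.bd M + 1)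

/-- A bound for the number of registers used in the evaluation. -/
def width : Tm → ℕ
  | var _ => 2
  | const _ => 1
  | add t u => t.width + u.width + 3
  | mul t u => t.width + u.width + 5

theorem Scoped.mono {d d' : ℕ} {t : Tm} (h : t.Scoped d) (hd : d ≤ d') : t.Scoped d' := by
  induction t with
  | var i => exact lt_of_lt_of_le h hd
  | const c => trivial
  | add t u iht ihu => exact ⟨iht h.1, ihu h.2⟩
  | mul t u iht ihu => exact ⟨iht h.1, ihu h.2⟩

theorem eval_congr {d : ℕ} {t : Tm} (h : t.Scoped d) {ρ ρ' : ℕ → ℕ} (hρ : ∀ i < d, ρ i = ρ' i) :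
    t.eval ρ = t.eval ρ' := by
  induction t with
  | var i => exact hρ i h
  | const c => rfl
  | add t u iht ihu => simp only [eval, iht h.1, ihu h.2]
  | mul t u iht ihu => simp only [eval, iht h.1, ihu h.2]

theorem eval_update {d i v : ℕ} {t : Tm} (h : t.Scoped d) (hi : d ≤ i) (ρ : ℕ → ℕ) :
    t.eval (Function.update ρ i v) = t.eval ρ :=
  eval_congr h fun j hj => Function.update_of_ne (by omega) _ _

theorem eval_le_bd {d M : ℕ} {t : Tm} (h : t.Scoped d) {ρ : ℕ → ℕ} (hρ : ∀ i < d, ρ i ≤ M) :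
    t.eval ρ ≤ t.bd M := by
  induction t with
  | var i => exact hρ i h
  | const c => exact le_rfl
  | add t u iht ihu => exact add_le_add (iht h.1) (ihu h.2)
  | mul t u iht ihu =>
    exact Nat.mul_le_mul ((iht h.1).trans (Nat.le_succ _)) ((ihu h.2).trans (Nat.le_succ _))

/-- With `2 ≤ M`, constants and factors of two are absorbed into the exponent. -/
theorem exists_bd_le_pow (t : Tm) : ∃ D, ∀ M, 2 ≤ M → t.bd M ≤ M ^ D := by
  induction t with
  | var i => exact ⟨1, fun M _ => by simp [bd]⟩
  | const c =>
    exact ⟨c, fun M hM => (Nat.lt_two_pow_self).le.trans (Nat.pow_le_pow_left hM c)⟩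
  | add t u iht ihu =>
    obtain ⟨a, ha⟩ := iht
    obtain ⟨b, hb⟩ := ihu
    refine ⟨a + b + 1, fun M hM => ?_⟩
    have h1 := ha M hM
    have h2 := hb M hM
    have h3 : M ^ a ≤ M ^ (a + b) := Nat.pow_le_pow_right (by omega) (by omega)
    have h4 : M ^ b ≤ M ^ (a + b) := Nat.pow_le_pow_right (by omega) (by omega)
    have h5 : M ^ (a + b) * 2 ≤ M ^ (a + b) * M := Nat.mul_le_mul_left _ hM
    rw [pow_succ]
    simp only [bd]
    omega
  | mul t u iht ihu =>
    obtain ⟨a, ha⟩ := iht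
    obtain ⟨b, hb⟩ := ihu
    refine ⟨(a + 1) + (b + 1), fun M hM => ?_⟩
    have h1 := ha M hM
    have h2 := hb M hM
    have h3 : M ^ a * 2 ≤ M ^ a * M := Nat.mul_le_mul_left _ hM
    have h4 : M ^ b * 2 ≤ M ^ b * M := Nat.mul_le_mul_left _ hM
    have h5 : 1 ≤ M ^ a := Nat.one_le_pow _ _ (by omega)
    have h6 : 1 ≤ M ^ b := Nat.one_le_pow _ _ (by omega)
    rw [pow_add, pow_succ, pow_succ]
    exact Nat.mul_le_mul (by omega) (by omega)

variable {A : Type} {k : ℕ}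

/-- The program that puts the value of a term into register `d`, using the registers from `d` on. -/
def compile : Tm → ℕ → Prog A k
  | var i, d => .seq (.clr d) (.addTo d i (d + 1))
  | const c, d => .seq (.clr d) (.incBy d c)
  | add t u, d => .seq (t.compile d) (.seq (u.compile (d + 1)) (.addTo d (d + 1) (d + 2)))
  | mul t u, d => .seq (.clr d) <| .seq (t.compile (d + 1)) <| .seq (u.compile (d + 2)) <|
      .seq (.clr (d + 3)) <|
      .whileNe (d + 3) (d + 1) (.seq (.inc (d + 3)) (.addTo d (d + 2) (d + 4)))

open Prog RegState

/-- The number `e` of variables is kept apart from the first free register `d`: sub-terms are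
evaluated at higher `d`, and only the variables proper, not the intermediate results in between,
have to be at most `M`. -/
theorem compile_correct {x : List A} {H K M e : ℕ} (hH : Nat.size K + 3 ≤ H) {t : Tm}
    (ht : t.Scoped e) {d : ℕ} (hed : e ≤ d) {ρ : ℕ → ℕ} (hρ : ∀ i < e, ρ i ≤ M)
    (hK : t.bd M ≤ K) (hk : d + t.width ≤ k) :
    Triple x H K (Agree d ρ) (t.compile d : Prog A k)
      (Agree (d + 1) (Function.update ρ d (t.eval ρ))) := by
  have hclr : ∀ {d : ℕ} {ρ : ℕ → ℕ}, d < k → Triple x H K (Agree d ρ) (.clr d : Prog A k)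
      (Agree (d + 1) (Function.update ρ d 0)) := by
    intro d ρ hd
    refine Triple.clr hH hd fun σ hσ => hσ.set ?_ (by simp)
    intro i hi hid
    exact ⟨by omega, by simp [hid]⟩
  induction t generalizing d ρ with
  | var i =>
    have hi : i < d := lt_of_lt_of_le ht hed
    simp only [width, bd] at hk hK
    refine Triple.seq hH (hclr (by omega)) ((Triple.addTo hH (by omega) (by omega) (by omega)
      (by omega) ?_).mono (fun _ h => h) ?_)
    · have := hρ i ht
      rw [Function.update_self, Function.update_of_ne (by omega)]; omega
    · intro σ hσ
      rw [Function.update_self, Function.update_of_ne (by omega)] at hσ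
      simpa [eval] using hσ
  | const c =>
    simp only [width, bd] at hk hK
    refine Triple.seq hH (hclr (by omega)) ((Triple.incBy hH (by omega) (by omega) ?_).mono
      (fun _ h => h) ?_)
    · rw [Function.update_self]; omega
    · intro σ hσ
      rw [Function.update_self] at hσ
      simpa [eval] using hσ
  | add t u iht ihu =>
    simp only [width, bd] at hk hK
    have h1 := eval_le_bd ht.1 hρ
    have h2 := eval_le_bd ht.2 hρ
    refine Triple.seq hH (iht ht.1 hed hρ (by omega) (by omega)) (Triple.seq hH
      (ihu (d := d + 1) ht.2 (by omega) ?_ (by omega) (by omega))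
      ((Triple.addTo (d := d + 2) hH (by omega) (by omega) (by omega) (by omega) ?_).mono
        (fun _ h => h) ?_))
    · intro i hi
      rw [Function.update_of_ne (by omega)]; exact hρ i hi
    · rw [Function.update_of_ne (by omega), Function.update_self, Function.update_self,
        eval_update ht.2 hed]
      omega
    · intro σ hσ
      refine hσ.mono (by omega) ?_
      intro i hi
      rw [Function.update_of_ne (show d ≠ d + 1 by omega), Function.update_self,
        Function.update_self, eval_update ht.2 hed]
      by_cases hid : i = d
      · subst hid; simp [eval]
      · rw [Function.update_of_ne hid, Function.update_of_ne (by omega), Function.update_of_ne hid,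
          Function.update_of_ne hid]
  | mul t u iht ihu =>
    simp only [width, bd] at hk hK
    have h1 := eval_le_bd ht.1 hρ
    have h2 := eval_le_bd ht.2 hρ
    -- The successors in `bd` make the bound of a product dominate the bounds of both factors, even
    -- if one of these is zero.
    have h3 : (t.bd M + 1) * 1 ≤ (t.bd M + 1) * (u.bd M + 1) := Nat.mul_le_mul_left _ (by omega)
    have h4 : 1 * (u.bd M + 1) ≤ (t.bd M + 1) * (u.bd M + 1) := Nat.mul_le_mul_right _ (by omega)
    have h5 : t.eval ρ * u.eval ρ ≤ K :=
      (eval_le_bd (t := mul t u) (d := e) ht hρ).trans hK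
    -- Multiplication by repeated addition: register `d` accumulates and register `d + 3` counts the
    -- rounds.
    set I : ℕ → RegState → Prop := fun j => Agree (d + 4) (fun i =>
      if i = d then j * u.eval ρ else if i = d + 1 then t.eval ρ else if i = d + 2 then u.eval ρ
      else if i = d + 3 then j else ρ i) with hI
    have hloop := Triple.whileNe (x := x) (K := K) (k := k) (r := d + 3) (s := d + 1)
      (p := .seq (.inc (d + 3)) (.addTo d (d + 2) (d + 4))) hH (by omega) (by omega) I (t.eval ρ)
      (fun j _ σ c h => h.setFlag c)
      (by
        intro j hj σ hσ
        rw [hσ (d + 3) (by omega), hσ (d + 1) (by omega)]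
        simp)
      (by
        intro j hj
        have h6 : (j + 1) * u.eval ρ ≤ K := (Nat.mul_le_mul_right _ hj).trans h5
        refine Triple.seq hH (Q := Agree (d + 4) (fun i =>
            if i = d then j * u.eval ρ else if i = d + 1 then t.eval ρ else
            if i = d + 2 then u.eval ρ else if i = d + 3 then j + 1 else ρ i))
          (Triple.inc hH (by omega) ?_)
          ((Triple.addTo hH (by omega) (by omega) (by omega) (by omega) ?_).mono (fun _ h => h) ?_)
        · intro σ hσ
          have h1 := hσ (d + 3) (by omega)
          simp only [show d + 3 ≠ d by omega, show d + 3 ≠ d + 1 by omega,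
            show d + 3 ≠ d + 2 by omega, if_false, if_true] at h1
          refine ⟨by omega, hσ.set ?_ ?_⟩
          · intro i hi hid; exact ⟨hi, by simp [hid]⟩
          · simp [h1]
        · simp only [show d + 2 ≠ d by omega, show d + 2 ≠ d + 1 by omega, if_false, if_true]
          rw [Nat.succ_mul] at h6; exact h6
        · intro σ hσ
          refine hσ.mono le_rfl ?_
          intro i hi
          by_cases hid : i = d
          · subst hid; simp [Nat.succ_mul]
          · simp [hid])
    refine Triple.seq hH (hclr (by omega)) ?_
    refine Triple.seq hH (iht (d := d + 1) ht.1 (by omega) ?_ (by omega) (by omega)) ?_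
    · intro i hi
      rw [Function.update_of_ne (by omega)]; exact hρ i hi
    refine Triple.seq hH (ihu (d := d + 2) ht.2 (by omega) ?_ (by omega) (by omega)) ?_
    · intro i hi
      rw [Function.update_of_ne (by omega), Function.update_of_ne (by omega)]; exact hρ i hi
    refine Triple.seq hH (hclr (by omega)) (hloop.mono ?_ ?_)
    · intro σ hσ
      refine hσ.mono le_rfl ?_
      intro i hi
      rw [eval_update ht.1 hed, eval_update ht.2 (by omega), eval_update ht.2 (by omega)]
      simp only [Function.update_apply]
      grind
    · intro σ hσ
      refine hσ.mono (by omega) ?_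
      intro i hi
      by_cases hid : i = d
      · subst hid; simp [eval]
      · simp only [Function.update_of_ne hid, if_neg hid]
        rw [if_neg (by omega), if_neg (by omega), if_neg (by omega)]

end Tm

/-- Formulas of bounded arithmetic with access to the symbols of the input. The quantifier at
depth `d` binds the variable `d`. -/
inductive Fm (A : Type)
  | eq (t u : Tm)
  | sym (a : A) (t : Tm)
  | not (φ : Fm A)
  | and (φ ψ : Fm A)
  | ex (t : Tm) (φ : Fm A)

/-! ### Evaluation of bounded formulas in logarithmic space. -/

namespace Fm

variable {A : Type}

/-- Truth of a formula at depth `d`. -/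
def eval (x : List A) : Fm A → ℕ → (ℕ → ℕ) → Prop
  | eq t u, _, ρ => t.eval ρ = u.eval ρ
  | sym a t, _, ρ => x[t.eval ρ]? = some a
  | not φ, d, ρ => ¬ φ.eval x d ρ
  | and φ ψ, d, ρ => φ.eval x d ρ ∧ ψ.eval x d ρ
  | ex t φ, d, ρ => ∃ v < t.eval ρ, φ.eval x (d + 1) (Function.update ρ d v)

/-- The free variables are below the depth. -/
def Scoped : Fm A → ℕ → Prop
  | eq t u, d => t.Scoped d ∧ u.Scoped d
  | sym _ t, d => t.Scoped d
  | not φ, d => φ.Scoped d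
  | and φ ψ, d => φ.Scoped d ∧ ψ.Scoped d
  | ex t φ, d => t.Scoped d ∧ φ.Scoped (d + 1)

/-- A bound for all values in the evaluation when the variables are at most `M`. -/
def bd : Fm A → ℕ → ℕ
  | eq t u, M => t.bd M + u.bd M
  | sym _ t, M => t.bd M
  | not φ, M => φ.bd M
  | and φ ψ, M => φ.bd M + ψ.bd M
  | ex t φ, M => t.bd M + φ.bd (max M (t.bd M))

/-- A bound for the number of registers used in the evaluation. -/
def width : Fm A → ℕ
  | eq t u => t.width + u.width + 2
  | sym _ t => t.width + 2
  | not φ => φ.width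
  | and φ ψ => φ.width + ψ.width
  | ex t φ => t.width + φ.width + 2

theorem exists_bd_le_pow (φ : Fm A) : ∃ D, ∀ M, 2 ≤ M → φ.bd M ≤ M ^ D := by
  have hadd : ∀ {f g : ℕ → ℕ}, (∃ D, ∀ M, 2 ≤ M → f M ≤ M ^ D) → (∃ D, ∀ M, 2 ≤ M → g M ≤ M ^ D) →
      ∃ D, ∀ M, 2 ≤ M → f M + g M ≤ M ^ D := by
    rintro f g ⟨a, ha⟩ ⟨b, hb⟩
    refine ⟨a + b + 1, fun M hM => ?_⟩
    have h1 := ha M hM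
    have h2 := hb M hM
    have h3 : M ^ a ≤ M ^ (a + b) := Nat.pow_le_pow_right (by omega) (by omega)
    have h4 : M ^ b ≤ M ^ (a + b) := Nat.pow_le_pow_right (by omega) (by omega)
    have h5 : M ^ (a + b) * 2 ≤ M ^ (a + b) * M := Nat.mul_le_mul_left _ hM
    rw [pow_succ]
    omega
  induction φ with
  | eq t u => exact hadd t.exists_bd_le_pow u.exists_bd_le_pow
  | sym a t => exact t.exists_bd_le_pow
  | not φ ih => exact ih
  | and φ ψ ih₁ ih₂ => exact hadd ih₁ ih₂
  | ex t φ ih =>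
    refine hadd t.exists_bd_le_pow ?_
    obtain ⟨a, ha⟩ := t.exists_bd_le_pow
    obtain ⟨D, hD⟩ := ih
    have hmono : ∀ (t : Tm) {M M'}, M ≤ M' → t.bd M ≤ t.bd M' := by
      intro t M M' h
      induction t with
      | var i => exact h
      | const c => exact le_rfl
      | add t u iht ihu => exact add_le_add iht ihu
      | mul t u iht ihu => exact Nat.mul_le_mul (by omega) (by omega)
    -- The new variable ranges up to `t.bd M`, so the body is bounded at `max M (t.bd M)`, which is
    -- at most `M ^ (a + 1)`; the exponents multiply.
    refine ⟨(a + 1) * D, fun M hM => ?_⟩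
    refine (hD _ (le_max_of_le_left hM)).trans ?_
    rw [pow_mul]
    refine Nat.pow_le_pow_left (max_le ?_ ?_) _
    · exact Nat.le_self_pow (by omega) M
    · exact (ha M hM).trans (Nat.pow_le_pow_right (by omega) (by omega))

open Prog RegState OfflineTM

variable {k : ℕ}

/-- The program that puts the length of the input into register `0`. -/
def measure : Prog A k :=
  .seq (.moveIn .right) <|
    .loop (fun a _ _ => match a with | .rightEnd => false | _ => true)
      (.seq (.inc 0) (.moveIn .right))

theorem measure_correct {x : List A} {H K : ℕ} (hH : Nat.size K + 3 ≤ H) (hK : x.length ≤ K)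
    (hk : 0 < k) : Triple x H K (fun σ => σ.reg 0 = 0 ∧ σ.inPos = 0) (measure : Prog A k)
      (Agree 1 fun _ => x.length) := by
  have hloop := Triple.loop (x := x) (K := K) (k := k) hH
    (t := fun a _ => match a with | .rightEnd => false | _ => true)
    (p := .seq (.inc 0) (.moveIn .right))
    (fun j σ => σ.reg 0 = j ∧ σ.inPos = j + 1) x.length
    (by
      rintro j hj σ ⟨-, h⟩
      simp only [h, readInput]
      rcases hj.lt_or_eq with h' | h'
      · simp [h']
      · simp [h'])
    (by
      intro j hj
      refine Triple.seq hH (Q := fun σ => σ.reg 0 = j + 1 ∧ σ.inPos = j + 1)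
        (Triple.inc hH hk ?_) (Triple.moveIn hH ?_)
      · rintro σ ⟨h1, h2⟩
        exact ⟨by omega, by simp [RegState.set, h1], h2⟩
      · rintro σ ⟨h1, h2⟩
        refine ⟨h1, ?_⟩
        simp only [setPos, moveHead, h2]
        omega)
  refine Triple.seq hH (Triple.moveIn hH ?_) (hloop.mono (fun _ h => h) ?_)
  · rintro σ ⟨h1, h2⟩
    refine ⟨h1, ?_⟩
    simp only [setPos, moveHead, h2]
    omega
  · rintro σ ⟨h1, -⟩ i hi
    obtain rfl : i = 0 := by omega
    exact h1

variable [DecidableEq A]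

/-- Whether the scanned input symbol is `a`. -/
def isSym (a : A) : InSym A → Bool
  | .sym b => decide (b = a)
  | _ => false

/-- Part of the search for a witness: the flag is set to whether the candidate in register `d` is
below the bound and not a witness. -/
def check (t : Tm) (p : Prog A k) (d : ℕ) : Prog A k :=
  .seq (t.compile (d + 1)) <| .seq (.eqt d (d + 1)) <|
    .ite (fun _ _ b => b) (.test fun _ _ => false) (.seq p (.test fun _ b => !b))

/-- The program that sets the flag to the truth value of a formula at depth `d`. -/
def compile : Fm A → ℕ → Prog A k
  | eq t u, d => .seq (t.compile d) (.seq (u.compile (d + 1)) (.eqt d (d + 1)))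
  | sym a t, d => .seq (t.compile d) <| .seq .rewindIn <| .seq (.moveIn .right) <|
      .seq (.clr (d + 1)) <|
      .seq (.whileNe (d + 1) d (.seq (.inc (d + 1)) (.moveIn .right))) (.test fun s _ => isSym a s)
  | not φ, d => .seq (φ.compile d) (.test fun _ b => !b)
  | and φ ψ, d => .seq (φ.compile d) (.ite (fun _ _ b => b) (ψ.compile d) .skip)
  | ex t φ, d => .seq (.clr d) <| .seq (check t (φ.compile (d + 1)) d) <|
      .seq (.loop (fun _ _ b => b) (.seq (.inc d) (check t (φ.compile (d + 1)) d))) <|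
      .seq (t.compile (d + 1)) (.seq (.eqt d (d + 1)) (.test fun _ b => !b))

/-- Entry `v` of the list sits in cell `v + 1`, behind the left end marker. For `v` beyond the list
the head has been stopped at the right end marker, which matches no symbol, just as `x[v]?` is
`none`. -/
theorem isSym_readInput {x : List A} {a : A} {v : ℕ} :
    isSym a (readInput x (min (v + 1) (x.length + 1))) = true ↔ x[v]? = some a := by
  rcases lt_or_ge v x.length with h | h
  · rw [min_eq_left (by omega)]
    simp [readInput, h, isSym]
  · rw [min_eq_right (by omega)]
    simp [readInput, h, isSym]

/-- Evaluation preserves the registers below `d`, so registers above them are reused freely. For a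
quantifier the candidate stays in register `d`, while the bound is recomputed in every round, since
evaluating the body overwrites it. -/
theorem compile_correct {x : List A} {H K M : ℕ} (hH : Nat.size K + 3 ≤ H) {φ : Fm A} {d : ℕ}
    (hφ : φ.Scoped d) {ρ : ℕ → ℕ} (hρ : ∀ i < d, ρ i ≤ M)
    (hK : φ.bd M ≤ K) (hk : d + φ.width ≤ k) :
    Triple x H K (Agree d ρ) (φ.compile d : Prog A k)
      (fun σ => Agree d ρ σ ∧ (σ.flag = true ↔ φ.eval x d ρ)) := by
  induction φ generalizing d ρ M with
  | eq t u =>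
    simp only [bd, width] at hK hk
    refine Triple.seq hH (Tm.compile_correct hH hφ.1 le_rfl hρ (by omega) (by omega)) <|
      Triple.seq hH (Tm.compile_correct hH hφ.2 (Nat.le_succ d) (M := M) ?_ (by omega) (by omega)) <|
      Triple.eqt hH (by omega) (by omega) ?_
    · intro i hi
      rw [Function.update_of_ne (by omega)]; exact hρ i hi
    · intro σ hσ
      refine ⟨hσ.mono (by omega) ?_, ?_⟩
      · intro i hi
        rw [Function.update_of_ne (by omega), Function.update_of_ne (by omega)]
      · have h1 := hσ d (by omega)
        have h2 := hσ (d + 1) (by omega)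
        rw [Function.update_of_ne (by omega), Function.update_self] at h1
        rw [Function.update_self, Tm.eval_update hφ.2 le_rfl] at h2
        simp [RegState.setFlag, eval, h1, h2]
  | sym a t =>
    simp only [bd, width] at hK hk
    have hle := Tm.eval_le_bd hφ hρ
    set ρ' := Function.update ρ d (t.eval ρ) with hρ'
    set I : ℕ → RegState → Prop := fun j σ =>
      Agree (d + 1) ρ' σ ∧ σ.reg (d + 1) = j ∧ σ.inPos = min (j + 1) (x.length + 1) with hI
    have hloop := Triple.whileNe (x := x) (K := K) (k := k) (r := d + 1) (s := d)
      (p := .seq (.inc (d + 1)) (.moveIn .right)) hH (by omega) (by omega) I (t.eval ρ)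
      (fun j _ σ c h => h)
      (by
        rintro j hj σ ⟨h1, h2, -⟩
        rw [h2, h1 d (by omega), hρ', Function.update_self])
      (by
        intro j hj
        refine Triple.seq hH (Q := fun σ => Agree (d + 1) ρ' σ ∧ σ.reg (d + 1) = j + 1 ∧
          σ.inPos = min (j + 1) (x.length + 1)) (Triple.inc hH (by omega) ?_)
          (Triple.moveIn hH ?_)
        · rintro σ ⟨h1, h2, h3⟩
          refine ⟨by omega, h1.set ?_ (by omega), by simp [RegState.set, h2], h3⟩
          intro i hi _; exact ⟨hi, rfl⟩
        · rintro σ ⟨h1, h2, h3⟩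
          refine ⟨h1, h2, ?_⟩
          simp only [setPos, moveHead, h3]
          omega)
    refine Triple.seq hH (Tm.compile_correct hH hφ le_rfl hρ (by omega) (by omega)) <|
      Triple.seq hH (Triple.rewindIn hH (Q := fun σ => Agree (d + 1) ρ' σ ∧ σ.inPos = 0)
        fun σ hσ => ⟨hσ, rfl⟩) <|
      Triple.seq hH (Triple.moveIn hH (Q := fun σ => Agree (d + 1) ρ' σ ∧ σ.inPos = 1)
        fun σ hσ => ⟨hσ.1, ?_⟩) <|
      Triple.seq hH (Triple.clr hH (by omega) (Q := I 0) fun σ hσ => ?_) <|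
      Triple.seq hH hloop (Triple.test hH fun σ hσ => ?_)
    · simp only [setPos, moveHead, hσ.2]; omega
    · refine ⟨hσ.1.set ?_ (by omega), by simp [RegState.set], ?_⟩
      · intro i hi _; exact ⟨hi, rfl⟩
      · simp only [RegState.set, hσ.2]; omega
    · refine ⟨(hσ.1.mono (by omega) ?_).setFlag _, ?_⟩
      · intro i hi
        rw [hρ', Function.update_of_ne (by omega)]
      · simp only [RegState.setFlag, hσ.2.2, eval]
        exact isSym_readInput
  | not φ ih =>
    simp only [bd, width] at hK hk
    refine Triple.seq hH (ih hφ hρ hK hk) (Triple.test hH fun σ hσ => ⟨hσ.1, ?_⟩)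
    simp only [RegState.setFlag, eval, ← hσ.2]
    simp
  | and φ ψ ih₁ ih₂ =>
    simp only [bd, width] at hK hk
    refine Triple.seq hH (ih₁ hφ.1 hρ (by omega) (by omega)) (Triple.ite hH ?_ (Triple.skip ?_))
    · intro σ hg hσ
      obtain ⟨σ', h1, h2, h3, h4⟩ := ih₂ hφ.2 hρ (by omega) (by omega) σ hg hσ.1.1
      refine ⟨σ', h1, h2, h3, ?_⟩
      rw [h4]
      have := hσ.1.2.1 hσ.2
      simp [eval, this]
    · intro σ hσ
      have : ¬ φ.eval x d ρ := by rw [← hσ.1.2, hσ.2]; simp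
      exact ⟨hσ.1.1, by simp [eval, this, hσ.2]⟩
  | ex t φ ih =>
    simp only [bd, width] at hK hk
    have hle := Tm.eval_le_bd hφ.1 hρ
    -- The search stops at `m`: the least witness, or the bound itself if there is none.
    obtain ⟨m, hm, hmin, hmw⟩ : ∃ m ≤ t.eval ρ,
        (∀ j < m, ¬ φ.eval x (d + 1) (Function.update ρ d j)) ∧
        (m < t.eval ρ → φ.eval x (d + 1) (Function.update ρ d m)) := by
      classical
      have hex : ∃ m, m = t.eval ρ ∨ φ.eval x (d + 1) (Function.update ρ d m) :=
        ⟨_, Or.inl rfl⟩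
      refine ⟨Nat.find hex, Nat.find_min' hex (Or.inl rfl), fun j hj h => ?_, fun h => ?_⟩
      · exact Nat.find_min hex hj (Or.inr h)
      · exact (Nat.find_spec hex).resolve_left (by omega)
    have hbound : ∀ j ≤ t.eval ρ, ∀ i < d + 1, Function.update ρ d j i ≤ max M (t.bd M) := by
      intro j hj i hi
      by_cases hid : i = d
      · subst hid; simp only [Function.update_self]; omega
      · rw [Function.update_of_ne hid]
        exact le_max_of_le_left (hρ i (by omega))
    have hterm : ∀ j ≤ t.eval ρ, Triple x H K (Agree (d + 1) (Function.update ρ d j))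
        (t.compile (d + 1) : Prog A k) (Agree (d + 2)
          (Function.update (Function.update ρ d j) (d + 1) (t.eval ρ))) := by
      intro j hj
      have := Tm.compile_correct (k := k) (x := x) (ρ := Function.update ρ d j) (d := d + 1)
        (M := M) hH hφ.1 (by omega)
        (fun i hi => by rw [Function.update_of_ne (by omega)]; exact hρ i hi) (by omega) (by omega)
      rwa [Tm.eval_update hφ.1 le_rfl] at this
    set I : ℕ → RegState → Prop := fun j σ =>
      Agree (d + 1) (Function.update ρ d j) σ ∧ (σ.flag = true ↔ j < m) with hI
    have hcheck : ∀ j ≤ m, Triple x H K (Agree (d + 1) (Function.update ρ d j))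
        (check t (φ.compile (d + 1)) d : Prog A k) (I j) := by
      intro j hj
      refine Triple.seq hH (hterm j (by omega)) <|
        Triple.seq hH (Q := fun σ => Agree (d + 1) (Function.update ρ d j) σ ∧
          (σ.flag = true ↔ j = t.eval ρ)) (Triple.eqt hH (by omega) (by omega) ?_) <|
        Triple.ite hH (Triple.test hH ?_) ?_
      · intro σ hσ
        refine ⟨hσ.mono (by omega) fun i hi => Function.update_of_ne (by omega) _ _, ?_⟩
        have h1 := hσ d (by omega)
        have h2 := hσ (d + 1) (by omega)
        rw [Function.update_of_ne (by omega), Function.update_self] at h1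
        rw [Function.update_self] at h2
        simp [RegState.setFlag, h1, h2]
      · rintro σ ⟨⟨h1, h2⟩, h3⟩
        have := h2.1 h3
        exact ⟨h1, by simp only [RegState.setFlag, Bool.false_eq_true, false_iff]; omega⟩
      · refine Triple.seq hH (Q := fun σ => Agree (d + 1) (Function.update ρ d j) σ ∧
          (σ.flag = true ↔ j = m)) ?_ (Triple.test hH ?_)
        · rintro σ hg ⟨⟨h1, h2⟩, h3⟩
          obtain ⟨σ', h4, h5, h6, h7⟩ := ih hφ.2 (hbound j (by omega)) (by omega) (by omega) σ hg h1
          refine ⟨σ', h4, h5, h6, ?_⟩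
          rw [h7]
          have hjt : j ≠ t.eval ρ := fun h => by simp [h2.2 h] at h3
          constructor
          · intro h
            by_contra hne
            exact hmin j (by omega) h
          · rintro rfl
            exact hmw (by omega)
        · rintro σ ⟨h1, h2⟩
          refine ⟨h1, ?_⟩
          simp only [RegState.setFlag, Bool.not_eq_true', ← Bool.not_eq_true, h2]
          omega
    have hloop := Triple.loop (x := x) (K := K) (k := k) hH (t := fun _ b => b)
      (p := .seq (.inc d) (check t (φ.compile (d + 1)) d)) I m (fun j _ σ hσ => hσ.2)
      (by
        intro j hj
        refine Triple.seq hH (Triple.inc hH (by omega) ?_) (hcheck (j + 1) (by omega))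
        intro σ hσ
        have h1 := hσ.1 d (by omega)
        rw [Function.update_self] at h1
        refine ⟨by omega, hσ.1.set ?_ (by simp [h1])⟩
        intro i hi hid; exact ⟨hi, by simp [hid]⟩)
    -- The loop ends with a false flag whether or not a witness was found; comparing the candidate
    -- with the bound once more tells the two cases apart.
    refine Triple.seq hH (Triple.clr hH (by omega) (Q := Agree (d + 1) (Function.update ρ d 0)) ?_) <|
      Triple.seq hH (hcheck 0 (by omega)) <|
      Triple.seq hH hloop <|
      Triple.seq hH ((hterm m hm).mono (fun σ hσ => hσ.1) (fun _ h => h)) <|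
      Triple.seq hH (Q := fun σ => Agree d ρ σ ∧ (σ.flag = true ↔ m = t.eval ρ))
        (Triple.eqt hH (by omega) (by omega) ?_) (Triple.test hH ?_)
    · intro σ hσ
      refine hσ.set ?_ (by simp)
      intro i hi hid; exact ⟨by omega, by simp [hid]⟩
    · intro σ hσ
      have h1 := hσ d (by omega)
      have h2 := hσ (d + 1) (by omega)
      rw [Function.update_of_ne (by omega), Function.update_self] at h1
      rw [Function.update_self] at h2
      refine ⟨(hσ.mono (by omega) fun i hi => ?_).setFlag _, by simp [RegState.setFlag, h1, h2]⟩
      rw [Function.update_of_ne (by omega), Function.update_of_ne (by omega)]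
    · rintro σ ⟨h1, h2⟩
      refine ⟨h1, ?_⟩
      simp only [RegState.setFlag, Bool.not_eq_true', ← Bool.not_eq_true, h2, eval]
      constructor
      · intro h; exact ⟨m, by omega, hmw (by omega)⟩
      · rintro ⟨v, hv, hv'⟩ rfl
        exact hmin v hv hv'

/-- A polynomially bounded number has logarithmically many digits; the summand 3 leaves room for the
mark and the closing blank. -/
theorem size_pow_le (n D : ℕ) : Nat.size ((n + 2) ^ D) + 3 ≤ (2 * D + 4) * (Nat.log 2 n + 1) := by
  have h1 : n + 2 ≤ 2 ^ (Nat.log 2 n + 2) := by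
    have := Nat.lt_pow_succ_log_self (b := 2) (by norm_num) n
    rw [pow_succ]
    have h2 : 1 ≤ Nat.log 2 n + 1 := by omega
    have h3 : 2 ^ 1 ≤ 2 ^ (Nat.log 2 n + 1) := Nat.pow_le_pow_right (by norm_num) h2
    have h4 : (Nat.log 2 n).succ = Nat.log 2 n + 1 := rfl
    rw [h4] at this
    omega
  have h2 : Nat.size ((n + 2) ^ D) ≤ (Nat.log 2 n + 2) * D + 1 := by
    rw [Nat.size_le, pow_succ, pow_mul]
    have := Nat.pow_le_pow_left h1 D
    have h3 : 0 < (2 ^ (Nat.log 2 n + 2)) ^ D := by positivity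
    omega
  nlinarith [Nat.zero_le (Nat.log 2 n), Nat.zero_le (Nat.log 2 n * D)]

/-- Languages that are definable in bounded arithmetic are in deterministic logarithmic space. -/
theorem inLogspace [Finite A] {L : Language A} (φ : Fm A) (hφ : φ.Scoped 1)
    (h : ∀ x, x ∈ L ↔ φ.eval x 1 fun _ => x.length) : InLogspace L := by
  obtain ⟨D, hD⟩ := φ.exists_bd_le_pow
  set k := 1 + φ.width
  refine ⟨(Prog.seq Prog.setup (Prog.seq measure (φ.compile 1)) : Prog A k).toTM,
    2 * (D + 1) + 4, decidesInSpace _ _ _ (fun n => by positivity) fun x => ?_⟩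
  -- The base is at least 2, as `hD` requires, and bounds the only variable, the length. The
  -- exponent `D + 1` makes `K` exceed the length even if `D = 0`.
  set K := (x.length + 2) ^ (D + 1) with hKdef
  have hH := size_pow_le x.length (D + 1)
  rw [← hKdef] at hH
  have hxK : x.length + 2 ≤ K := Nat.le_self_pow (by omega) _
  have hφK : φ.bd (x.length + 2) ≤ K :=
    (hD _ (by omega)).trans (Nat.pow_le_pow_right (by omega) (by omega))
  obtain ⟨σ, h1, h2, h3, h4⟩ := Triple.seq hH (measure_correct (x := x) (k := k) hH (by omega) (by omega))
    (compile_correct (M := x.length + 2) hH hφ (fun _ _ => by omega) hφK le_rfl)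
    ⟨fun _ => 0, false, 0⟩ ⟨fun _ => Nat.zero_le _, Nat.zero_le _⟩ ⟨rfl, rfl⟩
  refine ⟨σ.rest k, (runs_setup (by omega)).seq h1 (Nat.zero_le _) (within_rest (by omega)), ?_⟩
  rw [h x, ← h4]
  rfl

end Fm

/-! ### Definability -/

/-- Contexts: an input together with the values of finitely many variables, the variable `0` being
the length of the input. -/
class Ctx (A : outParam Type) (Γ : Type) where
  depth : ℕ
  inp : Γ → List A
  env : Γ → ℕ → ℕ
  depth_pos : 0 < depth
  env_zero : ∀ g, env g 0 = (inp g).length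

namespace Ctx

variable {A : Type}

instance : Ctx A (List A) where
  depth := 1
  inp := id
  env := fun x _ => x.length
  depth_pos := Nat.one_pos
  env_zero := fun _ => rfl

/-- The context for the body of a quantifier. The new value is stored at index `depth Γ`, which is
the variable that `Fm.ex` binds at this depth. -/
instance {Γ : Type} [Ctx A Γ] : Ctx A (Γ × ℕ) where
  depth := depth Γ + 1
  inp := fun p => inp p.1
  env := fun p => Function.update (env p.1) (depth Γ) p.2
  depth_pos := Nat.succ_pos _
  env_zero := fun p => by
    have := depth_pos (Γ := Γ)
    rw [Function.update_of_ne (by omega), env_zero]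

end Ctx

open Ctx in
/-- Functions of the context that are given by terms. -/
def DefFun {A Γ : Type} [Ctx A Γ] (f : Γ → ℕ) : Prop :=
  ∃ t : Tm, t.Scoped (depth Γ) ∧ ∀ g, t.eval (env g) = f g

open Ctx in
/-- Predicates of the context that are given by formulas. -/
def DefPred {A Γ : Type} [Ctx A Γ] (P : Γ → Prop) : Prop :=
  ∃ φ : Fm A, φ.Scoped (depth Γ) ∧ ∀ g, φ.eval (inp g) (depth Γ) (env g) ↔ P g

namespace DefFun

open Ctx

variable {A Γ : Type} [Ctx A Γ] {f f' : Γ → ℕ}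

theorem const (c : ℕ) : DefFun fun _ : Γ => c := ⟨.const c, trivial, fun _ => rfl⟩

theorem length : DefFun fun g : Γ => (inp g).length :=
  ⟨.var 0, depth_pos, fun g => env_zero g⟩

theorem add (h : DefFun f) (h' : DefFun f') : DefFun fun g => f g + f' g := by
  obtain ⟨t, ht, h⟩ := h
  obtain ⟨u, hu, h'⟩ := h'
  exact ⟨.add t u, ⟨ht, hu⟩, fun g => by simp [Tm.eval, h, h']⟩

theorem mul (h : DefFun f) (h' : DefFun f') : DefFun fun g => f g * f' g := by
  obtain ⟨t, ht, h⟩ := h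
  obtain ⟨u, hu, h'⟩ := h'
  exact ⟨.mul t u, ⟨ht, hu⟩, fun g => by simp [Tm.eval, h, h']⟩

theorem snd : DefFun fun p : Γ × ℕ => p.2 :=
  ⟨.var (depth Γ), Nat.lt_succ_self _, fun _ => Function.update_self _ _ _⟩

theorem fst (h : DefFun f) : DefFun fun p : Γ × ℕ => f p.1 := by
  obtain ⟨t, ht, h⟩ := h
  refine ⟨t, ht.mono (Nat.le_succ _), fun p => ?_⟩
  exact (Tm.eval_update ht le_rfl _).trans (h p.1)

theorem sum {ι : Type} (s : Finset ι) {f : ι → Γ → ℕ} (h : ∀ i ∈ s, DefFun (f i)) :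
    DefFun fun g => ∑ i ∈ s, f i g := by
  classical
  induction s using Finset.induction_on with
  | empty => simpa using const 0
  | insert a s ha ih =>
    simp only [Finset.sum_insert ha]
    exact (h a (by simp)).add (ih fun i hi => h i (by simp [hi]))

end DefFun

namespace DefPred

open Ctx

variable {A Γ : Type} [Ctx A Γ] {f f' : Γ → ℕ} {P Q : Γ → Prop}

theorem congr (h : DefPred P) (hPQ : ∀ g, P g ↔ Q g) : DefPred Q := by
  obtain ⟨φ, hφ, h⟩ := h
  exact ⟨φ, hφ, fun g => (h g).trans (hPQ g)⟩

theorem eq (h : DefFun f) (h' : DefFun f') : DefPred fun g => f g = f' g := by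
  obtain ⟨t, ht, h⟩ := h
  obtain ⟨u, hu, h'⟩ := h'
  exact ⟨.eq t u, ⟨ht, hu⟩, fun g => by simp [Fm.eval, h, h']⟩

theorem sym (a : A) (h : DefFun f) : DefPred fun g => (inp g)[f g]? = some a := by
  obtain ⟨t, ht, h⟩ := h
  exact ⟨.sym a t, ht, fun g => by simp [Fm.eval, h]⟩

theorem not (h : DefPred P) : DefPred fun g => ¬ P g := by
  obtain ⟨φ, hφ, h⟩ := h
  exact ⟨.not φ, hφ, fun g => by simp [Fm.eval, h]⟩

theorem and (h : DefPred P) (h' : DefPred Q) : DefPred fun g => P g ∧ Q g := by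
  obtain ⟨φ, hφ, h⟩ := h
  obtain ⟨ψ, hψ, h'⟩ := h'
  exact ⟨.and φ ψ, ⟨hφ, hψ⟩, fun g => by simp [Fm.eval, h, h']⟩

theorem or (h : DefPred P) (h' : DefPred Q) : DefPred fun g => P g ∨ Q g :=
  (h.not.and h'.not).not.congr fun g => by tauto

theorem imp (h : DefPred P) (h' : DefPred Q) : DefPred fun g => P g → Q g :=
  (h.and h'.not).not.congr fun g => by tauto

theorem iff (h : DefPred P) (h' : DefPred Q) : DefPred fun g => (P g ↔ Q g) :=
  ((h.imp h').and (h'.imp h)).congr fun g => by tauto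

theorem ex {P : Γ → ℕ → Prop} (h : DefFun f) (h' : DefPred fun p : Γ × ℕ => P p.1 p.2) :
    DefPred fun g => ∃ v < f g, P g v := by
  obtain ⟨t, ht, h⟩ := h
  obtain ⟨φ, hφ, h'⟩ := h'
  refine ⟨.ex t φ, ⟨ht, hφ⟩, fun g => ?_⟩
  simp only [Fm.eval, h]
  exact exists_congr fun v => and_congr_right fun _ => h' (g, v)

theorem all {P : Γ → ℕ → Prop} (h : DefFun f) (h' : DefPred fun p : Γ × ℕ => P p.1 p.2) :
    DefPred fun g => ∀ v < f g, P g v :=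
  (ex (P := fun g v => ¬ P g v) h h'.not).not.congr fun g => by push Not; rfl

theorem lt (h : DefFun f) (h' : DefFun f') : DefPred fun g => f g < f' g :=
  (ex (P := fun g v => v = f g) h' (eq .snd h.fst)).congr fun g => by simp

theorem le (h : DefFun f) (h' : DefFun f') : DefPred fun g => f g ≤ f' g :=
  (lt h' h).not.congr fun g => by simp

theorem const (p : Prop) : DefPred fun _ : Γ => p := by
  by_cases hp : p
  · exact (eq (.const 0) (.const 0)).congr fun _ => by simp [hp]
  · exact (eq (.const 0) (.const 1)).congr fun _ => by simp [hp]

/-- A finite disjunction written out inside the formula. The index set does not depend on the input,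
so it need not be given effectively. -/
theorem exists_mem {ι : Type} {s : Set ι} (hs : s.Finite) {P : ι → Γ → Prop}
    (h : ∀ i ∈ s, DefPred (P i)) : DefPred fun g => ∃ i ∈ s, P i g := by
  induction s, hs using Set.Finite.induction_on with
  | empty => exact (const False).congr fun _ => by simp
  | insert ha hs ih =>
    refine ((h _ (Set.mem_insert _ _)).or (ih fun i hi => h i (Set.mem_insert_of_mem _ hi))).congr
      fun g => ?_
    simp

end DefPred

/-- Predicates of an input and a vector of numbers that are given by formulas in all contexts. -/
def DefVec {A : Type} {N : ℕ} (P : List A → (Fin N → ℕ) → Prop) : Prop :=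
  ∀ (Γ : Type) [Ctx A Γ] (f : Fin N → Γ → ℕ), (∀ i, DefFun (f i)) →
    DefPred fun g => P (Ctx.inp g) fun i => f i g

/-- The coordinates are quantified one at a time. Because `DefVec` demands definability in every
context, the predicate remains available under a quantifier just introduced. -/
theorem DefVec.exists {A : Type} {N : ℕ} {P : List A → (Fin N → ℕ) → Prop} (h : DefVec P) :
    DefPred fun x : List A => ∃ v : Fin N → ℕ, (∀ i, v i < x.length + 1) ∧ P x v := by
  induction N with
  | zero =>
    refine (h (List A) (fun i => i.elim0) fun i => i.elim0).congr fun x => ?_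
    constructor
    · intro hx; exact ⟨_, fun i => i.elim0, hx⟩
    · rintro ⟨v, -, hv⟩
      convert (show P (Ctx.inp x) v from hv) using 2
  | succ N ih =>
    have h' : DefVec fun x (v : Fin N → ℕ) => ∃ a < x.length + 1, P x (Fin.cons a v) := by
      intro Γ _ f hf
      refine DefPred.ex (P := fun g a => P (Ctx.inp g) (Fin.cons a fun i => f i g))
        (DefFun.length.add (.const 1)) ?_
      refine (h (Γ × ℕ) (Fin.cons (fun p => p.2) fun i p => f i p.1) ?_).congr fun p => ?_
      · intro i
        refine Fin.cases ?_ (fun i => ?_) i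
        · exact DefFun.snd
        · exact (hf i).fst
      · refine iff_of_eq (congrArg _ ?_)
        funext i
        refine Fin.cases ?_ (fun i => ?_) i <;> rfl
    refine (ih h').congr fun x => ?_
    constructor
    · rintro ⟨v, hv, a, ha, hP⟩
      exact ⟨Fin.cons a v, Fin.cases ha hv, hP⟩
    · rintro ⟨v, hv, hP⟩
      refine ⟨Fin.tail v, fun i => hv i.succ, v 0, hv 0, ?_⟩
      rwa [Fin.cons_self_tail]

theorem DefPred.inLogspace {A : Type} [Finite A] {L : Language A}
    (h : DefPred fun x : List A => x ∈ L) : InLogspace L := by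
  classical
  obtain ⟨φ, hφ, h⟩ := h
  exact φ.inLogspace hφ fun x => (h x).symm

/-! ### Chains of unary operators -/

namespace LTL

variable {α : Type}

/-- Apply a chain of unary operators, the head of the list being the outermost one. -/
def chain (c : List UnOp) (φ : LTL α) : LTL α := c.foldr un φ

theorem suffix_suffix (w : ℕ → Set α) (i j : ℕ) : suffix (suffix w i) j = suffix w (i + j) := by
  funext k; simp [suffix, Nat.add_assoc]

theorem suffix_zero (w : ℕ → Set α) : suffix w 0 = w := by
  funext k; simp [suffix]

end LTL

/-- The action of a unary operator on predicates of positions. -/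
def UnOp.sem : UnOp → (ℕ → Prop) → ℕ → Prop
  | .not, f, i => ¬ f i
  | .X, f, i => f (i + 1)
  | .F, f, i => ∃ j, f (i + j)
  | .G, f, i => ∀ j, f (i + j)

theorem LTL.sat_un {α : Type} (w : ℕ → Set α) (o : UnOp) (φ : LTL α) (i : ℕ) :
    Sat (suffix w i) (un o φ) ↔ o.sem (fun j => Sat (suffix w j) φ) i := by
  cases o <;> simp [Sat, UnOp.sem, suffix_suffix]

/-- The modalities generated by `F` and `G`. -/
inductive Modality
  | id | F | G | FG | GF
  deriving DecidableEq

namespace Modality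

instance : Fintype Modality where
  elems := {.id, .F, .G, .FG, .GF}
  complete := by intro M; cases M <;> decide

/-- The action of a modality on predicates of positions. -/
def sem : Modality → (ℕ → Prop) → ℕ → Prop
  | id, f, i => f i
  | F, f, i => ∃ j, f (i + j)
  | G, f, i => ∀ j, f (i + j)
  | FG, f, i => ∃ j, ∀ l, f (i + j + l)
  | GF, f, i => ∀ j, ∃ l, f (i + j + l)

/-- The dual modality. -/
def dual : Modality → Modality
  | id => id | F => G | G => F | FG => GF | GF => FG

/-- Composition with `F` on the left. -/
def compF : Modality → Modality
  | id => F | F => F | G => FG | FG => FG | GF => GF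

/-- Composition with `G` on the left. -/
def compG : Modality → Modality
  | id => G | F => GF | G => G | FG => FG | GF => GF

theorem sem_dual (M : Modality) (f : ℕ → Prop) (i : ℕ) :
    M.dual.sem (fun j => ¬ f j) i ↔ ¬ M.sem f i := by
  cases M <;> simp [dual, sem]

/-- The absorption laws FF = F, FFG = FG and FGF = GF; in the last one, whether something holds
infinitely often does not depend on the starting point. -/
theorem sem_compF (M : Modality) (f : ℕ → Prop) (i : ℕ) :
    M.compF.sem f i ↔ ∃ j, M.sem f (i + j) := by
  cases M with
  | id => rfl
  | G => rfl
  | F =>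
    constructor
    · rintro ⟨j, h⟩; exact ⟨0, j, h⟩
    · rintro ⟨j, l, h⟩; exact ⟨j + l, by rwa [← Nat.add_assoc]⟩
  | FG =>
    constructor
    · rintro ⟨j, h⟩; exact ⟨0, j, h⟩
    · rintro ⟨j, l, h⟩; exact ⟨j + l, by rwa [← Nat.add_assoc]⟩
  | GF =>
    constructor
    · intro h; exact ⟨0, h⟩
    · rintro ⟨j, h⟩ m
      obtain ⟨l, hl⟩ := h m
      exact ⟨j + l, by convert hl using 1; omega⟩

theorem sem_compG (M : Modality) (f : ℕ → Prop) (i : ℕ) :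
    M.compG.sem f i ↔ ∀ j, M.sem f (i + j) := by
  have h1 : M.compG = M.dual.compF.dual := by cases M <;> rfl
  have h2 : f = fun j => ¬ ¬ f j := by simp
  rw [h1, h2, sem_dual, sem_compF]
  simp only [sem_dual, not_exists, not_not]

/-- The action of a modality with a sign on predicates of positions. -/
def signedSem (m : Bool × Modality) (f : ℕ → Prop) : ℕ → Prop :=
  m.2.sem (if m.1 then fun i => ¬ f i else f)

/-- Composition with a unary operator on the left, `X` being ignored. -/
def push : UnOp → Bool × Modality → Bool × Modality
  | .not, m => (!m.1, m.2.dual)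
  | .X, m => m
  | .F, m => (m.1, m.2.compF)
  | .G, m => (m.1, m.2.compG)

/-- The signed modality of a chain. -/
def ofChain (c : List UnOp) : Bool × Modality := c.foldr push (false, id)

/-- A negation travels inwards by duality, so a single sign on the argument suffices. -/
theorem signedSem_push {o : UnOp} (ho : o ≠ .X) (m : Bool × Modality) (f : ℕ → Prop) (i : ℕ) :
    signedSem (push o m) f i ↔ o.sem (signedSem m f) i := by
  obtain ⟨b, M⟩ := m
  cases o with
  | not =>
    have : ∀ g : ℕ → Prop, M.dual.sem g i ↔ ¬ M.sem (fun j => ¬ g j) i := by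
      intro g; rw [← sem_dual]; simp
    cases b
    · exact sem_dual M f i
    · exact this f
  | X => exact absurd rfl ho
  | F => exact sem_compF _ _ _
  | G => exact sem_compG _ _ _

/-- Pigeonhole: there are two signs and five modalities, so in a longer chain two of its first
eleven suffixes have the same signed modality, and the piece between their starting points can be
cut out. Cutting introduces no new operator. -/
theorem ofChain_shrink (c : List UnOp) : ∃ c', ofChain c' = ofChain c ∧ c'.length ≤ 10 ∧
    c'.length ≤ c.length ∧ c' ⊆ c := by
  induction h : c.length using Nat.strong_induction_on generalizing c with
  | _ n ih =>
    subst h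
    by_cases hc : c.length ≤ 10
    · exact ⟨c, rfl, hc, le_rfl, List.Subset.refl _⟩
    · obtain ⟨i, j, hij, heq⟩ := Fintype.exists_ne_map_eq_of_card_lt
        (fun i : Fin 11 => ofChain (c.drop i)) (by simp [Fintype.card_prod]; decide)
      wlog hlt : i < j generalizing i j
      · exact this j i hij.symm heq.symm (lt_of_le_of_ne (not_lt.1 hlt) hij.symm)
      have hlt' : (i : ℕ) < j := hlt
      have h11 := j.2
      have hlen : (c.take i ++ c.drop j).length < c.length := by
        simp only [List.length_append, List.length_take, List.length_drop]; omega
      obtain ⟨c', h1, h2, h3, h4⟩ := ih _ hlen _ rfl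
      refine ⟨c', ?_, h2, h3.trans hlen.le, List.Subset.trans h4 ?_⟩
      · rw [h1]
        conv_rhs => rw [← List.take_append_drop i c]
        simp only [ofChain, List.foldr_append] at heq ⊢
        rw [heq]
      · intro o ho
        rcases List.mem_append.1 ho with ho | ho
        · exact List.mem_of_mem_take ho
        · exact List.mem_of_mem_drop ho

end Modality

namespace LTL

variable {α : Type}

/-- `X` commutes with every unary operator, so its occurrences merge into one shift of the position.
-/
theorem sat_chain (w : ℕ → Set α) (c : List UnOp) (φ : LTL α) (i : ℕ) :
    Sat (suffix w i) (chain c φ) ↔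
      Modality.signedSem (Modality.ofChain c) (fun j => Sat (suffix w j) φ) (i + c.count .X) := by
  induction c generalizing i with
  | nil => rfl
  | cons o c ih =>
    change Sat (suffix w i) (un o (chain c φ)) ↔ _
    rw [sat_un]
    by_cases ho : o = .X
    · subst ho
      simp only [UnOp.sem, ih, List.count_cons_self]
      rw [show i + 1 + c.count .X = i + (c.count .X + 1) by omega]
      rfl
    · have h1 : (o :: c).count .X = c.count .X := by
        rw [List.count_cons]; simp [ho]
      rw [h1]
      change _ ↔ Modality.signedSem (Modality.push o (Modality.ofChain c)) _ _
      rw [Modality.signedSem_push ho]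
      cases o <;> simp only [UnOp.sem, ih, Nat.add_right_comm]

/-- A short chain without `X` that is equivalent to `c` up to a power of `X`. -/
theorem exists_short_chain (c : List UnOp) : ∃ c' : List UnOp, c'.length ≤ 10 ∧
    c'.length + c.count .X ≤ c.length ∧ c' ⊆ c ∧ ∀ {α : Type} (w : ℕ → Set α) (φ : LTL α),
      Sat w (chain c φ) ↔ Sat w (chain (List.replicate (c.count .X) .X ++ c') φ) := by
  obtain ⟨c', h1, h2, h3, h4⟩ := Modality.ofChain_shrink (c.filter (· ≠ .X))
  have hlen : (c.filter (· ≠ .X)).length + c.count .X = c.length := by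
    rw [List.count_eq_length_filter, Nat.add_comm]
    have := List.length_eq_length_filter_add (l := c) (· == UnOp.X)
    rw [this]; congr 3
    funext o; cases o <;> rfl
  have hX : c'.count .X = 0 := by
    rw [List.count_eq_zero]
    intro h
    simpa using h4 h
  have hof : ∀ d : List UnOp, Modality.ofChain (d.filter (· ≠ .X)) = Modality.ofChain d := by
    intro d
    induction d with
    | nil => rfl
    | cons o d ih => cases o <;> simp [Modality.ofChain, Modality.push] at ih ⊢ <;> simp [ih]
  have hrep : ∀ k, Modality.ofChain (List.replicate k .X ++ c') = Modality.ofChain c' := by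
    intro k
    induction k with
    | zero => rfl
    | succ k ih => exact ih
  refine ⟨c', h2, by omega, fun o ho => List.mem_of_mem_filter (h4 ho), fun w φ => ?_⟩
  rw [← suffix_zero w, sat_chain, sat_chain, hrep, h1, hof, List.count_append, hX,
    List.count_replicate_self]
  rfl

end LTL

/-! ### Sub-formulas as a graph -/

namespace LTL

variable {α : Type}

/-- The operand of a unary formula. -/
def operand : LTL α → LTL α
  | un _ φ => φ
  | φ => φ

/-- Whether the outermost operator is unary. -/
def isUn : LTL α → Bool
  | un _ _ => true
  | _ => false

variable [DecidableEq α]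

/-- The operands of the outermost operator if it is binary. -/
def binOperands : LTL α → Finset (LTL α)
  | binTemp _ φ ψ => {φ, ψ}
  | binLog _ φ ψ => {φ, ψ}
  | _ => ∅

theorem self_mem_subF (φ : LTL α) : φ ∈ φ.subF := by
  cases φ <;> simp [subF]

theorem subF_subset {φ ψ : LTL α} (h : ψ ∈ φ.subF) : ψ.subF ⊆ φ.subF := by
  induction φ with
  | atom p => simp only [subF, Finset.mem_singleton] at h; subst h; rfl
  | un o φ ih =>
    simp only [subF, Finset.mem_insert] at h
    rcases h with rfl | h
    · rfl
    · exact (ih h).trans (Finset.subset_insert _ _)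
  | binTemp o φ φ' ih ih' =>
    simp only [subF, Finset.mem_insert, Finset.mem_union] at h
    rcases h with rfl | h | h
    · rfl
    · exact ((ih h).trans Finset.subset_union_left).trans (Finset.subset_insert _ _)
    · exact ((ih' h).trans Finset.subset_union_right).trans (Finset.subset_insert _ _)
  | binLog o φ φ' ih ih' =>
    simp only [subF, Finset.mem_insert, Finset.mem_union] at h
    rcases h with rfl | h | h
    · rfl
    · exact ((ih h).trans Finset.subset_union_left).trans (Finset.subset_insert _ _)
    · exact ((ih' h).trans Finset.subset_union_right).trans (Finset.subset_insert _ _)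

theorem sizeOf_le_of_mem_subF {φ ψ : LTL α} (h : ψ ∈ φ.subF) : sizeOf ψ ≤ sizeOf φ := by
  induction φ with
  | atom p => simp only [subF, Finset.mem_singleton] at h; subst h; rfl
  | un o φ ih =>
    simp only [subF, Finset.mem_insert] at h
    rcases h with rfl | h
    · rfl
    · have := ih h; simp only [un.sizeOf_spec]; omega
  | binTemp o φ φ' ih ih' =>
    simp only [subF, Finset.mem_insert, Finset.mem_union] at h
    rcases h with rfl | h | h
    · rfl
    · have := ih h; simp only [binTemp.sizeOf_spec]; omega
    · have := ih' h; simp only [binTemp.sizeOf_spec]; omega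
  | binLog o φ φ' ih ih' =>
    simp only [subF, Finset.mem_insert, Finset.mem_union] at h
    rcases h with rfl | h | h
    · rfl
    · have := ih h; simp only [binLog.sizeOf_spec]; omega
    · have := ih' h; simp only [binLog.sizeOf_spec]; omega

theorem UsesOnly.of_mem_subF {Ut : Set UnOp} {Bt : Set BinTempOp} {Bl : Set BinLogOp}
    {φ ψ : LTL α} (hφ : φ.UsesOnly Ut Bt Bl) (h : ψ ∈ φ.subF) : ψ.UsesOnly Ut Bt Bl := by
  induction φ with
  | atom p => simp only [subF, Finset.mem_singleton] at h; subst h; exact hφ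
  | un o φ ih =>
    simp only [subF, Finset.mem_insert] at h
    rcases h with rfl | h
    · exact hφ
    · exact ih hφ.2 h
  | binTemp o φ φ' ih ih' =>
    simp only [subF, Finset.mem_insert, Finset.mem_union] at h
    rcases h with rfl | h | h
    · exact hφ
    · exact ih hφ.2.1 h
    · exact ih' hφ.2.2 h
  | binLog o φ φ' ih ih' =>
    simp only [subF, Finset.mem_insert, Finset.mem_union] at h
    rcases h with rfl | h | h
    · exact hφ
    · exact ih hφ.2.1 h
    · exact ih' hφ.2.2 h

/-- A proper sub-formula is an operand of a sub-formula. -/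
theorem exists_parent {φ ψ : LTL α} (h : ψ ∈ φ.subF) (hne : ψ ≠ φ) :
    (∃ o, un o ψ ∈ φ.subF) ∨ ∃ χ ∈ φ.subF, ψ ∈ χ.binOperands := by
  induction φ with
  | atom p => simp only [subF, Finset.mem_singleton] at h; exact absurd h hne
  | un o φ ih =>
    simp only [subF, Finset.mem_insert] at h
    have h := h.resolve_left hne
    by_cases hψ : ψ = φ
    · subst hψ; exact Or.inl ⟨o, self_mem_subF _⟩
    · have hs : φ.subF ⊆ (un o φ).subF := Finset.subset_insert _ _
      rcases ih h hψ with ⟨o', h'⟩ | ⟨χ, h', h''⟩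
      · exact Or.inl ⟨o', hs h'⟩
      · exact Or.inr ⟨χ, hs h', h''⟩
  | binTemp o φ φ' ih ih' =>
    simp only [subF, Finset.mem_insert, Finset.mem_union] at h
    have hs : φ.subF ⊆ (binTemp o φ φ').subF :=
      Finset.subset_union_left.trans (Finset.subset_insert _ _)
    have hs' : φ'.subF ⊆ (binTemp o φ φ').subF :=
      Finset.subset_union_right.trans (Finset.subset_insert _ _)
    by_cases hψ : ψ = φ ∨ ψ = φ'
    · exact Or.inr ⟨_, self_mem_subF _, by simpa [binOperands] using hψ⟩
    · rw [not_or] at hψ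
      rcases h.resolve_left hne with h | h
      · rcases ih h hψ.1 with ⟨o', h'⟩ | ⟨χ, h', h''⟩
        · exact Or.inl ⟨o', hs h'⟩
        · exact Or.inr ⟨χ, hs h', h''⟩
      · rcases ih' h hψ.2 with ⟨o', h'⟩ | ⟨χ, h', h''⟩
        · exact Or.inl ⟨o', hs' h'⟩
        · exact Or.inr ⟨χ, hs' h', h''⟩
  | binLog o φ φ' ih ih' =>
    simp only [subF, Finset.mem_insert, Finset.mem_union] at h
    have hs : φ.subF ⊆ (binLog o φ φ').subF :=
      Finset.subset_union_left.trans (Finset.subset_insert _ _)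
    have hs' : φ'.subF ⊆ (binLog o φ φ').subF :=
      Finset.subset_union_right.trans (Finset.subset_insert _ _)
    by_cases hψ : ψ = φ ∨ ψ = φ'
    · exact Or.inr ⟨_, self_mem_subF _, by simpa [binOperands] using hψ⟩
    · rw [not_or] at hψ
      rcases h.resolve_left hne with h | h
      · rcases ih h hψ.1 with ⟨o', h'⟩ | ⟨χ, h', h''⟩
        · exact Or.inl ⟨o', hs h'⟩
        · exact Or.inr ⟨χ, hs h', h''⟩
      · rcases ih' h hψ.2 with ⟨o', h'⟩ | ⟨χ, h', h''⟩
        · exact Or.inl ⟨o', hs' h'⟩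
        · exact Or.inr ⟨χ, hs' h', h''⟩

/-- The number of unary sub-formulas of `φ` with operand `ψ`. -/
def unParents (φ ψ : LTL α) : ℕ :=
  ((φ.subF.filter fun χ => χ.isUn = true).filter fun χ => χ.operand = ψ).card

/-- The sub-formulas at which chains of unary operators begin, end or branch. -/
def special (φ : LTL α) : Finset (LTL α) :=
  (insert φ ((φ.subF.filter fun χ => χ.isBin = true).biUnion binOperands) ∪
    φ.subF.filter fun χ => χ.isUn = false) ∪ φ.subF.filter fun χ => 2 ≤ unParents φ χ

theorem operand_mem_subF {φ χ : LTL α} (h : χ ∈ φ.subF) : χ.operand ∈ φ.subF := by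
  cases χ with
  | un o χ => exact subF_subset h (by simp [subF, operand, self_mem_subF])
  | _ => exact h

theorem binOperands_subset {φ χ : LTL α} (h : χ ∈ φ.subF) : χ.binOperands ⊆ φ.subF := by
  cases χ with
  | binTemp o a b =>
    intro ψ hψ
    refine subF_subset h ?_
    simp only [binOperands, Finset.mem_insert, Finset.mem_singleton] at hψ
    rcases hψ with rfl | rfl <;> simp [subF, self_mem_subF]
  | binLog o a b =>
    intro ψ hψ
    refine subF_subset h ?_
    simp only [binOperands, Finset.mem_insert, Finset.mem_singleton] at hψ
    rcases hψ with rfl | rfl <;> simp [subF, self_mem_subF]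
  | _ => simp [binOperands]

theorem special_subset (φ : LTL α) : φ.special ⊆ φ.subF := by
  intro ψ hψ
  simp only [special, Finset.mem_union, Finset.mem_insert, Finset.mem_biUnion,
    Finset.mem_filter] at hψ
  rcases hψ with ((rfl | ⟨χ, ⟨hχ, -⟩, h⟩) | h) | h
  · exact self_mem_subF _
  · exact binOperands_subset hχ h
  · exact h.1
  · exact h.1

/-- Double counting of the edges from unary formulas to their operands. -/
theorem sum_unParents_mul (φ : LTL α) (f : LTL α → ℕ) :
    ∑ ψ ∈ φ.subF, unParents φ ψ * f ψ =
      ∑ χ ∈ φ.subF.filter fun χ => χ.isUn = true, f χ.operand := by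
  rw [← Finset.sum_fiberwise_of_maps_to (s := φ.subF.filter fun χ => χ.isUn = true)
    (t := φ.subF) (g := operand)
    (fun χ hχ => operand_mem_subF (Finset.mem_filter.1 hχ).1)]
  refine Finset.sum_congr rfl fun ψ _ => ?_
  rw [Finset.sum_congr rfl (g := fun _ => f ψ)
    (fun χ hχ => by rw [(Finset.mem_filter.1 hχ).2])]
  simp [unParents]

theorem card_binOperands_le (φ : LTL α) : φ.binOperands.card ≤ 2 := by
  cases φ <;> simp [binOperands, Finset.card_le_two]

/-- There are as many unary edges as unary sub-formulas. Every branching formula receives an edge in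
excess of one, and only the formulas without unary parent receive none. Comparing with the number of
all sub-formulas, the non-unary and the branching ones together are at most as many as those without
unary parent. The latter lie in `E`, the root and the operands of binary formulas, and `E` itself
makes up the rest of `special`. -/
theorem card_special_le (φ : LTL α) : φ.special.card ≤ 2 * (2 * φ.numBin + 1) := by
  set E := insert φ ((φ.subF.filter fun χ => χ.isBin = true).biUnion binOperands) with hE
  have hEcard : E.card ≤ 2 * φ.numBin + 1 := by
    refine (Finset.card_insert_le _ _).trans ?_
    have := Finset.card_biUnion_le_card_mul (φ.subF.filter fun χ => χ.isBin = true)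
      binOperands 2 (fun χ _ => card_binOperands_le χ)
    rw [numBin]; omega
  have hzero : (φ.subF.filter fun ψ => unParents φ ψ = 0) ⊆ E := by
    intro ψ hψ
    obtain ⟨h1, h2⟩ := Finset.mem_filter.1 hψ
    by_cases hne : ψ = φ
    · simp [hE, hne]
    · rcases exists_parent h1 hne with ⟨o, ho⟩ | ⟨χ, hχ, h⟩
      · rw [unParents, Finset.card_eq_zero, Finset.filter_eq_empty_iff] at h2
        exact absurd rfl (h2 (x := un o ψ) (Finset.mem_filter.2 ⟨ho, rfl⟩))
      · refine Finset.mem_insert_of_mem (Finset.mem_biUnion.2 ⟨χ, ?_, h⟩)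
        refine Finset.mem_filter.2 ⟨hχ, ?_⟩
        cases χ <;> simp_all [binOperands, isBin]
  have hsum := sum_unParents_mul φ fun _ => 1
  -- Pointwise, with `u` unary parents: `1 + [2 ≤ u] ≤ u + [u = 0]`.
  have hpt : ∑ ψ ∈ φ.subF, (1 + if 2 ≤ unParents φ ψ then 1 else 0) ≤
      ∑ ψ ∈ φ.subF, (unParents φ ψ * 1 + if unParents φ ψ = 0 then 1 else 0) := by
    refine Finset.sum_le_sum fun ψ _ => ?_
    split_ifs <;> omega
  rw [Finset.sum_add_distrib, Finset.sum_add_distrib, hsum] at hpt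
  simp only [Finset.sum_boole, Finset.sum_const, smul_eq_mul, mul_one, Nat.cast_id] at hpt
  have hsplit := Finset.card_filter_add_card_filter_not (s := φ.subF) (fun χ => χ.isUn = true)
  have h0 := Finset.card_le_card hzero
  simp only [Bool.not_eq_true] at hsplit
  have h1 : φ.special.card ≤ E.card + (φ.subF.filter fun χ => χ.isUn = false).card +
      (φ.subF.filter fun χ => 2 ≤ unParents φ χ).card :=
    (Finset.card_union_le _ _).trans (Nat.add_le_add_right (Finset.card_union_le _ _) _)
  omega

/-- The chain of unary operators from a formula down to the next special sub-formula. -/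
def segment (S : Finset (LTL α)) : LTL α → List UnOp
  | un o φ => o :: if φ ∈ S then [] else segment S φ
  | _ => []

theorem segment_eq_nil {S : Finset (LTL α)} {φ : LTL α} : segment S φ = [] ↔ φ.isUn = false := by
  cases φ <;> simp [segment, isUn]

/-- The segments that begin at special sub-formulas do not overlap. -/
theorem sum_segment_le (φ : LTL α) :
    ∑ ψ ∈ φ.special, max 1 (segment φ.special ψ).length ≤ φ.size := by
  set S := φ.special with hS
  set ℓ : LTL α → ℕ := fun ψ => (segment S ψ).length with hℓ
  -- A segment is one operator plus, if the operand is not special, the segment of the operand.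
  have h1 : ∑ χ ∈ φ.subF.filter (fun χ => χ.isUn = true),
      (1 + if χ.operand ∈ S then 0 else ℓ χ.operand) = ∑ χ ∈ φ.subF, ℓ χ := by
    rw [Finset.sum_filter]
    refine Finset.sum_congr rfl fun χ _ => ?_
    cases χ with
    | un o χ =>
      simp only [isUn, if_true, operand, hℓ, segment, List.length_cons]
      split_ifs <;> simp [Nat.add_comm]
    | _ => simp [isUn, hℓ, segment]
  have h2 := sum_unParents_mul φ fun ψ => if ψ ∈ S then 0 else ℓ ψ
  rw [Finset.sum_add_distrib, ← h2] at h1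
  -- A formula that is not special has at most one unary parent, so its segment continues at most
  -- one other. With `h1` and `h4`, the segments that begin at special formulas have total length at
  -- most the number of unary sub-formulas.
  have h3 : ∑ ψ ∈ φ.subF, unParents φ ψ * (if ψ ∈ S then 0 else ℓ ψ) ≤
      ∑ ψ ∈ φ.subF, if ψ ∈ S then 0 else ℓ ψ := by
    refine Finset.sum_le_sum fun ψ hψ => ?_
    split_ifs with h
    · simp
    · have : ¬ 2 ≤ unParents φ ψ := fun h' =>
        h (Finset.mem_union_right _ (Finset.mem_filter.2 ⟨hψ, h'⟩))
      exact (Nat.mul_le_mul_right _ (show unParents φ ψ ≤ 1 by omega)).trans_eq (one_mul _)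
  have h4 : ∑ ψ ∈ φ.subF, ℓ ψ = ∑ ψ ∈ S, ℓ ψ + ∑ ψ ∈ φ.subF, if ψ ∈ S then 0 else ℓ ψ := by
    have h : ∑ ψ ∈ S, ℓ ψ = ∑ ψ ∈ φ.subF, if ψ ∈ S then ℓ ψ else 0 := by
      rw [← Finset.sum_filter, Finset.filter_mem_eq_inter,
        Finset.inter_eq_right.2 (special_subset φ)]
    rw [h]
    rw [← Finset.sum_add_distrib]
    refine Finset.sum_congr rfl fun ψ _ => ?_
    split_ifs <;> simp
  -- The segment of a unary formula is non-empty, so the maximum with 1 matters only for non-unary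
  -- formulas, which pay for themselves.
  have h5 : ∑ ψ ∈ S, max 1 (ℓ ψ) ≤ ∑ ψ ∈ S, ((if ψ.isUn = false then 1 else 0) + ℓ ψ) := by
    refine Finset.sum_le_sum fun ψ _ => ?_
    split_ifs with h
    · omega
    · have : ℓ ψ ≠ 0 := by
        simp only [hℓ, ne_eq, List.length_eq_zero_iff, segment_eq_nil]; exact h
      omega
  have h6 : (S.filter fun ψ => ψ.isUn = false).card ≤
      (φ.subF.filter fun ψ => ψ.isUn = false).card :=
    Finset.card_le_card (Finset.filter_subset_filter _ (special_subset φ))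
  rw [Finset.sum_add_distrib] at h5
  simp only [Finset.sum_boole, Nat.cast_id, Finset.sum_const, smul_eq_mul, mul_one] at h5 h1
  have hsplit := Finset.card_filter_add_card_filter_not (s := φ.subF) (fun χ => χ.isUn = true)
  simp only [Bool.not_eq_true] at hsplit
  rw [size]
  change ∑ ψ ∈ S, max 1 (ℓ ψ) ≤ _
  omega

end LTL

/-! ### Shapes of formulas -/

/-- Formulas with parameters for the propositions and for the powers of `X`. -/
inductive Shape (N : ℕ)
  | leaf (i : Fin N)
  | un (o : UnOp) (s : Shape N)
  | pow (i : Fin N) (s : Shape N)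
  | bin (o : BinLogOp) (s t : Shape N)

namespace LTL

variable {α : Type}

theorem sat_un_congr {φ ψ : LTL α} (h : ∀ w, Sat w φ ↔ Sat w ψ) (o : UnOp) (w : ℕ → Set α) :
    Sat w (un o φ) ↔ Sat w (un o ψ) := by
  cases o <;> simp [Sat, h]

theorem chain_append (c c' : List UnOp) (φ : LTL α) :
    chain (c ++ c') φ = chain c (chain c' φ) := by
  simp [chain]

theorem usesOnly_chain {Ut : Set UnOp} {Bt : Set BinTempOp} {Bl : Set BinLogOp} {c : List UnOp}
    {φ : LTL α} : (chain c φ).UsesOnly Ut Bt Bl ↔ (∀ o ∈ c, o ∈ Ut) ∧ φ.UsesOnly Ut Bt Bl := by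
  induction c with
  | nil => simp [chain]
  | cons o c ih =>
    change o ∈ Ut ∧ (chain c φ).UsesOnly Ut Bt Bl ↔ _
    rw [ih]
    simp [and_assoc]

/-- The sub-formulas of a chain above its base. -/
def chainSet [DecidableEq α] (φ : LTL α) : List UnOp → Finset (LTL α)
  | [] => ∅
  | o :: c => insert (chain (o :: c) φ) (chainSet φ c)

theorem subF_chain [DecidableEq α] (c : List UnOp) (φ : LTL α) :
    (chain c φ).subF = chainSet φ c ∪ φ.subF := by
  induction c with
  | nil => simp [chain, chainSet]
  | cons o c ih =>
    change insert _ (chain c φ).subF = _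
    rw [ih, chainSet, Finset.insert_union]
    rfl

theorem card_chainSet_le [DecidableEq α] (c : List UnOp) (φ : LTL α) :
    (chainSet φ c).card ≤ c.length := by
  induction c with
  | nil => simp [chainSet]
  | cons o c ih => exact (Finset.card_insert_le _ _).trans (Nat.succ_le_succ ih)

theorem isBin_of_mem_chainSet [DecidableEq α] {c : List UnOp} {φ ψ : LTL α}
    (h : ψ ∈ chainSet φ c) : ψ.isBin = false := by
  induction c with
  | nil => simp [chainSet] at h
  | cons o c ih =>
    rcases Finset.mem_insert.1 h with rfl | h
    · rfl
    · exact ih h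

end LTL

namespace Shape

variable {N : ℕ} {α : Type}

/-- The formula for given parameters. -/
def inst (θ : Fin N → α) (κ : Fin N → ℕ) : Shape N → LTL α
  | leaf i => .atom (θ i)
  | un o s => .un o (s.inst θ κ)
  | pow i s => LTL.chain (List.replicate (κ i) .X) (s.inst θ κ)
  | bin o s t => .binLog o (s.inst θ κ) (t.inst θ κ)

/-- The height of a shape. -/
def height : Shape N → ℕ
  | leaf _ => 1
  | un _ s => s.height + 1
  | pow _ s => s.height + 1
  | bin _ s t => max s.height t.height + 1

theorem finite_height_le (h : ℕ) : {s : Shape N | s.height ≤ h}.Finite := by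
  induction h with
  | zero =>
    refine Set.Finite.subset Set.finite_empty fun s hs => ?_
    cases s <;> simp [height] at hs
  | succ h ih =>
    have hU : Finite UnOp := Finite.of_injective (fun o : UnOp => match o with
      | .not => (0 : Fin 4) | .X => 1 | .F => 2 | .G => 3) (by
        intro a b hab; cases a <;> cases b <;> simp_all)
    have hB : Finite BinLogOp := Finite.of_injective (fun o : BinLogOp => match o with
      | .or => (0 : Fin 10) | .and => 1 | .imp => 2 | .revImp => 3 | .iff => 4
      | .nor => 5 | .nand => 6 | .nimp => 7 | .nrevImp => 8 | .niff => 9) (by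
        intro a b hab; cases a <;> cases b <;> simp_all)
    refine Set.Finite.subset (((Set.finite_range (leaf (N := N))).union
      ((Set.finite_univ.prod ih).image fun p : UnOp × Shape N => un p.1 p.2)).union
      (((Set.finite_univ.prod ih).image fun p : Fin N × Shape N => pow p.1 p.2).union
      ((Set.finite_univ.prod (ih.prod ih)).image
        fun p : BinLogOp × Shape N × Shape N => bin p.1 p.2.1 p.2.2))) fun s hs => ?_
    cases s with
    | leaf i => exact Or.inl (Or.inl ⟨i, rfl⟩)
    | un o s =>
      exact Or.inl (Or.inr ⟨(o, s), ⟨trivial, by simpa [height] using hs⟩, rfl⟩)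
    | pow i s =>
      exact Or.inr (Or.inl ⟨(i, s), ⟨trivial, by simpa [height] using hs⟩, rfl⟩)
    | bin o s t =>
      have h' : s.height ≤ h ∧ t.height ≤ h := by simpa [height] using hs
      exact Or.inr (Or.inr ⟨(o, s, t), ⟨trivial, h'.1, h'.2⟩, rfl⟩)

/-- An equivalent of the chain `c` up to a power of `X`. -/
noncomputable def shortChain (c : List UnOp) : List UnOp := (LTL.exists_short_chain c).choose

/-- The operators that replace the chain `c`, with the power `k` of `X` if `X` is available. -/
noncomputable def ops (b : Bool) (k : ℕ) (c : List UnOp) : List UnOp :=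
  if c = [] then [] else (if b then List.replicate k .X else []) ++ shortChain c

/-- Put the operators that replace the chain `c` on top of a shape. -/
noncomputable def wrap (b : Bool) (i : Fin N) (c : List UnOp) (s : Shape N) : Shape N :=
  if c = [] then s
  else if b then pow i ((shortChain c).foldr un s) else (shortChain c).foldr un s

theorem inst_foldr (θ : Fin N → α) (κ : Fin N → ℕ) (c : List UnOp) (s : Shape N) :
    (c.foldr un s).inst θ κ = LTL.chain c (s.inst θ κ) := by
  induction c with
  | nil => rfl
  | cons o c ih => exact congrArg (LTL.un o) ih

theorem inst_wrap (θ : Fin N → α) (κ : Fin N → ℕ) (b : Bool) (i : Fin N) (c : List UnOp)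
    (s : Shape N) : (wrap b i c s).inst θ κ = LTL.chain (ops b (κ i) c) (s.inst θ κ) := by
  unfold wrap ops
  split_ifs
  · rfl
  · simp [inst, inst_foldr, LTL.chain_append]
  · simp [inst_foldr]

theorem height_wrap_le (b : Bool) (i : Fin N) (c : List UnOp) (s : Shape N) :
    (wrap b i c s).height ≤ s.height + 11 := by
  have h : ∀ c : List UnOp, (c.foldr un s).height = s.height + c.length := by
    intro c
    induction c with
    | nil => rfl
    | cons o c ih => simp only [List.foldr_cons, height, ih, List.length_cons]; omega
  have := (LTL.exists_short_chain c).choose_spec.1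
  change (shortChain c).length ≤ 10 at this
  unfold wrap
  split_ifs
  · omega
  · simp only [height, h]; omega
  · simp only [h]; omega

variable [DecidableEq α] (S : Finset (LTL α)) (e : LTL α → Fin N) (b : Bool)

/-- The shape of the formula below the chain that begins at a given formula. -/
noncomputable def base : LTL α → Shape N
  | .atom p => leaf (e (.atom p))
  | .un _ φ => if φ ∈ S then wrap b (e φ) (φ.segment S) (base φ) else base φ
  | .binLog o φ ψ =>
    bin o (wrap b (e φ) (φ.segment S) (base φ)) (wrap b (e ψ) (ψ.segment S) (base ψ))
  -- A default value: the results on `ofFormula` assume that no binary temporal operator occurs.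
  | .binTemp _ φ _ => leaf (e φ)

/-- The shape of a formula. -/
noncomputable def ofFormula (φ : LTL α) : Shape N := wrap b (e φ) (φ.segment S) (base S e b φ)

end Shape

namespace LTL

variable {α : Type} [DecidableEq α] {φ : LTL α}

theorem self_mem_special : φ ∈ φ.special :=
  Finset.mem_union_left _ (Finset.mem_union_left _ (Finset.mem_insert_self _ _))

theorem mem_special_of_isUn {ψ : LTL α} (h : ψ ∈ φ.subF) (hψ : ψ.isUn = false) : ψ ∈ φ.special :=
  Finset.mem_union_left _ (Finset.mem_union_right _ (Finset.mem_filter.2 ⟨h, hψ⟩))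

theorem operands_mem_special {o : BinLogOp} {ψ χ : LTL α} (h : binLog o ψ χ ∈ φ.subF) :
    ψ ∈ φ.special ∧ χ ∈ φ.special := by
  have : ∀ ξ ∈ (binLog o ψ χ).binOperands, ξ ∈ φ.special := fun ξ hξ =>
    Finset.mem_union_left _ (Finset.mem_union_left _ (Finset.mem_insert_of_mem
      (Finset.mem_biUnion.2 ⟨_, Finset.mem_filter.2 ⟨h, rfl⟩, hξ⟩)))
  exact ⟨this ψ (by simp [binOperands]), this χ (by simp [binOperands])⟩

theorem mem_of_un_mem {o : UnOp} {ψ : LTL α} (h : un o ψ ∈ φ.subF) : ψ ∈ φ.subF :=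
  operand_mem_subF h

theorem segment_subset {Ut : Set UnOp} {Bt : Set BinTempOp} {Bl : Set BinLogOp}
    {S : Finset (LTL α)} {ψ : LTL α} (h : ψ.UsesOnly Ut Bt Bl) : ∀ o ∈ ψ.segment S, o ∈ Ut := by
  induction ψ with
  | un o ψ ih =>
    intro o' ho'
    simp only [segment, List.mem_cons] at ho'
    rcases ho' with rfl | ho'
    · exact h.1
    · split_ifs at ho'
      · simp at ho'
      · exact ih h.2 o' ho'
  | _ => simp [segment]

end LTL

/-! ### Comparing the instances of the shape of a formula with the formula. -/

namespace Shape

open LTL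

variable {N : ℕ} {α : Type} [DecidableEq α] {φ : LTL α} (e : LTL α → Fin N) (b : Bool)

theorem shortChain_spec (c : List UnOp) : (shortChain c).length ≤ 10 ∧
    (shortChain c).length + c.count .X ≤ c.length ∧ shortChain c ⊆ c ∧
    ∀ {α : Type} (w : ℕ → Set α) (φ : LTL α),
      Sat w (chain c φ) ↔ Sat w (chain (List.replicate (c.count .X) .X ++ shortChain c) φ) :=
  (exists_short_chain c).choose_spec

/-- Each special formula on a branch contributes at most 12 levels: 11 for the wrapped chain and 1
for the leaf or the binary operator. The induction counts the special sub-formulas still below. -/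
theorem height_ofFormula_le {Ut : Set UnOp} {Bl : Set BinLogOp} (hφ : φ.UsesOnly Ut ∅ Bl) :
    (ofFormula φ.special e b φ).height ≤ 12 * φ.special.card := by
  set S := φ.special with hS
  have hwrap : ∀ ψ : LTL α, ψ ∈ S →
      (base S e b ψ).height ≤ 12 * ((S ∩ ψ.subF).erase ψ).card + 1 →
      (wrap b (e ψ) (ψ.segment S) (base S e b ψ)).height ≤ 12 * (S ∩ ψ.subF).card := by
    intro ψ hψ h
    have h1 := height_wrap_le b (e ψ) (ψ.segment S) (base S e b ψ)
    have h2 : ψ ∈ S ∩ ψ.subF := Finset.mem_inter.2 ⟨hψ, ψ.self_mem_subF⟩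
    have h3 := Finset.card_erase_add_one h2
    omega
  have hcard : ∀ ψ χ : LTL α, χ.subF ⊆ ψ.subF → sizeOf χ < sizeOf ψ →
      (S ∩ χ.subF).card ≤ ((S ∩ ψ.subF).erase ψ).card := by
    intro ψ χ h h'
    refine Finset.card_le_card fun ξ hξ => ?_
    rw [Finset.mem_inter] at hξ
    refine Finset.mem_erase.2 ⟨?_, Finset.mem_inter.2 ⟨hξ.1, h hξ.2⟩⟩
    rintro rfl
    have := sizeOf_le_of_mem_subF hξ.2
    omega
  have hbase : ∀ ψ ∈ φ.subF, (base S e b ψ).height ≤ 12 * ((S ∩ ψ.subF).erase ψ).card + 1 := by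
    intro ψ hψ
    induction ψ with
    | atom p => simp [base, height]
    | un o ψ ih =>
      have h1 := hcard (.un o ψ) ψ (Finset.subset_insert _ _) (by simp)
      have h2 := ih (mem_of_un_mem hψ)
      simp only [base]
      split_ifs with h
      · have := hwrap ψ h h2
        omega
      · have := Finset.card_erase_le (s := S ∩ ψ.subF) (a := ψ)
        omega
    | binTemp o ψ χ => exact absurd (hφ.of_mem_subF hψ).1 (by simp)
    | binLog o ψ χ ih₁ ih₂ =>
      have hs : ψ.subF ⊆ (LTL.binLog o ψ χ).subF :=
        Finset.subset_union_left.trans (Finset.subset_insert _ _)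
      have hs' : χ.subF ⊆ (LTL.binLog o ψ χ).subF :=
        Finset.subset_union_right.trans (Finset.subset_insert _ _)
      have h1 := hcard (.binLog o ψ χ) ψ hs (by simp only [binLog.sizeOf_spec]; omega)
      have h2 := hcard (.binLog o ψ χ) χ hs' (by simp only [binLog.sizeOf_spec]; omega)
      obtain ⟨h3, h4⟩ := operands_mem_special hψ
      have h5 := hwrap ψ h3 (ih₁ (subF_subset hψ (hs ψ.self_mem_subF)))
      have h6 := hwrap χ h4 (ih₂ (subF_subset hψ (hs' χ.self_mem_subF)))
      simp only [base, height]
      omega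
  refine (hwrap φ self_mem_special (hbase φ φ.self_mem_subF)).trans ?_
  exact Nat.mul_le_mul_left _ (Finset.card_le_card Finset.inter_subset_left)

/-- By induction, the segment of `ψ` on top of the instance of its base is equivalent to `ψ`.
Replacing the segment by its short form is harmless if the exponent is the number of its `X`; if `X`
is not available, that number is zero and no power is needed. -/
theorem sat_inst_ofFormula {Ut : Set UnOp} {Bl : Set BinLogOp} (hφ : φ.UsesOnly Ut ∅ Bl)
    (hb : b = false → UnOp.X ∉ Ut) {θ : Fin N → α} {κ : Fin N → ℕ}
    (hθ : ∀ p, atom p ∈ φ.special → θ (e (atom p)) = p)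
    (hκ : ∀ ψ ∈ φ.special, ψ.isUn = true → b = true →
      κ (e ψ) = (ψ.segment φ.special).count .X) (w : ℕ → Set α) :
    Sat w ((ofFormula φ.special e b φ).inst θ κ) ↔ Sat w φ := by
  set S := φ.special with hS
  have hwrap : ∀ ψ ∈ S,
      (∀ w, Sat w (chain (ψ.segment S) ((base S e b ψ).inst θ κ)) ↔ Sat w ψ) →
      ∀ w, Sat w ((wrap b (e ψ) (ψ.segment S) (base S e b ψ)).inst θ κ) ↔ Sat w ψ := by
    intro ψ hψ h w
    rw [← h w, inst_wrap]
    unfold ops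
    split_ifs with h1 h2
    · rw [h1]
    · have hu : ψ.isUn = true := by
        rw [segment_eq_nil] at h1; simpa using h1
      rw [hκ ψ hψ hu h2, ← (shortChain_spec _).2.2.2]
    · have h0 : (ψ.segment S).count .X = 0 := by
        rw [List.count_eq_zero]
        intro hX
        exact hb (by simpa using h2)
          (segment_subset (hφ.of_mem_subF (special_subset φ hψ)) _ hX)
      rw [(shortChain_spec (ψ.segment S)).2.2.2, h0]
      rfl
  have hbase : ∀ ψ ∈ φ.subF, ∀ w,
      Sat w (chain (ψ.segment S) ((base S e b ψ).inst θ κ)) ↔ Sat w ψ := by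
    intro ψ hψ
    induction ψ with
    | atom p =>
      intro w
      simp only [LTL.segment, base, inst, chain, List.foldr_nil]
      rw [hθ p (mem_special_of_isUn hψ rfl)]
    | un o ψ ih =>
      have h := ih (mem_of_un_mem hψ)
      simp only [LTL.segment, base]
      split_ifs with h'
      · exact fun w => sat_un_congr (hwrap ψ h' h) o w
      · exact fun w => sat_un_congr h o w
    | binTemp o ψ χ => exact absurd (hφ.of_mem_subF hψ).1 (by simp)
    | binLog o ψ χ ih₁ ih₂ =>
      obtain ⟨h3, h4⟩ := operands_mem_special hψ
      intro w
      simp only [LTL.segment, base, inst, chain, List.foldr_nil, Sat]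
      rw [hwrap ψ h3 (ih₁ (special_subset _ h3)) w, hwrap χ h4 (ih₂ (special_subset _ h4)) w]
  exact hwrap φ self_mem_special (hbase φ φ.self_mem_subF) w

theorem usesOnly_inst_ofFormula {Ut : Set UnOp} {Bl : Set BinLogOp} (hφ : φ.UsesOnly Ut ∅ Bl)
    (hb : b = true → UnOp.X ∈ Ut) {β : Type} (θ : Fin N → β) (κ : Fin N → ℕ) :
    ((ofFormula φ.special e b φ).inst θ κ).UsesOnly Ut ∅ Bl := by
  set S := φ.special with hS
  have hwrap : ∀ ψ ∈ φ.subF, ((base S e b ψ).inst θ κ).UsesOnly Ut ∅ Bl →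
      ((wrap b (e ψ) (ψ.segment S) (base S e b ψ)).inst θ κ).UsesOnly Ut ∅ Bl := by
    intro ψ hψ h
    rw [inst_wrap, usesOnly_chain]
    refine ⟨fun o ho => ?_, h⟩
    have hseg := segment_subset (S := S) (hφ.of_mem_subF hψ)
    unfold ops at ho
    split_ifs at ho with h1 h2
    · simp at ho
    · rcases List.mem_append.1 ho with ho | ho
      · rw [List.eq_of_mem_replicate ho]; exact hb h2
      · exact hseg o ((shortChain_spec _).2.2.1 ho)
    · exact hseg o ((shortChain_spec _).2.2.1 (by simpa using ho))
  have hbase : ∀ ψ ∈ φ.subF, ((base S e b ψ).inst θ κ).UsesOnly Ut ∅ Bl := by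
    intro ψ hψ
    induction ψ with
    | atom p => trivial
    | un o ψ ih =>
      have h := ih (mem_of_un_mem hψ)
      simp only [base]
      split_ifs
      · exact hwrap ψ (mem_of_un_mem hψ) h
      · exact h
    | binTemp o ψ χ => exact absurd (hφ.of_mem_subF hψ).1 (by simp)
    | binLog o ψ χ ih₁ ih₂ =>
      obtain ⟨h3, h4⟩ := operands_mem_special hψ
      have h3 := special_subset _ h3
      have h4 := special_subset _ h4
      exact ⟨(hφ.of_mem_subF hψ).1, hwrap ψ h3 (ih₁ h3), hwrap χ h4 (ih₂ h4)⟩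
  exact hwrap φ φ.self_mem_subF (hbase φ φ.self_mem_subF)

/-- The sub-formulas of an instance that stem from the special sub-formula `ψ`. -/
noncomputable def piece {β : Type} [DecidableEq β] (θ : Fin N → β) (κ : Fin N → ℕ)
    (S : Finset (LTL α)) (ψ : LTL α) : Finset (LTL β) :=
  chainSet ((base S e b ψ).inst θ κ) (ops b (κ (e ψ)) (ψ.segment S)) ∪
    if ψ.isUn then ∅ else {(base S e b ψ).inst θ κ}

/-- Each special formula accounts for the operators of its own chain and, if it is not unary, for
its base. Below the chain of a unary formula comes what belongs to the next special formula, so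
counting that base again would spoil the size bound. -/
theorem subF_inst_ofFormula_subset {Ut : Set UnOp} {Bl : Set BinLogOp}
    (hφ : φ.UsesOnly Ut ∅ Bl) {β : Type} [DecidableEq β] (θ : Fin N → β) (κ : Fin N → ℕ) :
    ((ofFormula φ.special e b φ).inst θ κ).subF ⊆
      φ.special.biUnion (piece e b θ κ φ.special) := by
  set S := φ.special with hS
  have hwrap : ∀ ψ ∈ S,
      ((base S e b ψ).inst θ κ).subF ⊆ S.biUnion (piece e b θ κ S) →
      ((wrap b (e ψ) (ψ.segment S) (base S e b ψ)).inst θ κ).subF ⊆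
        S.biUnion (piece e b θ κ S) := by
    intro ψ hψ h
    rw [inst_wrap, subF_chain]
    refine Finset.union_subset (fun ξ hξ => ?_) h
    exact Finset.mem_biUnion.2 ⟨ψ, hψ, Finset.mem_union_left _ hξ⟩
  have hbase : ∀ ψ ∈ φ.subF,
      ((base S e b ψ).inst θ κ).subF ⊆ S.biUnion (piece e b θ κ S) := by
    intro ψ hψ
    induction ψ with
    | atom p =>
      have hp : atom p ∈ S := mem_special_of_isUn hψ rfl
      intro ξ hξ
      refine Finset.mem_biUnion.2 ⟨atom p, hp, Finset.mem_union_right _ ?_⟩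
      simpa [isUn, base, inst, subF] using hξ
    | un o ψ ih =>
      have h := ih (mem_of_un_mem hψ)
      simp only [base]
      split_ifs with h'
      · exact hwrap ψ h' h
      · exact h
    | binTemp o ψ χ => exact absurd (hφ.of_mem_subF hψ).1 (by simp)
    | binLog o ψ χ ih₁ ih₂ =>
      obtain ⟨h3, h4⟩ := operands_mem_special hψ
      have hp : LTL.binLog o ψ χ ∈ S := mem_special_of_isUn hψ rfl
      refine Finset.insert_subset ?_ (Finset.union_subset
        (hwrap ψ h3 (ih₁ (special_subset _ h3))) (hwrap χ h4 (ih₂ (special_subset _ h4))))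
      exact Finset.mem_biUnion.2 ⟨_, hp, Finset.mem_union_right _ (by simp [isUn, base, inst])⟩
  exact hwrap φ self_mem_special (hbase φ φ.self_mem_subF)

/-- Chains contain no binary formula, so the binary sub-formulas of an instance are images of those
of `φ`; an instance may identify some of them. -/
theorem numBin_inst_ofFormula_le {Ut : Set UnOp} {Bl : Set BinLogOp}
    (hφ : φ.UsesOnly Ut ∅ Bl) {β : Type} [DecidableEq β] (θ : Fin N → β) (κ : Fin N → ℕ) :
    ((ofFormula φ.special e b φ).inst θ κ).numBin ≤ φ.numBin := by
  refine (Finset.card_le_card (t := (φ.subF.filter fun ψ => ψ.isBin = true).image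
    fun ψ => (base φ.special e b ψ).inst θ κ) ?_).trans Finset.card_image_le
  intro ξ hξ
  obtain ⟨h1, h2⟩ := Finset.mem_filter.1 hξ
  obtain ⟨ψ, hψ, h⟩ := Finset.mem_biUnion.1 (subF_inst_ofFormula_subset e b hφ θ κ h1)
  rcases Finset.mem_union.1 h with h | h
  · rw [isBin_of_mem_chainSet h] at h2; simp at h2
  · have hψ' := special_subset _ hψ
    cases ψ with
    | atom p =>
      simp only [isUn, base, inst, Bool.false_eq_true, if_false, Finset.mem_singleton] at h
      rw [h] at h2; simp [isBin] at h2
    | un o ψ => simp [isUn] at h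
    | binTemp o ψ χ => exact absurd (hφ.of_mem_subF hψ').1 (by simp)
    | binLog o ψ χ =>
      simp only [isUn, Bool.false_eq_true, if_false, Finset.mem_singleton] at h
      exact Finset.mem_image.2 ⟨_, Finset.mem_filter.2 ⟨hψ', rfl⟩, h.symm⟩

/-- The part of the size of an instance that does not depend on the parameters. -/
noncomputable def fixedCost (S : Finset (LTL α)) : ℕ :=
  ∑ ψ ∈ S, if ψ.isUn then (shortChain (ψ.segment S)).length else 1

/-- The parameters that count for the size of an instance. -/
def costIndices (S : Finset (LTL α)) : Finset (Fin N) :=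
  if b then (S.filter fun ψ => ψ.isUn = true).image e else ∅

theorem cost_eq {S : Finset (LTL α)} (he : Set.InjOn e S) (κ : Fin N → ℕ) :
    fixedCost S + ∑ i ∈ costIndices e b S, κ i = ∑ ψ ∈ S, if ψ.isUn then
      (shortChain (ψ.segment S)).length + (if b then κ (e ψ) else 0) else 1 := by
  have h : ∑ i ∈ costIndices e b S, κ i =
      ∑ ψ ∈ S, if ψ.isUn then (if b then κ (e ψ) else 0) else 0 := by
    unfold costIndices
    cases b
    · simp
    · simp only [if_true]
      rw [Finset.sum_image (he.mono fun _ h => (Finset.mem_filter.1 h).1), Finset.sum_filter]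
  rw [h, fixedCost, ← Finset.sum_add_distrib]
  refine Finset.sum_congr rfl fun ψ _ => ?_
  split_ifs <;> rfl

/-- Soundness of the cost: valid for all parameters, so comparing the cost with the size bound is a
safe test. -/
theorem size_inst_ofFormula_le {Ut : Set UnOp} {Bl : Set BinLogOp}
    (hφ : φ.UsesOnly Ut ∅ Bl) (he : Set.InjOn e φ.special) {β : Type} [DecidableEq β]
    (θ : Fin N → β) (κ : Fin N → ℕ) : ((ofFormula φ.special e b φ).inst θ κ).size ≤
      fixedCost φ.special + ∑ i ∈ costIndices e b φ.special, κ i := by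
  rw [cost_eq e b he]
  refine (Finset.card_le_card (subF_inst_ofFormula_subset e b hφ θ κ)).trans
    (Finset.card_biUnion_le.trans (Finset.sum_le_sum fun ψ _ => ?_))
  refine (Finset.card_union_le _ _).trans ?_
  have h := card_chainSet_le (ops b (κ (e ψ)) (ψ.segment φ.special))
    ((base φ.special e b ψ).inst θ κ)
  by_cases hu : ψ.isUn = true
  · simp only [hu, if_true, Finset.card_empty, Nat.add_zero]
    refine h.trans ?_
    unfold ops
    split_ifs <;> simp [Nat.add_comm]
  · have hs : ψ.segment φ.special = [] := segment_eq_nil.2 (by simpa using hu)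
    simp [hu, hs, ops, chainSet]

/-- Completeness of the cost: a short chain together with its `X` is no longer than the segment it
replaces, and the segments fit into the size of `φ`. -/
theorem cost_le_size (he : Set.InjOn e φ.special) {κ : Fin N → ℕ}
    (hκ : ∀ ψ ∈ φ.special, ψ.isUn = true → b = true →
      κ (e ψ) = (ψ.segment φ.special).count .X) :
    fixedCost φ.special + ∑ i ∈ costIndices e b φ.special, κ i ≤ φ.size := by
  rw [cost_eq e b he]
  refine (Finset.sum_le_sum fun ψ hψ => ?_).trans (sum_segment_le φ)
  have := (shortChain_spec (ψ.segment φ.special)).2.1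
  split_ifs with h1 h2
  · rw [hκ ψ hψ h1 h2]; omega
  · omega
  · omega

theorem fixedCost_le (S : Finset (LTL α)) : fixedCost S ≤ S.card * 10 := by
  refine Finset.sum_le_card_nsmul _ _ _ fun ψ _ => ?_
  have := (shortChain_spec (ψ.segment S)).1
  split_ifs <;> omega

end Shape

/-- Every formula with few binary operators is equivalent to an instance, of no larger size, of
one of finitely many shapes. -/
theorem exists_finite_shapes (Ut : Set UnOp) (Bl : Set BinLogOp) (n : ℕ) :
    ∃ (N : ℕ) (S : Set (Shape N × ℕ × Finset (Fin N))), S.Finite ∧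
      (∀ s ∈ S, ∀ (m : ℕ) (θ : Fin N → Fin m) (κ : Fin N → ℕ),
        (s.1.inst θ κ).UsesOnly Ut ∅ Bl ∧ (s.1.inst θ κ).numBin ≤ n ∧
        (s.1.inst θ κ).size ≤ s.2.1 + ∑ i ∈ s.2.2, κ i) ∧
      ∀ (m : ℕ) (φ : LTL (Fin m)), φ.UsesOnly Ut ∅ Bl → φ.numBin ≤ n →
        ∃ s ∈ S, ∃ (θ : Fin N → Fin m) (κ : Fin N → ℕ), s.2.1 + ∑ i ∈ s.2.2, κ i ≤ φ.size ∧
          (∀ i, κ i ≤ φ.size) ∧ ∀ w, LTL.Sat w (s.1.inst θ κ) ↔ LTL.Sat w φ := by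
  classical
  set N := 2 * (2 * n + 1) with hN
  -- Soundness for all parameters is built into the set; the bounds on height and fixed cost make it
  -- finite.
  refine ⟨N, {s | s.1.height ≤ 12 * N ∧ s.2.1 ≤ N * 10 ∧
    ∀ (m : ℕ) (θ : Fin N → Fin m) (κ : Fin N → ℕ),
        (s.1.inst θ κ).UsesOnly Ut ∅ Bl ∧ (s.1.inst θ κ).numBin ≤ n ∧
        (s.1.inst θ κ).size ≤ s.2.1 + ∑ i ∈ s.2.2, κ i}, ?_, fun s hs => hs.2.2, ?_⟩
  · refine Set.Finite.subset ((Shape.finite_height_le (12 * N)).prod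
      ((Set.finite_Iic (N * 10)).prod (Set.finite_univ (α := Finset (Fin N))))) ?_
    rintro ⟨s, C, J⟩ ⟨h1, h2, -⟩
    exact ⟨h1, h2, trivial⟩
  · intro m φ hφ hn
    have hcard : φ.special.card ≤ N := (LTL.card_special_le φ).trans (by omega)
    have hN0 : 0 < N := by omega
    -- Every formula contains a proposition, which provides a default value for unused entries of
    -- `θ`.
    have hm : 0 < m := by
      clear hcard hn hφ
      induction φ with
      | atom p => exact p.pos
      | un o φ ih => exact ih
      | binTemp o φ ψ ih => exact ih
      | binLog o φ ψ ih => exact ih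
    obtain ⟨e, he⟩ : ∃ e : LTL (Fin m) → Fin N, Set.InjOn e φ.special := by
      obtain ⟨f⟩ := Function.Embedding.nonempty_of_card_le
        (α := φ.special) (β := Fin N) (by simpa using hcard)
      refine ⟨fun ψ => if h : ψ ∈ φ.special then f ⟨ψ, h⟩ else ⟨0, hN0⟩, fun a ha c hc h => ?_⟩
      simp only [Finset.mem_coe] at ha hc
      simpa [ha, hc] using h
    set b : Bool := decide (UnOp.X ∈ Ut) with hb
    set S := φ.special with hS
    set g : Fin N → LTL (Fin m) := fun i =>
      if h : ∃ ψ ∈ S, e ψ = i then h.choose else φ with hg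
    have hge : ∀ ψ ∈ S, g (e ψ) = ψ := by
      intro ψ hψ
      have h : ∃ χ ∈ S, e χ = e ψ := ⟨ψ, hψ, rfl⟩
      simp only [hg, dif_pos h]
      exact he h.choose_spec.1 hψ h.choose_spec.2
    set θ : Fin N → Fin m := fun i => match g i with
      | .atom p => p
      | _ => ⟨0, hm⟩ with hθdef
    set J := Shape.costIndices e b S with hJ
    -- Exponents that do not enter the cost are set to zero, so that all of them are at most the
    -- size of `φ`.
    set κ : Fin N → ℕ := fun i => if i ∈ J then ((g i).segment S).count .X else 0 with hκdef
    have hκ : ∀ ψ ∈ φ.special, ψ.isUn = true → b = true →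
        κ (e ψ) = (ψ.segment φ.special).count .X := by
      intro ψ hψ hu hb'
      have : e ψ ∈ J := by
        rw [hJ, Shape.costIndices, if_pos hb']
        exact Finset.mem_image_of_mem _ (Finset.mem_filter.2 ⟨hψ, hu⟩)
      simp only [hκdef, if_pos this, hge ψ hψ, hS]
    have hcost := Shape.cost_le_size e b he hκ
    refine ⟨(Shape.ofFormula S e b φ, Shape.fixedCost S, J), ⟨?_, ?_, ?_⟩, θ, κ, hcost, ?_, ?_⟩
    · exact (Shape.height_ofFormula_le e b hφ).trans (Nat.mul_le_mul_left _ hcard)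
    · exact (Shape.fixedCost_le S).trans (Nat.mul_le_mul_right _ hcard)
    · intro m θ κ
      exact ⟨Shape.usesOnly_inst_ofFormula e b hφ (by simp [hb]) θ κ,
        (Shape.numBin_inst_ofFormula_le e b hφ θ κ).trans hn,
        Shape.size_inst_ofFormula_le e b hφ he θ κ⟩
    · intro i
      by_cases hi : i ∈ J
      · exact ((Finset.single_le_sum (fun _ _ => Nat.zero_le _) hi).trans
          (Nat.le_add_left _ _)).trans hcost
      · simp [hκdef, hi]
    · refine Shape.sat_inst_ofFormula e b hφ (by simp [hb]) ?_ hκ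
      intro p hp
      simp only [hθdef, hge _ hp]

/-! ### Reading the encoding -/

/-- A letter over `m` propositions is written at position `i`. -/
def LetterAt (x : List LearnSym) (m i : ℕ) : Prop :=
  x[i]? = some .letter ∧ ∀ t < m, x[i + 1 + t]? = some .zero ∨ x[i + 1 + t]? = some .one

/-- A mark or the end of the input is at position `e`. -/
def EndAt (x : List LearnSym) (e : ℕ) : Prop :=
  e = x.length ∨ x[e]? = some .pos ∨ x[e]? = some .neg

/-- After the mark at position `i`, a word with a prefix of length `a` and a period of length `b`
is written. -/
def WordAt (x : List LearnSym) (m i a b : ℕ) : Prop :=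
  (∀ t < a, LetterAt x m (i + 1 + t * (m + 1))) ∧
  x[i + 1 + a * (m + 1)]? = some .loop ∧ 0 < b ∧
  (∀ t < b, LetterAt x m (i + 1 + a * (m + 1) + 1 + t * (m + 1))) ∧
  EndAt x (i + 1 + a * (m + 1) + 1 + b * (m + 1))

/-- Whether proposition `p` holds at time `j` in the word written after the mark at `i`. -/
def BitAt (x : List LearnSym) (m i a b j p : ℕ) : Prop :=
  (j < a ∧ x[i + 1 + j * (m + 1) + 1 + p]? = some .one) ∨
  ∃ q < j + 1, ∃ r < b, j = a + q * b + r ∧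
    x[i + 1 + a * (m + 1) + 1 + r * (m + 1) + 1 + p]? = some .one

/-- The letter written at position `i`. -/
def letterAt (x : List LearnSym) (m i : ℕ) : Finset (Fin m) :=
  Finset.univ.filter fun p => x[i + 1 + p]? = some .one

/-- The letters of `w` are the ones written after the mark at `i`. -/
def Spells {m : ℕ} (x : List LearnSym) (i : ℕ) (w : UPWord (Fin m)) : Prop :=
  (∀ t (h : t < w.pre.length), w.pre[t] = letterAt x m (i + 1 + t * (m + 1))) ∧
  ∀ t (h : t < w.per.length),
    w.per[t] = letterAt x m (i + 1 + w.pre.length * (m + 1) + 1 + t * (m + 1))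

/-- `BitAt` expresses the remainder modulo the period by bounded quantifiers over quotient and
remainder; the quotient is at most `j`. -/
theorem Spells.mem_toWord {m i : ℕ} {x : List LearnSym} {w : UPWord (Fin m)} (h : Spells x i w)
    (j : ℕ) (p : Fin m) : p ∈ w.toWord j ↔ BitAt x m i w.pre.length w.per.length j p := by
  have hpos : 0 < w.per.length := List.length_pos_of_ne_nil w.per_ne
  unfold UPWord.toWord BitAt
  split_ifs with hj
  · rw [h.1 j hj]
    simp only [letterAt, Finset.coe_filter, Finset.mem_univ, true_and, Set.mem_ofPred_eq, hj]
    constructor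
    · exact Or.inl
    · rintro (h' | ⟨q, -, r, -, h', -⟩)
      · exact h'
      · rw [Nat.add_assoc] at h'; omega
  · rw [h.2 _ (Nat.mod_lt _ hpos)]
    simp only [letterAt, Finset.coe_filter, Finset.mem_univ, true_and, Set.mem_ofPred_eq, hj,
      false_and, false_or]
    constructor
    · intro h'
      refine ⟨(j - w.pre.length) / w.per.length, ?_, _, Nat.mod_lt _ hpos, ?_, h'⟩
      · have := Nat.div_le_self (j - w.pre.length) w.per.length; omega
      · have := Nat.div_add_mod' (j - w.pre.length) w.per.length; omega
    · rintro ⟨q, -, r, hr, h', h''⟩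
      have : (j - w.pre.length) % w.per.length = r := by
        rw [h', Nat.add_assoc, Nat.add_sub_cancel_left, Nat.mul_comm, Nat.mul_add_mod,
          Nat.mod_eq_of_lt hr]
      rwa [this]

/-! ### Recovering letters, words and inputs from the symbols. -/

section

variable {x : List LearnSym} {m : ℕ}

theorem length_encodeLetter (A : Finset (Fin m)) : (encodeLetter A).length = m + 1 := by
  simp [encodeLetter]

theorem getElem?_of_drop {i j : ℕ} {y : List LearnSym} (h : x.drop i = y) : x[i + j]? = y[j]? := by
  rw [← h, List.getElem?_drop]

theorem LetterAt.drop_eq {i : ℕ} (h : LetterAt x m i) :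
    x.drop i = encodeLetter (letterAt x m i) ++ x.drop (i + (m + 1)) := by
  apply List.ext_getElem?
  intro j
  rw [List.getElem?_drop]
  rcases j with _ | t
  · simpa [encodeLetter] using h.1
  · by_cases ht : t < m
    · rw [List.getElem?_append_left (by rw [length_encodeLetter]; omega)]
      simp only [encodeLetter, List.getElem?_cons_succ, List.getElem?_ofFn, ht, dif_pos,
        letterAt, Finset.mem_filter, Finset.mem_univ, true_and]
      rw [show i + (t + 1) = i + 1 + t by omega]
      rcases h.2 t ht with h' | h' <;> simp [h']
    · rw [List.getElem?_append_right (by rw [length_encodeLetter]; omega), length_encodeLetter,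
        List.getElem?_drop]
      congr 1; omega

theorem drop_eq_of_letters {s a : ℕ} (h : ∀ t < a, LetterAt x m (s + t * (m + 1))) :
    x.drop s = ((List.range a).map fun t => letterAt x m (s + t * (m + 1))).flatMap encodeLetter ++
      x.drop (s + a * (m + 1)) := by
  induction a with
  | zero => simp
  | succ a ih =>
    rw [ih fun t ht => h t (by omega), (h a (by omega)).drop_eq, List.range_succ]
    simp [Nat.add_mul, Nat.add_assoc]

theorem letterAt_of_drop {i : ℕ} {A : Finset (Fin m)} {y : List LearnSym}
    (h : x.drop i = encodeLetter A ++ y) :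
    LetterAt x m i ∧ letterAt x m i = A ∧ x.drop (i + (m + 1)) = y := by
  have hbit : ∀ t (ht : t < m), x[i + 1 + t]? = some (if ⟨t, ht⟩ ∈ A then .one else .zero) := by
    intro t ht
    rw [Nat.add_assoc, getElem?_of_drop h,
      List.getElem?_append_left (by rw [length_encodeLetter]; omega), Nat.add_comm 1 t]
    simp [encodeLetter, ht]
  refine ⟨⟨?_, fun t ht => ?_⟩, ?_, ?_⟩
  · rw [← Nat.add_zero i, getElem?_of_drop h]; simp [encodeLetter]
  · rw [hbit t ht]; split_ifs <;> simp
  · ext p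
    simp only [letterAt, Finset.mem_filter, Finset.mem_univ, true_and, hbit p p.2]
    split_ifs with hp <;> simpa using hp
  · rw [← List.drop_drop, h, ← length_encodeLetter A, List.drop_left]

theorem letters_of_drop {l : List (Finset (Fin m))} {s : ℕ} {y : List LearnSym}
    (h : x.drop s = l.flatMap encodeLetter ++ y) :
    (∀ t (ht : t < l.length), LetterAt x m (s + t * (m + 1)) ∧
      l[t] = letterAt x m (s + t * (m + 1))) ∧ x.drop (s + l.length * (m + 1)) = y := by
  induction l generalizing s with
  | nil => simpa using h
  | cons A l ih =>
    simp only [List.flatMap_cons, List.append_assoc] at h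
    obtain ⟨h1, h2, h3⟩ := letterAt_of_drop h
    obtain ⟨h4, h5⟩ := ih h3
    constructor
    · rintro (_ | t) ht
      · simpa using ⟨h1, h2.symm⟩
      · have := h4 t (by simpa using ht)
        rw [show s + (t + 1) * (m + 1) = s + (m + 1) + t * (m + 1) by ring]
        simpa using this
    · rw [← h5]; congr 1; simp only [List.length_cons]; ring

theorem WordAt.exists_word {i a b : ℕ} {k : LearnSym} (h : WordAt x m i a b)
    (hk : x[i]? = some k) : ∃ w : UPWord (Fin m), w.pre.length = a ∧ w.per.length = b ∧
      Spells x i w ∧ x.drop i = encodeWord k w ++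
        x.drop (i + 1 + a * (m + 1) + 1 + b * (m + 1)) := by
  obtain ⟨h1, h2, h3, h4, -⟩ := h
  refine ⟨⟨(List.range a).map fun t => letterAt x m (i + 1 + t * (m + 1)),
    (List.range b).map fun t => letterAt x m (i + 1 + a * (m + 1) + 1 + t * (m + 1)), ?_⟩,
    by simp, by simp, ⟨by simp, by simp⟩, ?_⟩
  · simp; omega
  · have hi : x.drop i = k :: x.drop (i + 1) := by
      obtain ⟨hlt, h⟩ := List.getElem?_eq_some_iff.1 hk
      rw [List.drop_eq_getElem_cons hlt, h]
    have hl : x.drop (i + 1 + a * (m + 1)) = .loop :: x.drop (i + 1 + a * (m + 1) + 1) := by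
      obtain ⟨hlt, h⟩ := List.getElem?_eq_some_iff.1 h2
      rw [List.drop_eq_getElem_cons hlt, h]
    rw [hi, drop_eq_of_letters h1, hl, drop_eq_of_letters h4]
    simp [encodeWord]

/-- The hypothesis on the remainder `y` is what yields the end condition `EndAt` behind the word. -/
theorem wordAt_of_drop {i : ℕ} {k : LearnSym} {w : UPWord (Fin m)} {y : List LearnSym}
    (h : x.drop i = encodeWord k w ++ y)
    (hy : y = [] ∨ y[0]? = some .pos ∨ y[0]? = some .neg) :
    WordAt x m i w.pre.length w.per.length ∧ Spells x i w := by
  have hi : x.drop (i + 1) = w.pre.flatMap encodeLetter ++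
      (LearnSym.loop :: (w.per.flatMap encodeLetter ++ y)) := by
    rw [← List.drop_drop, h]; simp [encodeWord]
  have hlen : i < x.length := by
    by_contra hcon
    rw [List.drop_eq_nil_of_le (by omega)] at h
    simp [encodeWord] at h
  obtain ⟨h1, h2⟩ := letters_of_drop hi
  have h3 : x.drop (i + 1 + w.pre.length * (m + 1) + 1) = w.per.flatMap encodeLetter ++ y := by
    rw [← List.drop_drop, h2]; simp
  obtain ⟨h4, h5⟩ := letters_of_drop h3
  refine ⟨⟨fun t ht => (h1 t ht).1, ?_, List.length_pos_of_ne_nil w.per_ne,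
    fun t ht => (h4 t ht).1, ?_⟩, fun t ht => (h1 t ht).2, fun t ht => (h4 t ht).2⟩
  · rw [← Nat.add_zero (i + 1 + w.pre.length * (m + 1)), getElem?_of_drop h2]; simp
  · set e := i + 1 + w.pre.length * (m + 1) + 1 + w.per.length * (m + 1) with he
    rcases hy with hy | hy
    · left
      have hl1 := congrArg List.length h
      have hl5 := congrArg List.length h3
      have hfl : (w.per.flatMap encodeLetter).length = w.per.length * (m + 1) := by
        simp [List.length_flatMap, length_encodeLetter]
      rw [hy, List.append_nil, List.length_drop, hfl] at hl5
      have hper : 0 < w.per.length * (m + 1) :=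
        Nat.mul_pos (List.length_pos_of_ne_nil w.per_ne) (Nat.succ_pos m)
      omega
    · right
      rw [← Nat.add_zero e, getElem?_of_drop h5]
      exact hy

theorem mem_encodeLetter {A : Finset (Fin m)} {k : LearnSym} (h : k ∈ encodeLetter A) :
    k ≠ .pos ∧ k ≠ .neg := by
  simp only [encodeLetter, List.mem_cons, List.mem_ofFn] at h
  rcases h with rfl | ⟨i, rfl⟩
  · simp
  · split_ifs <;> simp

/-- The body of an encoded word contains no marks. -/
theorem mem_encodeWord_tail {w : UPWord (Fin m)} {k : LearnSym}
    (h : k ∈ w.pre.flatMap encodeLetter ++ LearnSym.loop :: w.per.flatMap encodeLetter) :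
    k ≠ .pos ∧ k ≠ .neg := by
  simp only [List.mem_append, List.mem_flatMap, List.mem_cons] at h
  rcases h with ⟨A, -, h⟩ | rfl | ⟨A, -, h⟩
  · exact mem_encodeLetter h
  · simp
  · exact mem_encodeLetter h

/-- A mark in a list of encoded words is the first symbol of one of the words. -/
theorem exists_word_of_mark {L : List (LearnSym × UPWord (Fin m))} {j : ℕ} {k : LearnSym}
    (hL : ∀ q ∈ L, q.1 = .pos ∨ q.1 = .neg) (hk : k = .pos ∨ k = .neg)
    (h : (L.flatMap fun q => encodeWord q.1 q.2)[j]? = some k) :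
    ∃ w, (k, w) ∈ L ∧ ∃ y, (L.flatMap fun q => encodeWord q.1 q.2).drop j = encodeWord k w ++ y ∧
      (y = [] ∨ y[0]? = some .pos ∨ y[0]? = some .neg) := by
  induction L generalizing j with
  | nil => simp at h
  | cons q L ih =>
    obtain ⟨k', w⟩ := q
    have hhead : (L.flatMap fun q => encodeWord q.1 q.2) = [] ∨
        (L.flatMap fun q => encodeWord q.1 q.2)[0]? = some .pos ∨
        (L.flatMap fun q => encodeWord q.1 q.2)[0]? = some .neg := by
      cases L with
      | nil => simp
      | cons q L =>
        right
        have := hL q (by simp)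
        simpa [encodeWord] using this
    rw [List.flatMap_cons] at h ⊢
    by_cases hj : j < (encodeWord k' w).length
    · rw [List.getElem?_append_left hj] at h
      rcases j with _ | j
      · have : k' = k := by simpa [encodeWord] using h
        subst this
        exact ⟨w, by simp, _, by simp, hhead⟩
      · have hmem : k ∈ w.pre.flatMap encodeLetter ++ LearnSym.loop :: w.per.flatMap encodeLetter :=
          List.mem_of_getElem? (i := j) (by simpa [encodeWord] using h)
        have := mem_encodeWord_tail hmem
        tauto
    · rw [List.getElem?_append_right (not_lt.1 hj)] at h
      obtain ⟨w', h1, y, h2, h3⟩ := ih (fun q hq => hL q (by simp [hq])) h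
      refine ⟨w', by simp [h1], y, ?_, h3⟩
      rw [List.drop_append, List.drop_eq_nil_of_le (not_lt.1 hj), List.nil_append, h2]

/-- The input begins with `m` propositions and `B` ticks, followed by words, the positive ones
first. -/
def Header (x : List LearnSym) (m B : ℕ) : Prop :=
  (∀ t < m, x[t]? = some .prop) ∧ (∀ t < B, x[m + t]? = some .tick) ∧ EndAt x (m + B) ∧
    ∀ i < x.length, ∀ j < i, ¬ (x[j]? = some .neg ∧ x[i]? = some .pos)

/-- Each word ends at a mark or at the end of the input, so the words can be read off one after the
other. The relation `R` carries along what is known about the word behind each mark. -/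
theorem Header.exists_words {B : ℕ} (hx : Header x m B)
    (R : ℕ → UPWord (Fin m) → Prop)
    (h : ∀ i, (x[i]? = some .pos ∨ x[i]? = some .neg) → ∃ a b, WordAt x m i a b ∧
      ∀ w : UPWord (Fin m), w.pre.length = a → w.per.length = b → Spells x i w → R i w) :
    ∃ P Q : List (UPWord (Fin m)), (⟨m, P, Q, B⟩ : LearnInput).encode = x ∧
      (∀ w ∈ P, ∃ i, x[i]? = some .pos ∧ R i w) ∧ ∀ w ∈ Q, ∃ i, x[i]? = some .neg ∧ R i w := by
  have key : ∀ d e, x.length ≤ e + d → EndAt x e → ∃ P Q : List (UPWord (Fin m)),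
      x.drop e = P.flatMap (encodeWord .pos) ++ Q.flatMap (encodeWord .neg) ∧
      (∀ w ∈ P, ∃ i, e ≤ i ∧ x[i]? = some .pos ∧ R i w) ∧
      ∀ w ∈ Q, ∃ i, e ≤ i ∧ x[i]? = some .neg ∧ R i w := by
    intro d
    induction d with
    | zero =>
      intro e he _
      exact ⟨[], [], by simp; omega, by simp, by simp⟩
    | succ d ih =>
      intro e he hend
      rcases hend with hend | hend
      · exact ⟨[], [], by simp [hend], by simp, by simp⟩
      · obtain ⟨a, b, hw, hR⟩ := h e hend
        have hend' := hw.2.2.2.2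
        set e' := e + 1 + a * (m + 1) + 1 + b * (m + 1) with he'
        have hlt : e < e' := by omega
        obtain ⟨P, Q, h1, h2, h3⟩ := ih e' (by omega) hend'
        have h2' : ∀ w ∈ P, ∃ i, e ≤ i ∧ x[i]? = some .pos ∧ R i w := fun w hw => by
          obtain ⟨i, hi, h⟩ := h2 w hw; exact ⟨i, by omega, h⟩
        have h3' : ∀ w ∈ Q, ∃ i, e ≤ i ∧ x[i]? = some .neg ∧ R i w := fun w hw => by
          obtain ⟨i, hi, h⟩ := h3 w hw; exact ⟨i, by omega, h⟩
        rcases hend with hk | hk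
        · obtain ⟨w, hwa, hwb, hsp, hdrop⟩ := hw.exists_word hk
          refine ⟨w :: P, Q, ?_, ?_, h3'⟩
          · rw [hdrop, h1]; simp
          · intro w' hw'
            rcases List.mem_cons.1 hw' with rfl | hw'
            · exact ⟨e, le_rfl, hk, hR w' hwa hwb hsp⟩
            · exact h2' w' hw'
        · obtain ⟨w, hwa, hwb, hsp, hdrop⟩ := hw.exists_word hk
          -- Behind a negative mark the header admits no positive one.
          have hP : P = [] := by
            rw [List.eq_nil_iff_forall_not_mem]
            intro w' hw'
            obtain ⟨i, hi, hpos, -⟩ := h2 w' hw'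
            have hil : i < x.length := (List.getElem?_eq_some_iff.1 hpos).1
            exact hx.2.2.2 i hil e (by omega) ⟨hk, hpos⟩
          subst hP
          refine ⟨[], w :: Q, ?_, by simp, ?_⟩
          · rw [hdrop, h1]; simp
          · intro w' hw'
            rcases List.mem_cons.1 hw' with rfl | hw'
            · exact ⟨e, le_rfl, hk, hR w' hwa hwb hsp⟩
            · exact h3' w' hw'
  obtain ⟨P, Q, h1, h2, h3⟩ := key x.length (m + B) (by omega) hx.2.2.1
  refine ⟨P, Q, ?_, fun w hw => ?_, fun w hw => ?_⟩
  · simp only [LearnInput.encode, List.append_assoc]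
    rw [← h1]
    apply List.ext_getElem?
    intro j
    rcases lt_or_ge j m with hj | hj
    · rw [List.getElem?_append_left (by simpa using hj), hx.1 j hj]
      simp [hj]
    · rw [List.getElem?_append_right (by simpa using hj), List.length_replicate]
      rcases lt_or_ge (j - m) B with hj' | hj'
      · rw [List.getElem?_append_left (by simpa using hj')]
        have := hx.2.1 (j - m) hj'
        rw [show m + (j - m) = j by omega] at this
        rw [this]
        simp [hj']
      · rw [List.getElem?_append_right (by simpa using hj'), List.length_replicate,
          List.getElem?_drop]
        congr 1; omega
  · obtain ⟨i, -, h⟩ := h2 w hw; exact ⟨i, h⟩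
  · obtain ⟨i, -, h⟩ := h3 w hw; exact ⟨i, h⟩

end

namespace LearnInput

variable (I : LearnInput)

/-- The words of an input with their marks. -/
def marked : List (LearnSym × UPWord (Fin I.numProp)) :=
  I.pos.map (Prod.mk .pos) ++ I.neg.map (Prod.mk .neg)

theorem marked_mark : ∀ q ∈ I.marked, q.1 = .pos ∨ q.1 = .neg := by
  intro q hq
  simp only [marked, List.mem_append, List.mem_map] at hq
  rcases hq with ⟨w, -, rfl⟩ | ⟨w, -, rfl⟩ <;> simp

theorem encode_eq : I.encode = List.replicate I.numProp .prop ++ (List.replicate I.bound .tick ++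
    I.marked.flatMap fun q => encodeWord q.1 q.2) := by
  simp only [encode, marked, List.flatMap_append, List.flatMap_map, List.append_assoc]

theorem getElem?_encode (j : ℕ) : I.encode[I.numProp + I.bound + j]? =
    (I.marked.flatMap fun q => encodeWord q.1 q.2)[j]? := by
  rw [encode_eq, List.getElem?_append_right (by simp; omega),
    List.getElem?_append_right (by simp; omega)]
  congr 1; simp; omega

theorem getElem?_encode_lt {j : ℕ} (hj : j < I.numProp + I.bound) :
    I.encode[j]? = some .prop ∨ I.encode[j]? = some .tick := by
  rw [encode_eq]
  rcases lt_or_ge j I.numProp with h | h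
  · left
    rw [List.getElem?_append_left (by simpa using h)]; simp [h]
  · right
    rw [List.getElem?_append_right (by simpa using h),
      List.getElem?_append_left (by simp; omega), List.getElem?_replicate, if_pos]
    simp only [List.length_replicate]; omega

/-- Neither the unary numbers at the beginning nor the bodies of words contain marks, so a mark
found anywhere is the start of a word of the input. -/
theorem exists_word_of_encode {i : ℕ} {k : LearnSym} (hk : k = .pos ∨ k = .neg)
    (h : I.encode[i]? = some k) : ∃ w, (k, w) ∈ I.marked ∧
      WordAt I.encode I.numProp i w.pre.length w.per.length ∧ Spells I.encode i w := by
  have hi : I.numProp + I.bound ≤ i := by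
    by_contra hcon
    have := I.getElem?_encode_lt (not_le.1 hcon)
    rw [h] at this
    rcases hk with rfl | rfl <;> simp at this
  obtain ⟨j, rfl⟩ := Nat.exists_eq_add_of_le hi
  rw [getElem?_encode] at h
  obtain ⟨w, h1, y, h2, h3⟩ := exists_word_of_mark I.marked_mark hk h
  refine ⟨w, h1, wordAt_of_drop (k := k) (y := y) ?_ h3⟩
  rw [← h2]
  apply List.ext_getElem?
  intro l
  rw [List.getElem?_drop, List.getElem?_drop, Nat.add_assoc, getElem?_encode]

theorem header_encode : Header I.encode I.numProp I.bound := by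
  refine ⟨fun t ht => ?_, fun t ht => ?_, ?_, ?_⟩
  · rw [encode_eq, List.getElem?_append_left (by simpa using ht)]; simp [ht]
  · rw [encode_eq, List.getElem?_append_right (by simp), List.getElem?_append_left (by simp; omega),
      List.getElem?_replicate, if_pos]
    simp only [List.length_replicate]; omega
  · rw [EndAt, ← Nat.add_zero (I.numProp + I.bound), getElem?_encode]
    cases hM : I.marked with
    | nil => left; rw [encode_eq, hM]; simp
    | cons q L =>
      right
      have := I.marked_mark q (by simp [hM])
      simpa [encodeWord] using this
  · rintro i hi j hj ⟨hneg, hpos⟩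
    set y := List.replicate I.numProp LearnSym.prop ++ List.replicate I.bound LearnSym.tick ++
      I.pos.flatMap (encodeWord LearnSym.pos) with hy
    have henc : I.encode = y ++ I.neg.flatMap (encodeWord LearnSym.neg) := rfl
    rw [henc] at hneg hpos
    rcases lt_or_ge j y.length with h | h
    · rw [List.getElem?_append_left h] at hneg
      have := List.mem_of_getElem? hneg
      simp only [hy, List.mem_append, List.mem_replicate, List.mem_flatMap, encodeWord,
        List.mem_cons] at this
      rcases this with (⟨-, h⟩ | ⟨-, h⟩) | ⟨w, -, h | h⟩
      · simp at h
      · simp at h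
      · simp at h
      · exact (mem_encodeWord_tail (w := w) (by simpa using h)).2 rfl
    · rw [List.getElem?_append_right (by omega)] at hpos
      have := List.mem_of_getElem? hpos
      simp only [List.mem_flatMap, encodeWord, List.mem_cons] at this
      obtain ⟨w, -, h | h⟩ := this
      · simp at h
      · exact (mem_encodeWord_tail h).1 rfl

end LearnInput

/-! ### Truth of shapes on ultimately periodic words -/

namespace Shape

variable {N : ℕ}

/-- Truth of a shape at a position, with `F` and `G` restricted to the next `D` positions. -/
def Holds (W : ℕ → ℕ → Prop) (D : ℕ) (u v : Fin N → ℕ) : Shape N → ℕ → Prop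
  | leaf i, j => W j (u i)
  | un .not s, j => ¬ s.Holds W D u v j
  | un .X s, j => s.Holds W D u v (j + 1)
  | un .F s, j => ∃ t < D, s.Holds W D u v (j + t)
  | un .G s, j => ∀ t < D, s.Holds W D u v (j + t)
  | pow i s, j => s.Holds W D u v (j + v i)
  | bin o s t, j => o.eval (s.Holds W D u v j) (t.Holds W D u v j)

end Shape

theorem UPWord.suffix_add_period {α : Type} (w : UPWord α) {j : ℕ} (hj : w.pre.length ≤ j) :
    LTL.suffix w.toWord (j + w.per.length) = LTL.suffix w.toWord j := by
  funext l
  simp only [LTL.suffix, UPWord.toWord]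
  rw [dif_neg (by omega), dif_neg (by omega)]
  have : (j + w.per.length + l - w.pre.length) % w.per.length =
      (j + l - w.pre.length) % w.per.length := by
    rw [show j + w.per.length + l - w.pre.length = j + l - w.pre.length + w.per.length by omega,
      Nat.add_mod_right]
  simp only [this]

/-- A witness at distance at least `|pre| + |per|` stays in the periodic part when moved back by one
period, whatever `j` is. -/
theorem UPWord.exists_sat_iff {α : Type} (w : UPWord α) (φ : LTL α) (j : ℕ) :
    (∃ t, LTL.Sat (LTL.suffix w.toWord (j + t)) φ) ↔
      ∃ t < w.pre.length + w.per.length, LTL.Sat (LTL.suffix w.toWord (j + t)) φ := by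
  constructor
  · rintro ⟨t, ht⟩
    induction t using Nat.strong_induction_on with
    | _ t ih =>
      by_cases hlt : t < w.pre.length + w.per.length
      · exact ⟨t, hlt, ht⟩
      · have hpos : 0 < w.per.length := List.length_pos_of_ne_nil w.per_ne
        refine ih (t - w.per.length) (by omega) ?_
        rw [← w.suffix_add_period (by omega)]
        rwa [show j + (t - w.per.length) + w.per.length = j + t by omega]
  · rintro ⟨t, -, ht⟩; exact ⟨t, ht⟩

theorem UPWord.forall_sat_iff {α : Type} (w : UPWord α) (φ : LTL α) (j : ℕ) :
    (∀ t, LTL.Sat (LTL.suffix w.toWord (j + t)) φ) ↔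
      ∀ t < w.pre.length + w.per.length, LTL.Sat (LTL.suffix w.toWord (j + t)) φ := by
  have := w.exists_sat_iff (.un .not φ) j
  simp only [LTL.Sat] at this
  rw [← not_iff_not]
  push Not
  exact this

theorem LTL.sat_chain_replicate_X {α : Type} (w : ℕ → Set α) (φ : LTL α) (k j : ℕ) :
    Sat (suffix w j) (chain (List.replicate k .X) φ) ↔ Sat (suffix w (j + k)) φ := by
  induction k generalizing j with
  | zero => rfl
  | succ k ih =>
    change Sat (suffix w j) (un .X (chain (List.replicate k .X) φ)) ↔ _
    rw [sat_un]
    simp only [UnOp.sem, ih]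
    rw [show j + 1 + k = j + (k + 1) by omega]

theorem Shape.holds_iff {N m : ℕ} {W : ℕ → ℕ → Prop} {w : UPWord (Fin m)} {θ : Fin N → Fin m}
    (hW : ∀ j (p : Fin m), p ∈ w.toWord j ↔ W j p) (κ : Fin N → ℕ) (s : Shape N) (j : ℕ) :
    s.Holds W (w.pre.length + w.per.length) (fun i => θ i) κ j ↔
      LTL.Sat (LTL.suffix w.toWord j) (s.inst θ κ) := by
  induction s generalizing j with
  | leaf i => simp only [Holds, inst, LTL.Sat, LTL.suffix, Nat.add_zero, hW]
  | un o s ih =>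
    rw [inst, LTL.sat_un]
    cases o with
    | not => simp only [Holds, UnOp.sem, ih]
    | X => simp only [Holds, UnOp.sem, ih]
    | F => simp only [Holds, UnOp.sem, ih, w.exists_sat_iff]
    | G => simp only [Holds, UnOp.sem, ih, w.forall_sat_iff]
  | pow i s ih => rw [inst, LTL.sat_chain_replicate_X, Holds, ih]
  | bin o s t ihs iht => simp only [Holds, inst, LTL.Sat, ihs, iht]

/-! ### Definability of the learning problem -/

section

open Ctx

variable {Γ : Type} [Ctx LearnSym Γ] {m i a b j p B e : Γ → ℕ}

theorem defPred_letterAt (hm : DefFun m) (hi : DefFun i) :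
    DefPred fun g => LetterAt (inp g) (m g) (i g) :=
  (DefPred.sym _ hi).and <| DefPred.all hm <|
    (DefPred.sym .zero ((hi.fst.add (.const 1)).add .snd)).or
      (DefPred.sym .one ((hi.fst.add (.const 1)).add .snd))

theorem defPred_endAt (he : DefFun e) : DefPred fun g => EndAt (inp g) (e g) :=
  (DefPred.eq he .length).or ((DefPred.sym _ he).or (DefPred.sym _ he))

theorem defPred_wordAt (hm : DefFun m) (hi : DefFun i) (ha : DefFun a) (hb : DefFun b) :
    DefPred fun g => WordAt (inp g) (m g) (i g) (a g) (b g) := by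
  have hm1 := hm.add (.const 1)
  have hl := (hi.add (.const 1)).add (ha.mul hm1)
  refine DefPred.and ?_ (DefPred.and ?_ (DefPred.and ?_ (DefPred.and ?_ ?_)))
  · exact DefPred.all ha (defPred_letterAt hm.fst
      ((hi.fst.add (.const 1)).add (DefFun.snd.mul hm1.fst)))
  · exact DefPred.sym _ hl
  · exact DefPred.lt (.const 0) hb
  · exact DefPred.all hb (defPred_letterAt hm.fst
      ((hl.fst.add (.const 1)).add (DefFun.snd.mul hm1.fst)))
  · exact defPred_endAt ((hl.add (.const 1)).add (hb.mul hm1))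

theorem defPred_bitAt (hm : DefFun m) (hi : DefFun i) (ha : DefFun a) (hb : DefFun b)
    (hj : DefFun j) (hp : DefFun p) :
    DefPred fun g => BitAt (inp g) (m g) (i g) (a g) (b g) (j g) (p g) := by
  have hm1 := hm.add (.const 1)
  have hl := (hi.add (.const 1)).add (ha.mul hm1)
  refine DefPred.or (DefPred.and (DefPred.lt hj ha) (DefPred.sym _ ?_)) ?_
  · exact (((hi.add (.const 1)).add (hj.mul hm1)).add (.const 1)).add hp
  · refine DefPred.ex (hj.add (.const 1)) (DefPred.ex hb.fst (DefPred.and ?_ (DefPred.sym _ ?_)))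
    · exact DefPred.eq hj.fst.fst ((ha.fst.fst.add (DefFun.snd.fst.mul hb.fst.fst)).add .snd)
    · exact (((hl.fst.fst.add (.const 1)).add (DefFun.snd.mul hm1.fst.fst)).add (.const 1)).add
        hp.fst.fst

theorem defPred_header (hm : DefFun m) (hB : DefFun B) :
    DefPred fun g => Header (inp g) (m g) (B g) := by
  refine DefPred.and ?_ (DefPred.and ?_ (DefPred.and (defPred_endAt (hm.add hB)) ?_))
  · exact DefPred.all hm (DefPred.sym _ .snd)
  · exact DefPred.all hB (DefPred.sym _ (hm.fst.add .snd))
  · exact DefPred.all .length (DefPred.all .snd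
      ((DefPred.sym _ .snd).and (DefPred.sym _ DefFun.snd.fst)).not)

theorem defPred_eval (o : BinLogOp) {P Q : Γ → Prop} (hP : DefPred P) (hQ : DefPred Q) :
    DefPred fun g => o.eval (P g) (Q g) := by
  cases o with
  | or => exact hP.or hQ
  | and => exact hP.and hQ
  | imp => exact hP.imp hQ
  | revImp => exact hQ.imp hP
  | iff => exact hP.iff hQ
  | nor => exact (hP.or hQ).not
  | nand => exact (hP.and hQ).not
  | nimp => exact (hP.imp hQ).not
  | nrevImp => exact (hQ.imp hP).not
  | niff => exact (hP.iff hQ).not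

end

open Ctx in
-- Positions are not reduced modulo the period but stay terms in the parameters and bound variables;
-- the reduction happens in `BitAt`. Each F or G adds a variable, so the induction is over all
-- contexts.
theorem defPred_holds {N : ℕ} (s : Shape N) {Γ : Type} [Ctx LearnSym Γ] {m i a b j : Γ → ℕ}
    {u v : Fin N → Γ → ℕ} (hm : DefFun m) (hi : DefFun i) (ha : DefFun a) (hb : DefFun b)
    (hu : ∀ l, DefFun (u l)) (hv : ∀ l, DefFun (v l)) (hj : DefFun j) :
    DefPred fun g => s.Holds (BitAt (inp g) (m g) (i g) (a g) (b g)) (a g + b g)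
      (fun l => u l g) (fun l => v l g) (j g) := by
  induction s generalizing Γ with
  | leaf l => exact defPred_bitAt hm hi ha hb hj (hu l)
  | un o s ih =>
    cases o with
    | not => exact (ih hm hi ha hb hu hv hj).not
    | X => exact ih hm hi ha hb hu hv (hj.add (.const 1))
    | F =>
      exact DefPred.ex (ha.add hb) (ih hm.fst hi.fst ha.fst hb.fst (fun l => (hu l).fst)
        (fun l => (hv l).fst) (hj.fst.add .snd))
    | G =>
      exact DefPred.all (ha.add hb) (ih hm.fst hi.fst ha.fst hb.fst (fun l => (hu l).fst)
        (fun l => (hv l).fst) (hj.fst.add .snd))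
  | pow l s ih => exact ih hm hi ha hb hu hv (hj.add (hv l))
  | bin o s t ihs iht =>
    exact defPred_eval o (ihs hm hi ha hb hu hv hj) (iht hm hi ha hb hu hv hj)

/-- The instance of the shape `s` with the parameters `u` and `v` is a solution for the input `x`
with `m` propositions and size bound `B`. -/
def Solves {N : ℕ} (s : Shape N × ℕ × Finset (Fin N)) (u v : Fin N → ℕ) (x : List LearnSym)
    (m B : ℕ) : Prop :=
  Header x m B ∧ (∀ l ∈ Finset.univ, u l < m) ∧ s.2.1 + ∑ l ∈ s.2.2, v l ≤ B ∧
  ∀ i < x.length, (x[i]? = some .pos ∨ x[i]? = some .neg) →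
    ∃ a < x.length + 1, ∃ b < x.length + 1, WordAt x m i a b ∧
      (s.1.Holds (BitAt x m i a b) (a + b) u v 0 ↔ x[i]? = some .pos)

open Ctx in
theorem defPred_solves {N : ℕ} (s : Shape N × ℕ × Finset (Fin N)) {Γ : Type} [Ctx LearnSym Γ]
    {u v : Fin N → Γ → ℕ} {m B : Γ → ℕ} (hu : ∀ l, DefFun (u l)) (hv : ∀ l, DefFun (v l))
    (hm : DefFun m) (hB : DefFun B) :
    DefPred fun g => Solves s (fun l => u l g) (fun l => v l g) (inp g) (m g) (B g) := by
  refine DefPred.and (defPred_header hm hB) (DefPred.and ?_ (DefPred.and ?_ ?_))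
  · refine (DefPred.exists_mem (Set.finite_univ (α := Fin N)) (P := fun l g => ¬ u l g < m g)
      fun l _ => (DefPred.lt (hu l) hm).not).not.congr fun g => ?_
    simp
  · exact DefPred.le ((DefFun.const _).add (DefFun.sum _ fun l _ => hv l)) hB
  · refine DefPred.all .length (((DefPred.sym _ .snd).or (DefPred.sym _ .snd)).imp ?_)
    refine DefPred.ex (DefFun.length.add (.const 1)) (DefPred.ex (DefFun.length.add (.const 1)) ?_)
    refine (defPred_wordAt hm.fst.fst.fst DefFun.snd.fst.fst DefFun.snd.fst .snd).and
      (DefPred.iff ?_ (DefPred.sym _ DefFun.snd.fst.fst))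
    exact defPred_holds s.1 hm.fst.fst.fst DefFun.snd.fst.fst DefFun.snd.fst .snd
      (fun l => (hu l).fst.fst.fst) (fun l => (hv l).fst.fst.fst) (.const 0)

/-- From left to right, a solution is replaced by an equivalent instance of a shape, whose
parameters are bounded by the unary parts of the input. From right to left, the header and the words
at the marks rebuild an input with encoding `x`, and the instance is a solution because its cost
bounds its size. -/
theorem mem_LTLLearn_iff {Ut : Set UnOp} {Bl : Set BinLogOp} {n N : ℕ}
    {S : Set (Shape N × ℕ × Finset (Fin N))}
    (hS : ∀ s ∈ S, ∀ (m : ℕ) (θ : Fin N → Fin m) (κ : Fin N → ℕ),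
      (s.1.inst θ κ).UsesOnly Ut ∅ Bl ∧ (s.1.inst θ κ).numBin ≤ n ∧
      (s.1.inst θ κ).size ≤ s.2.1 + ∑ i ∈ s.2.2, κ i)
    (hS' : ∀ (m : ℕ) (φ : LTL (Fin m)), φ.UsesOnly Ut ∅ Bl → φ.numBin ≤ n →
      ∃ s ∈ S, ∃ (θ : Fin N → Fin m) (κ : Fin N → ℕ), s.2.1 + ∑ i ∈ s.2.2, κ i ≤ φ.size ∧
        (∀ i, κ i ≤ φ.size) ∧ ∀ w, LTL.Sat w (s.1.inst θ κ) ↔ LTL.Sat w φ)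
    (x : List LearnSym) : x ∈ LTLLearn Ut ∅ Bl (n : ℕ∞) ↔
      ∃ s ∈ S, ∃ v : Fin (N + N) → ℕ, (∀ l, v l < x.length + 1) ∧
        ∃ m < x.length + 1, ∃ B < x.length + 1,
          Solves s (fun l => v (Fin.castAdd N l)) (fun l => v (Fin.natAdd N l)) x m B := by
  constructor
  · rintro ⟨I, rfl, φ, h1, h2, h3, h4, h5⟩
    obtain ⟨s, hs, θ, κ, hcost, hκ, hsat⟩ := hS' _ φ h1 (by exact_mod_cast h3)
    have hlen : I.numProp + I.bound ≤ I.encode.length := by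
      rw [I.encode_eq]; simp
    -- The first half of the vector holds the propositions, the second half the exponents of `X`.
    refine ⟨s, hs, Fin.append (fun l => (θ l : ℕ)) κ, ?_, I.numProp, by omega, I.bound, by omega,
      I.header_encode, ?_, ?_, ?_⟩
    · intro l
      refine Fin.addCases (fun l => ?_) (fun l => ?_) l
      · rw [Fin.append_left]
        have := (θ l).2
        omega
      · rw [Fin.append_right]
        have := hκ l
        omega
    · intro l _
      simp only [Fin.append_left]
      exact (θ l).2
    · simp only [Fin.append_right]
      omega
    · intro i _ hi
      simp only [Fin.append_left, Fin.append_right]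
      have key : ∀ k, (k = .pos ∨ k = .neg) → I.encode[i]? = some k →
          ∃ a < I.encode.length + 1, ∃ b < I.encode.length + 1,
            WordAt I.encode I.numProp i a b ∧
            (s.1.Holds (BitAt I.encode I.numProp i a b) (a + b) (fun l => (θ l : ℕ)) κ 0 ↔
              I.encode[i]? = some .pos) := by
        intro k hk hik
        obtain ⟨w, hw, hwa, hsp⟩ := I.exists_word_of_encode hk hik
        have hlt : i + 1 + w.pre.length * (I.numProp + 1) + 1 + w.per.length * (I.numProp + 1) ≤
            I.encode.length := by
          rcases hwa.2.2.2.2 with h | h | h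
          · exact h.le
          · exact (List.getElem?_eq_some_iff.1 h).1.le
          · exact (List.getElem?_eq_some_iff.1 h).1.le
        -- A letter occupies at least one symbol, so prefix and period are no longer than the input.
        have ha := Nat.le_mul_of_pos_right w.pre.length (Nat.add_one_pos I.numProp)
        have hb := Nat.le_mul_of_pos_right w.per.length (Nat.add_one_pos I.numProp)
        refine ⟨w.pre.length, by omega, w.per.length, by omega, hwa, ?_⟩
        rw [Shape.holds_iff hsp.mem_toWord, LTL.suffix_zero, hsat, hik]
        simp only [LearnInput.marked, List.mem_append, List.mem_map, Prod.mk.injEq] at hw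
        rcases hw with ⟨w', hw', rfl, rfl⟩ | ⟨w', hw', rfl, rfl⟩
        · simp [h4 w' hw']
        · simp [h5 w' hw']
      rcases hi with hi | hi
      · exact key _ (Or.inl rfl) hi
      · exact key _ (Or.inr rfl) hi
  · rintro ⟨s, hs, v, hv, m, hm, B, hB, hx, hu, hcost, hwords⟩
    set θ : Fin N → Fin m := fun l => ⟨v (Fin.castAdd N l), hu l (Finset.mem_univ _)⟩ with hθ
    set κ : Fin N → ℕ := fun l => v (Fin.natAdd N l) with hκ
    -- The relation says that the instance classifies the word as its mark demands.
    obtain ⟨P, Q, henc, hP, hQ⟩ := hx.exists_words (m := m)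
      (fun i w => LTL.Sat w.toWord (s.1.inst θ κ) ↔ x[i]? = some .pos) (by
        intro i hi
        have hlt : i < x.length := by
          rcases hi with h | h <;> exact (List.getElem?_eq_some_iff.1 h).1
        obtain ⟨a, -, b, -, hw, hh⟩ := hwords i hlt hi
        refine ⟨a, b, hw, ?_⟩
        rintro w rfl rfl hsp
        rw [← hh, ← LTL.suffix_zero w.toWord]
        exact (Shape.holds_iff (θ := θ) hsp.mem_toWord κ s.1 0).symm)
    obtain ⟨h1, h2, h3⟩ := hS s hs m θ κ
    refine ⟨⟨m, P, Q, B⟩, henc, s.1.inst θ κ, h1, h3.trans hcost, by exact_mod_cast h2, ?_, ?_⟩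
    · intro w hw
      obtain ⟨i, hi, h⟩ := hP w hw
      exact h.2 hi
    · intro w hw
      obtain ⟨i, hi, h⟩ := hQ w hw
      rw [h, hi]
      simp

theorem mainTheorem4 (Ut : Set UnOp) (Bl : Set BinLogOp) (n : ℕ) :
    InLogspace (LTLLearn Ut ∅ Bl (n : ℕ∞)) := by
  obtain ⟨N, S, hfin, hS, hS'⟩ := exists_finite_shapes Ut Bl n
  refine DefPred.inLogspace (DefPred.congr ?_ fun x => (mem_LTLLearn_iff hS hS' x).symm)
  refine DefPred.exists_mem hfin fun s _ => DefVec.exists ?_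
  intro Γ _ f hf
  refine DefPred.ex (DefFun.length.add (.const 1)) (DefPred.ex (DefFun.length.add (.const 1)) ?_)
  exact defPred_solves s (fun l => (hf _).fst.fst) (fun l => (hf _).fst.fst) DefFun.snd.fst .snd
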